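/- Let $m\ge 2$ and let $M$ be a smooth manifold (Hausdorff, second countable; it need not be oriented) of dimension $2m+1\ge 5$, equipped with a projective structure $\mathbf p$, that is, an equivalence class of torsion-free affine connections under $$\hat\nabla_\eta\xi=\nabla_\eta\xi+\Upsilon(\eta)\xi+\Upsilon(\xi)\eta,\qquad \Upsilon\in\Gamma(T^*M).$$ For a connection $\nabla$ let $\mathrm{Ric}(v,w)=\mathrm{tr}(u\mapsto R(u,v)w)$ and let $\mathsf P(v,w)=\frac{(2m+1)\mathrm{Ric}(v,w)+\mathrm{Ric}(w,v)}{2m(2m+2)}$ be its projective Schouten tensor. Let $\mathcal E(1)$ be the bundle of projective densities of weight $1$ and $\mathcal T$ the projective tractor bundle. Each $\nabla\in\mathbf p$ identifies $\mathcal T\otimes\mathcal E(1)$ with $TM\oplus\mathbb R$; the pairs $(\nu,\rho)$ and $(\hat\nu,\hat\rho)$ given by $\nabla$ and $\hat\nabla$ are related by $(\hat\nu,\hat\rho)=(\nu,\rho-\Upsilon(\nu))$, and the tractor connection, coupled with $\nabla$ on $\mathcal E(1)$, is $\nabla^{\mathcal T}_v(\nu,\rho)=(\nabla_v\nu+\rho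 v,\ d\rho(v)-\mathsf P(v,\nu))$. Let $\mathbb J$ be a parallel tractor complex structure, i.e. a smooth section of $\mathrm{End}(\mathcal T)=\mathrm{End}(\mathcal T\otimes\mathcal E(1))$ with $\mathbb J^2=-\mathrm{id}$ that is parallel for the tractor connection, and let $k$ be its underlying vector field, i.e. the $TM$-component of $\mathbb J(0,1)$. Suppose that $k$ is a projective symmetry of $\mathbf p$, i.e. the trace-free part of $\mathcal L_k\nabla$ vanishes for $\nabla\in\mathbf p$. For an open $U\subseteq M$, a $k$-adapted scale on $U$ is a connection $\nabla\in\mathbf p|_U$ that preserves a volume form on $U$ and satisfies $\nabla_ck^c=0$. Put $H=\ker\mathsf P(\,\cdot\,,k)\subset TU$ for such $\nabla$. A local leaf space of $k$ is a smooth surjective submersion $\pi:U\to\widetilde M$ with connected fibres from an open subset $U\subseteq M$ onto a smooth manifold $\widetilde M$ of dimension $2m$ such that $\ker T_x\pi=\langle k_x\rangle$ for all $x\in U$. Let $\pi:U\to\widetilde M$ be a local leaf space of $k$. Then: 1. Every point of $U$ has an open neighbourhood $V\subseteq U$ such that every open subset of $V$ admits a $k$-adapted scale. 2. Suppose that $U$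 is so small that it admits a $k$-adapted scale. Then: (a) For every $k$-adapted scale $\nabla$ on $U$ and every $x\in U$, the map $T_x\pi$ restricts to a bijection $H_x\to T_{\pi(x)}\widetilde M$. (b) There is an integrable complex structure $\tilde J$ on $\widetilde M$ (a smooth endomorphism field of $T\widetilde M$ with $\tilde J^2=-\mathrm{id}$ and vanishing Nijenhuis tensor) such that, for every $k$-adapted scale $\nabla$ on $U$, the map $\nabla k$ preserves $H$ and $\nabla k|_H$ descends to $\tilde J$: $T_x\pi(\nabla_hk)=\tilde J(T_x\pi\, h)$ for all $x\in U$, $h\in H_x$. For each single $k$-adapted scale, $\tilde J$ is the only endomorphism field on $\widetilde M$ to which $\nabla k|_H$ descends. (c) Every $k$-adapted scale $\nabla$ on $U$ induces an affine connection $\widetilde\nabla$ on $\widetilde M$, characterised by $\widetilde\nabla_{T\pi h}\tilde\xi=T\pi(\nabla_h\xi)$ for $h\in H$ and every local vector field $\tilde\xi$ on $\widetilde M$ with horizontal lift $\xi\in\Gamma(H)$. (d) There is exactly one c-projective structure on $(\widetilde M,\tilde J)$ that contains all the connections $\widetilde\nabla$ induced by $k$-adapted scales on $U$. Here a c-projective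 structure is an equivalence class of torsion-free affine connections $\widetilde\nabla$ with $\widetilde\nabla\tilde J=0$ under $$\widetilde\nabla'_{\tilde\eta}\tilde\xi=\widetilde\nabla_{\tilde\eta}\tilde\xi+\tilde\Upsilon(\tilde\eta)\tilde\xi+\tilde\Upsilon(\tilde\xi)\tilde\eta-\tilde\Upsilon(\tilde J\tilde\eta)\tilde J\tilde\xi-\tilde\Upsilon(\tilde J\tilde\xi)\tilde J\tilde\eta,\qquad\tilde\Upsilon\in\Gamma(T^*\widetilde M).$$ -/

import Mathlib

open scoped Manifold ContDiff Bundle Topology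

noncomputable section

namespace ProjGeom

/-! ### Vector fields, one-forms and affine connections

All objects are defined on the whole manifold and are only constrained on an open set `U`; the
values outside `U` are irrelevant.  `cov σ x v` stands for `(∇_v σ)(x)`. -/

section Basic

variable {n : ℕ} {M : Type*} [TopologicalSpace M] [ChartedSpace (EuclideanSpace ℝ (Fin n)) M]

variable (n M) in
/-- (Not necessarily continuous) vector fields on an `n`-dimensional manifold. -/
abbrev VField : Type _ := Π x : M, TangentSpace (𝓡 n) x

variable (n M) in
/-- (Not necessarily continuous) one-forms on an `n`-dimensional manifold. -/
abbrev OneForm : Type _ := Π x : M, TangentSpace (𝓡 n) x →L[ℝ] ℝ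

variable (n M) in
/-- Fields of endomorphisms of the tangent spaces. -/
abbrev EndField : Type _ := Π x : M, TangentSpace (𝓡 n) x →L[ℝ] TangentSpace (𝓡 n) x

variable (n M) in
/-- The operators `σ ↦ ∇ σ` on vector fields, among which the affine connections are singled out
below. -/
abbrev ConnOp : Type _ := VField n M → EndField n M

variable [IsManifold (𝓡 n) ∞ M]

/-- `X` is a smooth vector field on `U`. -/
def VField.SmoothOn (X : VField n M) (U : Set M) : Prop :=
  ContMDiffOn (𝓡 n) ((𝓡 n).prod 𝓘(ℝ, EuclideanSpace ℝ (Fin n))) ∞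
    (fun x => (⟨x, X x⟩ : TangentBundle (𝓡 n) M)) U

/-- `X` is differentiable at the point `x`. -/
def VField.DiffAt (X : VField n M) (x : M) : Prop :=
  MDifferentiableAt (𝓡 n) ((𝓡 n).prod 𝓘(ℝ, EuclideanSpace ℝ (Fin n)))
    (fun x => (⟨x, X x⟩ : TangentBundle (𝓡 n) M)) x

/-- `f` is a smooth function on `U`. -/
def SmoothFunOn (n : ℕ) {M : Type*} [TopologicalSpace M]
    [ChartedSpace (EuclideanSpace ℝ (Fin n)) M] (f : M → ℝ) (U : Set M) : Prop :=
  ContMDiffOn (𝓡 n) 𝓘(ℝ, ℝ) ∞ f U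

/-- `θ` is a smooth one-form on `U`: it is smooth on all smooth local vector fields. -/
def OneForm.SmoothOn (θ : OneForm n M) (U : Set M) : Prop :=
  ∀ W : Set M, IsOpen W → W ⊆ U → ∀ X : VField n M, X.SmoothOn W →
    SmoothFunOn n (fun x => θ x (X x)) W

/-- `A` is a smooth endomorphism field: it preserves smoothness of local vector fields. -/
def EndField.Smooth (A : EndField n M) : Prop :=
  ∀ W : Set M, IsOpen W → ∀ X : VField n M, X.SmoothOn W →
    VField.SmoothOn (fun x => A x (X x)) W

/-- `cov` is a smooth affine connection (a linear connection on the tangent bundle) over `U`. -/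
structure IsAffineConnOn (cov : ConnOp n M) (U : Set M) : Prop where
  isCov : IsCovariantDerivativeOn (EuclideanSpace ℝ (Fin n)) cov U
  smooth : ContMDiffCovariantDerivativeOn (EuclideanSpace ℝ (Fin n)) ∞ cov U

/-- `∇_X Y - ∇_Y X = [X, Y]` on `U`. -/
def IsTorsionFreeOn (cov : ConnOp n M) (U : Set M) : Prop :=
  ∀ X Y : VField n M, ∀ x ∈ U, X.DiffAt x → Y.DiffAt x →
    cov Y x (X x) - cov X x (Y x) = VectorField.mlieBracket (𝓡 n) X Y x

/-- The curvature `∇_X ∇_Y Z - ∇_Y ∇_X Z - ∇_[X,Y] Z`. -/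
def curvature (cov : ConnOp n M) (X Y Z : VField n M) : VField n M := fun x =>
  cov (fun y => cov Z y (Y y)) x (X x) - cov (fun y => cov Z y (X y)) x (Y x)
    - cov Z x (VectorField.mlieBracket (𝓡 n) X Y x)

/-- A local vector field, smooth near `x`, with value `v` at `x`. -/
def localExt {x : M} (v : TangentSpace (𝓡 n) x) : VField n M :=
  FiberBundle.extend (EuclideanSpace ℝ (Fin n)) v

/-- The Ricci tensor `Ric(v, w) = tr (u ↦ R(u, v) w)` at `x`. As the curvature is tensorial, it may
be evaluated on any local extensions of tangent vectors; the trace is written out in a basis. -/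
def ricci (cov : ConnOp n M) (x : M) (v w : TangentSpace (𝓡 n) x) : ℝ :=
  let b : Module.Basis (Fin n) ℝ (TangentSpace (𝓡 n) x) :=
    (EuclideanSpace.basisFun (Fin n) ℝ).toBasis
  ∑ i, b.repr (curvature cov (localExt (b i)) (localExt v) (localExt w) x) i

/-- The projective Schouten tensor in dimension `n`:
`P(v, w) = (n Ric(v, w) + Ric(w, v)) / ((n - 1) (n + 1))`. -/
def schouten (cov : ConnOp n M) (x : M) (v w : TangentSpace (𝓡 n) x) : ℝ :=
  (n * ricci cov x v w + ricci cov x w v) / (((n : ℝ) - 1) * ((n : ℝ) + 1))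

/-- The divergence `∇_c k^c`, that is, the trace of `v ↦ ∇_v k`. -/
def divergence (cov : ConnOp n M) (k : VField n M) (x : M) : ℝ :=
  LinearMap.trace ℝ (TangentSpace (𝓡 n) x) (cov k x).toLinearMap

/-- The connection is special on `U`: it preserves a volume form on `U`. -/
def IsSpecialOn (cov : ConnOp n M) (U : Set M) : Prop :=
  ∃ μ : Π x : M, (TangentSpace (𝓡 n) x) [⋀^Fin n]→ₗ[ℝ] ℝ,
    (∀ x ∈ U, μ x ≠ 0) ∧
    ∀ W : Set M, IsOpen W → W ⊆ U → ∀ X : Fin n → VField n M, (∀ i, (X i).SmoothOn W) →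
      SmoothFunOn n (fun x => μ x (fun i => X i x)) W ∧
      ∀ x ∈ W, ∀ v : TangentSpace (𝓡 n) x,
        mvfderiv (𝓡 n) (fun y => μ y (fun i => X i y)) x v
          = ∑ i, μ x (Function.update (fun j => X j x) i (cov (X i) x v))

/-! ### Projective structures -/

/-- `∇'_v σ = ∇_v σ + Υ(v) σ + Υ(σ) v` on `U`. -/
def IsProjChangeOn (U : Set M) (cov : ConnOp n M) (Υ : OneForm n M) (cov' : ConnOp n M) : Prop :=
  ∀ σ : VField n M, ∀ x ∈ U, σ.DiffAt x → ∀ v : TangentSpace (𝓡 n) x,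
    cov' σ x v = cov σ x v + Υ x v • σ x + Υ x (σ x) • v

/-- Projective equivalence over `U` of torsion-free affine connections. -/
def ProjEquivOn (U : Set M) (cov cov' : ConnOp n M) : Prop :=
  ∃ Υ : OneForm n M, Υ.SmoothOn U ∧ IsProjChangeOn U cov Υ cov'

variable (n M) in
/-- A projective structure: an equivalence class of projectively equivalent torsion-free affine
connections on `M`. -/
structure ProjStructure where
  carrier : Set (ConnOp n M)
  isClass : ∃ cov₀ : ConnOp n M, IsAffineConnOn cov₀ Set.univ ∧ IsTorsionFreeOn cov₀ Set.univ ∧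
    carrier = {cov | IsAffineConnOn cov Set.univ ∧ IsTorsionFreeOn cov Set.univ ∧
      ProjEquivOn Set.univ cov₀ cov}

/-- The restriction of a projective structure to an open set `U`, as a class of torsion-free affine
connections on `U`. -/
def ProjStructure.restrict (p : ProjStructure n M) (U : Set M) :
    Set (ConnOp n M) :=
  {cov | IsAffineConnOn cov U ∧ IsTorsionFreeOn cov U ∧
    ∃ cov₀ ∈ p.carrier, ProjEquivOn U cov₀ cov}

/-- The Lie derivative of a connection,
`(L_k ∇)(X, Y) = [k, ∇_X Y] - ∇_[k,X] Y - ∇_X [k, Y]`. -/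
def lieDerivConn (cov : ConnOp n M) (k X Y : VField n M) : VField n M := fun x =>
  VectorField.mlieBracket (𝓡 n) k (fun y => cov Y y (X y)) x
    - cov Y x (VectorField.mlieBracket (𝓡 n) k X x)
    - cov (VectorField.mlieBracket (𝓡 n) k Y) x (X x)

/-- `k` is a projective symmetry: for the connections `∇` of the class, the trace-free part of the
(symmetric) tensor `L_k ∇` vanishes, that is, `(L_k ∇)(X, Y) = θ(X) Y + θ(Y) X`. -/
def IsProjSymmetry (p : ProjStructure n M) (k : VField n M) : Prop :=
  ∀ cov ∈ p.carrier, ∀ x : M, ∃ θ : TangentSpace (𝓡 n) x →L[ℝ] ℝ,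
    ∀ W : Set M, IsOpen W → x ∈ W → ∀ X Y : VField n M, X.SmoothOn W → Y.SmoothOn W →
      lieDerivConn cov k X Y x = θ (X x) • Y x + θ (Y x) • X x

/-- `∇` is a `k`-adapted scale over `U`: a special connection in the restricted projective class
for which `k` is divergence-free. -/
def IsAdaptedScaleOn (p : ProjStructure n M) (k : VField n M) (U : Set M)
    (cov : ConnOp n M) : Prop :=
  cov ∈ p.restrict U ∧ IsSpecialOn cov U ∧ ∀ x ∈ U, divergence cov k x = 0

end Basic

/-! ### The tractor bundle and its connection

The tractor bundle `T` is handled through `T ⊗ E(1)`, where `E(1)` is the line bundle of projective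
densities of weight one. A choice of `∇` in the projective class identifies `T ⊗ E(1)` with
`TM ⊕ ℝ`, and the pairs belonging to `∇` and to `∇' = ∇ + Υ` are related by
`(ν', ρ') = (ν, ρ - Υ(ν))`. Since `E(1)` is a line bundle, `End T = End (T ⊗ E(1))`. -/

section Tractor

variable {n : ℕ} {M : Type*} [TopologicalSpace M] [ChartedSpace (EuclideanSpace ℝ (Fin n)) M]
  [IsManifold (𝓡 n) ∞ M]

theorem localExt_diffAt {x : M} (v : TangentSpace (𝓡 n) x) :
    (localExt v).DiffAt x :=
  FiberBundle.mdifferentiableAt_extend (𝓡 n) (EuclideanSpace ℝ (Fin n)) v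

theorem localExt_self {x : M} (v : TangentSpace (𝓡 n) x) : localExt v x = v :=
  FiberBundle.extend_apply_self (F := EuclideanSpace ℝ (Fin n)) v

/-- The one-form of a projective change is determined by the two connections. -/
theorem IsProjChangeOn.unique {U : Set M} {cov cov' : ConnOp n M}
    {Υ Υ' : OneForm n M} (h : IsProjChangeOn U cov Υ cov') (h' : IsProjChangeOn U cov Υ' cov')
    {x : M} (hx : x ∈ U) (v : TangentSpace (𝓡 n) x) : Υ x v = Υ' x v := by
  by_cases hv : v = 0
  · simp [hv]
  have e := (h (localExt v) x hx (localExt_diffAt v) v).symm.trans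
    (h' (localExt v) x hx (localExt_diffAt v) v)
  rw [localExt_self, add_assoc, add_assoc, add_right_inj, ← add_smul, ← add_smul] at e
  have := smul_left_injective ℝ hv e
  linarith

theorem IsProjChangeOn.trans {U : Set M} {c₁ c₂ c₃ : ConnOp n M} {Υ Υ' : OneForm n M}
    (h : IsProjChangeOn U c₁ Υ c₂) (h' : IsProjChangeOn U c₂ Υ' c₃) :
    IsProjChangeOn U c₁ (fun x => Υ x + Υ' x) c₃ := by
  intro σ x hx hσ v
  rw [h' σ x hx hσ v, h σ x hx hσ v]
  simp only [add_apply, add_smul]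
  abel

theorem ProjStructure.exists_change (p : ProjStructure n M) (c c' : p.carrier) :
    ∃ Υ : OneForm n M, Υ.SmoothOn Set.univ ∧ IsProjChangeOn Set.univ c.1 Υ c'.1 := by
  obtain ⟨c₀, -, -, hp⟩ := p.isClass
  obtain ⟨-, -, Υ, hs, h⟩ := hp.subset c.2
  obtain ⟨-, -, Υ', hs', h'⟩ := hp.subset c'.2
  refine ⟨fun x => Υ' x - Υ x, fun W hW hWU X hX => ?_, fun σ x hx hσ v => ?_⟩
  · exact (hs' W hW hWU X hX).sub (hs W hW hWU X hX)
  · rw [h' σ x hx hσ v, h σ x hx hσ v]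
    simp only [sub_apply, sub_smul]
    abel

theorem ProjStructure.nonempty (p : ProjStructure n M) : Nonempty p.carrier := by
  obtain ⟨c₀, h₁, h₂, hp⟩ := p.isClass
  refine ⟨c₀, hp.symm.subset ?_⟩
  refine ⟨h₁, h₂, fun _ => 0, fun W _ _ X _ => ?_, fun σ x _ _ v => by simp⟩
  exact contMDiffOn_const

/-- The fibre of `T ⊗ E(1)` at `x`. -/
def TractorFibre (p : ProjStructure n M) (x : M) :
    Submodule ℝ (p.carrier → TangentSpace (𝓡 n) x × ℝ) where
  carrier := {t | ∀ c c' : p.carrier, ∀ Υ : OneForm n M, IsProjChangeOn Set.univ c.1 Υ c'.1 →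
    t c' = ((t c).1, (t c).2 - Υ x (t c).1)}
  add_mem' := by
    intro a b ha hb c c' Υ h
    ext1
    · simp [ha c c' Υ h, hb c c' Υ h]
    · simp only [Pi.add_apply, Prod.snd_add, Prod.fst_add, ha c c' Υ h, hb c c' Υ h, map_add]
      ring
  zero_mem' := by
    intro c c' Υ _
    ext1 <;> simp
  smul_mem' := by
    intro r a ha c c' Υ h
    ext1
    · simp [ha c c' Υ h]
    · simp only [Pi.smul_apply, Prod.smul_snd, Prod.smul_fst, ha c c' Υ h, map_smul, smul_eq_mul]
      ring

/-- The identification of the fibre of `T ⊗ E(1)` with `T_x M ⊕ ℝ` by means of a connection in the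
projective class. -/
def tractorSplit (p : ProjStructure n M) (c : p.carrier) (x : M) :
    TractorFibre p x ≃ₗ[ℝ] TangentSpace (𝓡 n) x × ℝ :=
  LinearEquiv.ofBijective ((LinearMap.proj c).comp (TractorFibre p x).subtype) (by
    constructor
    · intro a b hab
      have hab' : a.1 c = b.1 c := hab
      apply Subtype.ext
      funext c'
      obtain ⟨Υ, -, h⟩ := p.exists_change c c'
      rw [a.2 c c' Υ h, b.2 c c' Υ h, hab']
    · intro t
      choose Υ _ hΥ using fun c' => p.exists_change c c'
      refine ⟨⟨fun c' => (t.1, t.2 - Υ c' x t.1), ?_⟩, ?_⟩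
      · intro c₁ c₂ Υ' h
        have e := (hΥ c₂).unique ((hΥ c₁).trans h) (Set.mem_univ x) t.1
        ext1
        · rfl
        · simp only [e, add_apply]
          ring
      · have e : Υ c x t.1 = 0 := by
          have h0 : IsProjChangeOn Set.univ c.1 (fun _ => 0) c.1 := fun σ x _ _ v => by simp
          simpa using (hΥ c).unique h0 (Set.mem_univ x) t.1
        ext1
        · rfl
        · change t.2 - Υ c x t.1 = t.2
          rw [e, sub_zero])

/-- The canonical section `X` of `T ⊗ E(1)`, equal to `(0, 1)` in every splitting. -/
def canonicalTractor (p : ProjStructure n M) (x : M) : TractorFibre p x :=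
  ⟨fun _ => (0, 1), fun c c' Υ _ => by simp⟩

/-- The canonical projection `Z : T ⊗ E(1) → TM`, given by `(ν, ρ) ↦ ν` in every splitting. -/
def tractorProj (p : ProjStructure n M) (x : M) : TractorFibre p x →ₗ[ℝ] TangentSpace (𝓡 n) x :=
  (LinearMap.fst ℝ _ _).comp (tractorSplit p p.nonempty.some x).toLinearMap

theorem tractorProj_eq (p : ProjStructure n M) (c : p.carrier) (x : M) (t : TractorFibre p x) :
    tractorProj p x t = (tractorSplit p c x t).1 := by
  obtain ⟨Υ, -, h⟩ := p.exists_change c p.nonempty.some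
  have e : (t.1 p.nonempty.some).1 = (t.1 c).1 := by rw [t.2 c p.nonempty.some Υ h]
  exact e

/-- (Not necessarily continuous) sections of `T ⊗ E(1)`. -/
abbrev TractorSec (p : ProjStructure n M) : Type _ := Π x : M, TractorFibre p x

/-- A section of `T ⊗ E(1)` is smooth on `W` if its components in all splittings are. -/
def TractorSec.SmoothOn {p : ProjStructure n M} (s : TractorSec p) (W : Set M) : Prop :=
  ∀ c : p.carrier, VField.SmoothOn (fun x => (tractorSplit p c x (s x)).1) W ∧
    SmoothFunOn n (fun x => (tractorSplit p c x (s x)).2) W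

/-- The tractor connection on `T`, coupled with the connection `c` in the projective class so as to
act on sections of `T ⊗ E(1)`: in the splitting given by `c`,
`∇_v (ν, ρ) = (∇_v ν + ρ v, dρ(v) - P(v, ν))`. -/
def tractorConn (p : ProjStructure n M) (c : p.carrier) (s : TractorSec p) (x : M)
    (v : TangentSpace (𝓡 n) x) : TractorFibre p x :=
  (tractorSplit p c x).symm
    (c.1 (fun y => (tractorSplit p c y (s y)).1) x v + (tractorSplit p c x (s x)).2 • v,
      mvfderiv (𝓡 n) (fun y => (tractorSplit p c y (s y)).2) x v
        - schouten c.1 x v (tractorSplit p c x (s x)).1)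

/-- Endomorphism fields of the tractor bundle `T`, equivalently of `T ⊗ E(1)`. -/
abbrev TractorEnd (p : ProjStructure n M) : Type _ := Π x : M, Module.End ℝ (TractorFibre p x)

/-- A parallel tractor complex structure: a smooth section `J` of `End T` with `J² = -1` which is
parallel for the tractor connection. Two connections on `T ⊗ E(1)` that are obtained from the
tractor connection by coupling with different connections on `E(1)` differ by a scalar one-form, so
`J` is parallel if and only if it commutes with any of them. -/
structure IsParallelTractorComplexStructure (p : ProjStructure n M) (J : TractorEnd p) :
    Prop where
  smooth : ∀ W : Set M, IsOpen W → ∀ s : TractorSec p, s.SmoothOn W →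
    TractorSec.SmoothOn (fun x => J x (s x)) W
  sq : ∀ x, J x * J x = -1
  parallel : ∀ c : p.carrier, ∀ W : Set M, IsOpen W → ∀ s : TractorSec p, s.SmoothOn W →
    ∀ x ∈ W, ∀ v : TangentSpace (𝓡 n) x,
      tractorConn p c (fun y => J y (s y)) x v = J x (tractorConn p c s x v)

/-- The vector field `k = Z J X` underlying a tractor endomorphism. -/
def underlyingField (p : ProjStructure n M) (J : TractorEnd p) : VField n M := fun x =>
  tractorProj p x (J x (canonicalTractor p x))

end Tractor

/-! ### Complex structures and c-projective structures -/

section CProjective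

variable {n : ℕ} {N : Type*} [TopologicalSpace N] [ChartedSpace (EuclideanSpace ℝ (Fin n)) N]
  [IsManifold (𝓡 n) ∞ N]

/-- The Nijenhuis tensor of `J` vanishes. -/
def IsIntegrable (J : EndField n N) : Prop :=
  ∀ W : Set N, IsOpen W → ∀ X Y : VField n N, X.SmoothOn W → Y.SmoothOn W → ∀ x ∈ W,
    VectorField.mlieBracket (𝓡 n) (fun y => J y (X y)) (fun y => J y (Y y)) x
      - J x (VectorField.mlieBracket (𝓡 n) (fun y => J y (X y)) Y x)
      - J x (VectorField.mlieBracket (𝓡 n) X (fun y => J y (Y y)) x)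
      - VectorField.mlieBracket (𝓡 n) X Y x = 0

/-- An integrable almost complex structure. -/
structure IsComplexStructure (J : EndField n N) : Prop where
  smooth : J.Smooth
  sq : ∀ x v, J x (J x v) = -v
  integrable : IsIntegrable J

/-- `∇ J = 0`. -/
def IsComplexConn (J : EndField n N) (cov : ConnOp n N) : Prop :=
  ∀ σ : VField n N, ∀ x, σ.DiffAt x → ∀ v : TangentSpace (𝓡 n) x,
    cov (fun y => J y (σ y)) x v = J x (cov σ x v)

/-- C-projective equivalence of torsion-free complex connections:
`∇'_v σ = ∇_v σ + Υ(v) σ + Υ(σ) v - Υ(J v) J σ - Υ(J σ) J v` for a smooth one-form `Υ`. -/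
def CProjEquiv (J : EndField n N) (cov cov' : ConnOp n N) : Prop :=
  ∃ Υ : OneForm n N, Υ.SmoothOn Set.univ ∧
    ∀ σ : VField n N, ∀ x, σ.DiffAt x → ∀ v : TangentSpace (𝓡 n) x,
      cov' σ x v = cov σ x v + Υ x v • σ x + Υ x (σ x) • v
        - Υ x (J x v) • J x (σ x) - Υ x (J x (σ x)) • J x v

/-- `cov` is a smooth torsion-free affine connection on `N` with `∇ J = 0`. -/
structure IsTorsionFreeComplexConn (J : EndField n N)
    (cov : ConnOp n N) : Prop where
  affine : IsAffineConnOn cov Set.univ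
  torsionFree : IsTorsionFreeOn cov Set.univ
  complex : IsComplexConn J cov

/-- A c-projective structure on the complex manifold `(N, J)`: an equivalence class of
c-projectively equivalent torsion-free complex connections. -/
structure CProjStructure (J : EndField n N) where
  carrier : Set (ConnOp n N)
  isClass : ∃ cov₀ : ConnOp n N, IsTorsionFreeComplexConn J cov₀ ∧
    carrier = {cov | IsTorsionFreeComplexConn J cov ∧ CProjEquiv J cov₀ cov}

end CProjective

/-! ### Local leaf spaces and the induced structures -/

section LeafSpace

variable {n r : ℕ} {M : Type*} [TopologicalSpace M] [ChartedSpace (EuclideanSpace ℝ (Fin n)) M]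
  [IsManifold (𝓡 n) ∞ M]
  {N : Type*} [TopologicalSpace N] [ChartedSpace (EuclideanSpace ℝ (Fin r)) N]
  [IsManifold (𝓡 r) ∞ N]

variable (r) in
/-- `prj : U → N` is a local leaf space of the vector field `k`: `U` is open and `prj` is a smooth
surjective submersion with `ker T_x prj = ⟨k_x⟩`, whose fibres are connected (so that they are the
leaves of the foliation of `U` by the integral curves of `k`). -/
structure IsLocalLeafSpace (k : VField n M) (U : Set M) (prj : M → N) : Prop where
  isOpen : IsOpen U
  smooth : ContMDiffOn (𝓡 n) (𝓡 r) ∞ prj U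
  surjective : prj '' U = Set.univ
  submersion : ∀ x ∈ U, Function.Surjective (mfderiv (𝓡 n) (𝓡 r) prj x)
  ker : ∀ x ∈ U, ∀ v : TangentSpace (𝓡 n) x,
    mfderiv (𝓡 n) (𝓡 r) prj x v = 0 ↔ ∃ a : ℝ, v = a • k x
  connected : ∀ y : N, IsPreconnected (U ∩ prj ⁻¹' {y})

/-- The hyperplane `H_x = ker ν_x`, where `ν(v) = - P(v, k)`. -/
def horizontal (k : VField n M) (cov : ConnOp n M) (x : M) : Set (TangentSpace (𝓡 n) x) :=
  {v | -schouten cov x v (k x) = 0}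

variable (r) in
/-- `T_x prj` restricts to a bijection from `H_x` onto the tangent space of the leaf space. -/
def HorizontalBijOn (k : VField n M) (U : Set M) (prj : M → N) (cov : ConnOp n M) : Prop :=
  ∀ x ∈ U, Set.BijOn (mfderiv (𝓡 n) (𝓡 r) prj x) (horizontal k cov x) Set.univ

/-- `∇ k` restricts to an endomorphism of `H`, and this restriction descends along `prj` to `J`. -/
def InducesEnd (k : VField n M) (U : Set M) (prj : M → N) (cov : ConnOp n M)
    (J : EndField r N) : Prop :=
  ∀ x ∈ U, ∀ h ∈ horizontal k cov x, cov k x h ∈ horizontal k cov x ∧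
    mfderiv (𝓡 n) (𝓡 r) prj x (cov k x h) = J (prj x) (mfderiv (𝓡 n) (𝓡 r) prj x h)

/-- The affine connection `covN` on `N` is the descent along `prj` of the connection on `H` obtained
by projecting `∇` to `H` along `k`: for a local vector field `Y` on `N` with horizontal lift `X`,
`(covN)_{Tprj h} Y = Tprj (∇_h X)` for all horizontal `h`. -/
def InducesConn (k : VField n M) (U : Set M) (prj : M → N)
    (cov : ConnOp n M) (covN : ConnOp r N) : Prop :=
  IsAffineConnOn covN Set.univ ∧
  ∀ W : Set N, IsOpen W → ∀ Y : VField r N, Y.SmoothOn W → ∀ X : VField n M,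
    (∀ x ∈ U ∩ prj ⁻¹' W, X x ∈ horizontal k cov x ∧ mfderiv (𝓡 n) (𝓡 r) prj x (X x) = Y (prj x)) →
    ∀ x ∈ U ∩ prj ⁻¹' W, ∀ h ∈ horizontal k cov x,
      covN Y (prj x) (mfderiv (𝓡 n) (𝓡 r) prj x h) = mfderiv (𝓡 n) (𝓡 r) prj x (cov X x h)

end LeafSpace

end ProjGeom

end

open ProjGeom

noncomputable section

namespace ProjGeom

set_option linter.unusedSectionVars false

/-! ### Vector field calculus -/

section VectorFieldCalculus

variable {n r : ℕ} {M : Type*} [TopologicalSpace M] [ChartedSpace (EuclideanSpace ℝ (Fin n)) M]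
  [IsManifold (𝓡 n) ∞ M]
  {N : Type*} [TopologicalSpace N] [ChartedSpace (EuclideanSpace ℝ (Fin r)) N]
  [IsManifold (𝓡 r) ∞ N]
  {F : Type*} [NormedAddCommGroup F] [NormedSpace ℝ F]

/-! Write `n = 2m + 1`, `A = ∇k` and `τ = P(·, k)`. Differentiating `𝕁(0,1) = (k, b)` with the
tractor connection gives `𝕁(v,0) = (A v + b v, db(v) - τ(v))`. Since `𝕁² = -1` forces trace zero,
`div k = -(n + 1) b`, so for an adapted scale `𝕁(v,b) = (A v + b k, -τ(v))`. The blocks of `𝕁² = -1`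
then say `A k = 0` and `A² = -1 + τ ⊗ k`, whence `τ(k) = 1` and `τ ∘ A = 0` where `k ≠ 0`. Thus `H =
ker τ` is a complement of `k` on which `A` is a complex structure, and `∇𝕁 = 0` gives `∇A = 0` on
`H` modulo `k` (`IsParallelTractorComplexStructure.isScaleData`).

Descent needs invariance under `k`. The symmetry condition gives `L_k ∇ = θ ⊙ id`; tracing against
the parallel volume form, with `div k = 0`, yields `(n + 1) θ = 0`
(`IsProjSymmetry.lieDerivConn_eq_zero`). So `A` and `τ` are invariant too, horizontal lifts commute
with `k`, and the fields built from them project to the leaf space because functions killed by `k`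
are constant on the connected fibres (`IsLocalLeafSpace.descField_apply`,
`IsLocalLeafSpace.eq_descend`). The descended connection is torsion-free and preserves the descended
`J`, which is therefore integrable.

If two adapted scales differ by `Υ`, equality of divergences gives `Υ(k) = 0`; then `A' = A + Υ ⊗ k`
and `τ' = τ + Υ ∘ A`, and the horizontal lift of `w` changes by `-Υ(A w) k`. Hence `J` does not
change, and inserting the new lifts into `∇'` produces exactly the two `J`-terms of a c-projective
change (`IsInvariantScaleData.descendedConn_change`). The form descends because `Υ = -τ' ∘ A` on
`H`.

Adapted scales exist near every point: a frame made of `k` and lifts of coordinate fields spans a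
volume invariant under `k`, and some connection of the projective class preserves it
(`IsLocalLeafSpace.exists_adaptedScale`). -/

instance finiteDimensional_tangentSpace (x : M) : FiniteDimensional ℝ (TangentSpace (𝓡 n) x) :=
  inferInstanceAs (FiniteDimensional ℝ (EuclideanSpace ℝ (Fin n)))

instance t2Space_tangentSpace (x : M) : T2Space (TangentSpace (𝓡 n) x) :=
  inferInstanceAs (T2Space (EuclideanSpace ℝ (Fin n)))

theorem finrank_tangentSpace (x : M) : Module.finrank ℝ (TangentSpace (𝓡 n) x) = n :=
  (finrank_euclideanSpace (𝕜 := ℝ) (ι := Fin n)).trans (Fintype.card_fin n)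

namespace VField

variable {X Y : VField n M} {U W : Set M} {x : M}

theorem SmoothOn.mono (hX : X.SmoothOn U) (h : W ⊆ U) : X.SmoothOn W :=
  ContMDiffOn.mono hX h

theorem SmoothOn.congr (hX : X.SmoothOn U) (h : ∀ x ∈ U, Y x = X x) : Y.SmoothOn U :=
  ContMDiffOn.congr hX fun x hx => by rw [h x hx]

theorem SmoothOn.add (hX : X.SmoothOn U) (hY : Y.SmoothOn U) :
    VField.SmoothOn (fun x => X x + Y x) U :=
  ContMDiffOn.add_section hX hY

theorem SmoothOn.sub (hX : X.SmoothOn U) (hY : Y.SmoothOn U) :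
    VField.SmoothOn (fun x => X x - Y x) U :=
  ContMDiffOn.sub_section hX hY

theorem SmoothOn.smul {f : M → ℝ} (hf : SmoothFunOn n f U) (hX : X.SmoothOn U) :
    VField.SmoothOn (fun x => f x • X x) U :=
  ContMDiffOn.smul_section hf hX

theorem SmoothOn.sum {ι : Type*} {s : Finset ι} {X : ι → VField n M}
    (hX : ∀ i ∈ s, (X i).SmoothOn U) : VField.SmoothOn (fun x => ∑ i ∈ s, X i x) U :=
  ContMDiffOn.sum_section hX

theorem smoothOn_zero : VField.SmoothOn (fun x => (0 : TangentSpace (𝓡 n) x)) U :=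
  (Bundle.contMDiff_zeroSection ℝ (TangentSpace (𝓡 n) : M → Type _)).contMDiffOn

theorem SmoothOn.diffAt (hX : X.SmoothOn U) (hU : IsOpen U) (hx : x ∈ U) : X.DiffAt x :=
  (hX.contMDiffAt (hU.mem_nhds hx)).mdifferentiableAt (by simp)

theorem smoothOn_of_locally
    (h : ∀ x ∈ U, ∃ V : Set M, IsOpen V ∧ x ∈ V ∧ X.SmoothOn V) : X.SmoothOn U := fun x hx =>
  let ⟨_, hV, hxV, hXV⟩ := h x hx
  (hXV.contMDiffAt (hV.mem_nhds hxV)).contMDiffWithinAt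

theorem DiffAt.congr (hX : X.DiffAt x) (h : ∀ᶠ y in 𝓝 x, Y y = X y) : Y.DiffAt x :=
  MDifferentiableAt.congr_of_eventuallyEq hX
    (h.mono fun y hy => congrArg (Bundle.TotalSpace.mk y) hy)

theorem DiffAt.add (hX : X.DiffAt x) (hY : Y.DiffAt x) : VField.DiffAt (fun x => X x + Y x) x :=
  mdifferentiableAt_add_section hX hY

theorem DiffAt.smul {f : M → ℝ} (hf : MDifferentiableAt (𝓡 n) 𝓘(ℝ, ℝ) f x) (hX : X.DiffAt x) :
    VField.DiffAt (fun x => f x • X x) x :=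
  MDifferentiableAt.smul_section hf hX

theorem DiffAt.sum {ι : Type*} {s : Finset ι} {X : ι → VField n M}
    (hX : ∀ i ∈ s, (X i).DiffAt x) : VField.DiffAt (fun x => ∑ i ∈ s, X i x) x :=
  MDifferentiableAt.sum_section hX

theorem SmoothOn.mlieBracket (hU : IsOpen U) (hX : X.SmoothOn U) (hY : Y.SmoothOn U) :
    VField.SmoothOn (VectorField.mlieBracket (𝓡 n) X Y) U := by
  have : IsManifold (𝓡 n) (minSmoothness ℝ 2) M := by
    rw [minSmoothness_of_isRCLikeNormedField]; infer_instance
  have : IsManifold (𝓡 n) (((⊤ : ℕ∞) : WithTop ℕ∞) + 1) M := by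
    have h : ((⊤ : ℕ∞) : WithTop ℕ∞) + 1 = ∞ := rfl
    rw [h]; infer_instance
  intro x hx
  refine (ContMDiffAt.mlieBracket_vectorField (n := ⊤) (m := ⊤)
    (hX.contMDiffAt (hU.mem_nhds hx)) (hY.contMDiffAt (hU.mem_nhds hx)) ?_).contMDiffWithinAt
  rw [minSmoothness_of_isRCLikeNormedField]
  exact le_rfl

end VField

/-- The extension has constant coordinates in the trivialization at `x`, so the base set of that
trivialization serves for all `v` at once. -/
theorem exists_localExt_smoothOn (x : M) : ∃ V : Set M, IsOpen V ∧ x ∈ V ∧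
    ∀ v : TangentSpace (𝓡 n) x, (localExt v).SmoothOn V := by
  set t := trivializationAt (EuclideanSpace ℝ (Fin n)) (TangentSpace (𝓡 n) : M → Type _) x
  refine ⟨t.baseSet, t.open_baseSet, FiberBundle.mem_baseSet_trivializationAt' x, fun v => ?_⟩
  refine (t.contMDiffOn_section_baseSet_iff).2 ?_
  refine (contMDiffOn_const (c := (t ⟨x, v⟩).2)).congr fun y hy => ?_
  change (t ⟨y, t.symm y (t ⟨x, v⟩).2⟩).2 = _
  rw [t.apply_mk_symm hy]

theorem SmoothFunOn.mdifferentiableAt {f : M → F} {U : Set M} {x : M}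
    (hf : ContMDiffOn (𝓡 n) 𝓘(ℝ, F) ∞ f U) (hU : IsOpen U) (hx : x ∈ U) :
    MDifferentiableAt (𝓡 n) 𝓘(ℝ, F) f x :=
  (hf.contMDiffAt (hU.mem_nhds hx)).mdifferentiableAt (by simp)

theorem contMDiffOn_mfderiv_apply {f : M → N} {U : Set M} (hU : IsOpen U)
    (hf : ContMDiffOn (𝓡 n) (𝓡 r) ∞ f U) {X : VField n M} (hX : X.SmoothOn U) :
    ContMDiffOn (𝓡 n) ((𝓡 r).prod 𝓘(ℝ, EuclideanSpace ℝ (Fin r))) ∞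
      (fun x => (⟨f x, mfderiv (𝓡 n) (𝓡 r) f x (X x)⟩ : TangentBundle (𝓡 r) N)) U := by
  have h := (hf.contMDiffOn_tangentMapWithin (m := ∞) le_rfl hU.uniqueMDiffOn).comp hX
    (fun x hx => hx)
  refine h.congr fun x hx => ?_
  simp [tangentMapWithin, mfderivWithin_of_isOpen hU hx]

theorem contMDiffOn_mvfderiv_apply {f : M → F} {U : Set M} (hU : IsOpen U)
    (hf : ContMDiffOn (𝓡 n) 𝓘(ℝ, F) ∞ f U) {X : VField n M} (hX : X.SmoothOn U) :
    ContMDiffOn (𝓡 n) 𝓘(ℝ, F) ∞ (fun x => mvfderiv (𝓡 n) f x (X x)) U := by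
  have h := (hf.contMDiffOn_tangentMapWithin (m := ∞) le_rfl hU.uniqueMDiffOn).comp hX
    (fun x hx => hx)
  refine ((contMDiff_snd_tangentBundle_modelSpace F 𝓘(ℝ, F)).comp_contMDiffOn h).congr
    fun x hx => ?_
  change mvfderiv (𝓡 n) f x (X x) = mfderivWithin (𝓡 n) 𝓘(ℝ, F) f U x (X x)
  rw [mfderivWithin_of_isOpen hU hx]
  rfl

/-- Connections act on fields that are merely differentiable at a point, so the descent of the
Leibniz rule needs this version for such fields. -/
theorem mdifferentiableAt_mvfderiv_apply {f : M → F} {U : Set M} (hU : IsOpen U)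
    (hf : ContMDiffOn (𝓡 n) 𝓘(ℝ, F) ∞ f U) {x : M} (hx : x ∈ U) {X : VField n M}
    (hX : X.DiffAt x) :
    MDifferentiableAt (𝓡 n) 𝓘(ℝ, F) (fun x => mvfderiv (𝓡 n) f x (X x)) x := by
  have h1 := (hf.contMDiffOn_tangentMapWithin (m := ∞) le_rfl hU.uniqueMDiffOn)
  have h2 : MDifferentiableAt (𝓡 n).tangent 𝓘(ℝ, F).tangent (tangentMapWithin (𝓡 n) 𝓘(ℝ, F) f U)
      ⟨x, X x⟩ := by
    refine (h1.contMDiffAt ?_).mdifferentiableAt (by simp)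
    exact (hU.preimage (FiberBundle.continuous_proj _ _)).mem_nhds hx
  have h3 := h2.comp x hX
  have h4 := ((contMDiff_snd_tangentBundle_modelSpace F 𝓘(ℝ, F) (n := ∞)).mdifferentiableAt
    (by simp)).comp x h3
  refine h4.congr_of_eventuallyEq ?_
  filter_upwards [hU.mem_nhds hx] with y hy
  change mvfderiv (𝓡 n) f y (X y) = mfderivWithin (𝓡 n) 𝓘(ℝ, F) f U y (X y)
  rw [mfderivWithin_of_isOpen hU hy]
  rfl

theorem mvfderiv_comp_mfderiv {f : M → N} {g : N → F} {x : M}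
    (hg : MDifferentiableAt (𝓡 r) 𝓘(ℝ, F) g (f x)) (hf : MDifferentiableAt (𝓡 n) (𝓡 r) f x)
    (v : TangentSpace (𝓡 n) x) :
    mvfderiv (𝓡 n) (fun y => g (f y)) x v = mvfderiv (𝓡 r) g (f x) (mfderiv (𝓡 n) (𝓡 r) f x v) := by
  have h := mfderiv_comp x hg hf
  change mfderiv (𝓡 n) 𝓘(ℝ, F) (g ∘ f) x v = _
  rw [h]
  rfl

theorem mvfderiv_congr {f g : M → F} {x : M} (h : f =ᶠ[𝓝 x] g) :
    mvfderiv (𝓡 n) f x = mvfderiv (𝓡 n) g x := by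
  ext v
  change mfderiv (𝓡 n) 𝓘(ℝ, F) f x v = mfderiv (𝓡 n) 𝓘(ℝ, F) g x v
  rw [h.mfderiv_eq]
  rfl

theorem mlieBracket_congr {X Y X' Y' : VField n M} {x : M} (hX : ∀ᶠ y in 𝓝 x, X y = X' y)
    (hY : ∀ᶠ y in 𝓝 x, Y y = Y' y) :
    VectorField.mlieBracket (𝓡 n) X Y x = VectorField.mlieBracket (𝓡 n) X' Y' x :=
  Filter.EventuallyEq.mlieBracket_vectorField_eq hX hY

theorem mlieBracket_fun_add_right {X Y Z : VField n M} {x : M}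
    (hY : Y.DiffAt x) (hZ : Z.DiffAt x) :
    VectorField.mlieBracket (𝓡 n) X (fun y => Y y + Z y) x
      = VectorField.mlieBracket (𝓡 n) X Y x + VectorField.mlieBracket (𝓡 n) X Z x :=
  VectorField.mlieBracket_add_right hY hZ

theorem mlieBracket_fun_smul_right {X Y : VField n M} {f : M → ℝ} {x : M}
    (hf : MDifferentiableAt (𝓡 n) 𝓘(ℝ, ℝ) f x) (hY : Y.DiffAt x) :
    VectorField.mlieBracket (𝓡 n) X (fun y => f y • Y y) x
      = mvfderiv (𝓡 n) f x (X x) • Y x + f x • VectorField.mlieBracket (𝓡 n) X Y x :=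
  VectorField.mlieBracket_smul_right hf hY

theorem mlieBracket_self_apply (X : VField n M) (x : M) :
    VectorField.mlieBracket (𝓡 n) X X x = 0 := by
  rw [VectorField.mlieBracket_self]; rfl

theorem mlieBracket_jacobi {U : Set M} (hU : IsOpen U) {X Y Z : VField n M}
    (hX : X.SmoothOn U) (hY : Y.SmoothOn U) (hZ : Z.SmoothOn U) {x : M} (hx : x ∈ U) :
    VectorField.mlieBracket (𝓡 n) X (VectorField.mlieBracket (𝓡 n) Y Z) x
      = VectorField.mlieBracket (𝓡 n) (VectorField.mlieBracket (𝓡 n) X Y) Z x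
        + VectorField.mlieBracket (𝓡 n) Y (VectorField.mlieBracket (𝓡 n) X Z) x := by
  have h3 : minSmoothness ℝ 3 = 3 := minSmoothness_of_isRCLikeNormedField
  have h2 : minSmoothness ℝ 2 = 2 := minSmoothness_of_isRCLikeNormedField
  have : IsManifold (𝓡 n) (minSmoothness ℝ 3) M := by
    rw [h3]; infer_instance
  have h {X : VField n M} (hX : X.SmoothOn U) := (hX.contMDiffAt (hU.mem_nhds hx)).of_le
    (m := minSmoothness ℝ 2) (by rw [h2]; exact WithTop.coe_le_coe.2 (le_top : (2 : ℕ∞) ≤ ⊤))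
  exact VectorField.leibniz_identity_mlieBracket_apply (h hX) (h hY) (h hZ)

/-- The Lie bracket of vector fields is the commutator of the corresponding derivations. -/
theorem mvfderiv_mlieBracket {f : M → ℝ} {U : Set M} (hU : IsOpen U) (hf : SmoothFunOn n f U)
    {x : M} (hx : x ∈ U) {X Y : VField n M} (hX : X.SmoothOn U) (hY : Y.SmoothOn U) :
    mvfderiv (𝓡 n) f x (VectorField.mlieBracket (𝓡 n) X Y x)
      = mvfderiv (𝓡 n) (fun y => mvfderiv (𝓡 n) f y (Y y)) x (X x)
        - mvfderiv (𝓡 n) (fun y => mvfderiv (𝓡 n) f y (X y)) x (Y x) := by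
  by_cases hXx : X x = 0 ∧ Y x = 0
  · rw [hXx.1, hXx.2, map_zero, map_zero, sub_zero,
      ← VectorField.mlieBracketWithin_univ,
      VectorField.mlieBracketWithin_eq_zero_of_eq_zero hXx.1 hXx.2, map_zero]
  obtain ⟨v, hv⟩ : ∃ v : TangentSpace (𝓡 n) x, v ≠ 0 := by
    by_contra! h
    exact hXx ⟨h _, h _⟩
  obtain ⟨V, hV, hxV, hext⟩ := exists_localExt_smoothOn (n := n) x
  obtain ⟨W, hW, hxW, hWU, hWV⟩ : ∃ W : Set M, IsOpen W ∧ x ∈ W ∧ W ⊆ U ∧ W ⊆ V :=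
    ⟨U ∩ V, hU.inter hV, ⟨hx, hxV⟩, Set.inter_subset_left, Set.inter_subset_right⟩
  replace hf : SmoothFunOn n f W := ContMDiffOn.mono hf hWU
  replace hX := hX.mono hWU
  replace hY := hY.mono hWU
  set Z := localExt v with hZdef
  have hZ : Z.SmoothOn W := (hext v).mono hWV
  have hfd : ∀ y ∈ W, MDifferentiableAt (𝓡 n) 𝓘(ℝ, ℝ) f y :=
    fun y hy => SmoothFunOn.mdifferentiableAt hf hW hy
  -- Expands `[A, [B, fZ]]` for a field `Z` that does not vanish at `x`. Comparing the Jacobi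
  -- identity for `fZ` with that for `Z` isolates the claim as the coefficient of `Z`.
  have key : ∀ A B : VField n M, A.SmoothOn W → B.SmoothOn W →
      VectorField.mlieBracket (𝓡 n) A (VectorField.mlieBracket (𝓡 n) B fun y => f y • Z y) x
        = (mvfderiv (𝓡 n) (fun y => mvfderiv (𝓡 n) f y (B y)) x (A x) • Z x
          + mvfderiv (𝓡 n) f x (B x) • VectorField.mlieBracket (𝓡 n) A Z x)
          + (mvfderiv (𝓡 n) f x (A x) • VectorField.mlieBracket (𝓡 n) B Z x
          + f x • VectorField.mlieBracket (𝓡 n) A (VectorField.mlieBracket (𝓡 n) B Z) x) := by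
    intro A B hA hB
    have hBf : SmoothFunOn n (fun y => mvfderiv (𝓡 n) f y (B y)) W :=
      contMDiffOn_mvfderiv_apply hW hf hB
    have hBZ := hB.mlieBracket hW hZ
    have e : ∀ᶠ y in 𝓝 x, VectorField.mlieBracket (𝓡 n) B (fun y => f y • Z y) y
        = mvfderiv (𝓡 n) f y (B y) • Z y + f y • VectorField.mlieBracket (𝓡 n) B Z y := by
      filter_upwards [hW.mem_nhds hxW] with y hy
      exact mlieBracket_fun_smul_right (hfd y hy) (hZ.diffAt hW hy)
    rw [mlieBracket_congr (.of_forall fun _ => rfl) e,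
      mlieBracket_fun_add_right ((VField.SmoothOn.smul hBf hZ).diffAt hW hxW)
        ((VField.SmoothOn.smul hf hBZ).diffAt hW hxW),
      mlieBracket_fun_smul_right (SmoothFunOn.mdifferentiableAt hBf hW hxW) (hZ.diffAt hW hxW),
      mlieBracket_fun_smul_right (hfd x hxW) (hBZ.diffAt hW hxW)]
  have hJ := mlieBracket_jacobi hW hX hY (VField.SmoothOn.smul hf hZ) hxW
  have hJ' := mlieBracket_jacobi hW hX hY hZ hxW
  rw [key X Y hX hY, key Y X hY hX,
    mlieBracket_fun_smul_right (hfd x hxW) (hZ.diffAt hW hxW), hJ'] at hJ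
  have hZx : Z x = v := localExt_self v
  have e : (mvfderiv (𝓡 n) f x (VectorField.mlieBracket (𝓡 n) X Y x)
      - (mvfderiv (𝓡 n) (fun y => mvfderiv (𝓡 n) f y (Y y)) x (X x)
        - mvfderiv (𝓡 n) (fun y => mvfderiv (𝓡 n) f y (X y)) x (Y x))) • Z x = 0 := by
    rw [← sub_eq_zero] at hJ
    rw [← neg_eq_zero, ← hJ]
    module
  rw [hZx, smul_eq_zero, or_iff_left hv, sub_eq_zero] at e
  exact e

end VectorFieldCalculus

/-! ### Affine connections -/

section AffineConnections

variable {n : ℕ} {M : Type*} [TopologicalSpace M] [ChartedSpace (EuclideanSpace ℝ (Fin n)) M]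
  [IsManifold (𝓡 n) ∞ M]

theorem exists_bump [T2Space M] {U : Set M} (hU : IsOpen U) {x : M} (hx : x ∈ U) :
    ∃ ρ : M → ℝ, ContMDiff (𝓡 n) 𝓘(ℝ, ℝ) ∞ ρ ∧ tsupport ρ ⊆ U ∧
      ∃ V : Set M, IsOpen V ∧ x ∈ V ∧ V ⊆ U ∧ ∀ y ∈ V, ρ y = 1 := by
  obtain ⟨f, -, hf⟩ := (SmoothBumpFunction.nhds_basis_tsupport (I := 𝓡 n) x).mem_iff.1
    (hU.mem_nhds hx)
  obtain ⟨V, hV, hVo, hxV⟩ := mem_nhds_iff.1 (Filter.inter_mem f.eventuallyEq_one (hU.mem_nhds hx))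
  exact ⟨f, f.contMDiff, hf, V, hVo, hxV, fun y hy => (hV hy).2, fun y hy => (hV hy).1⟩

/-- An endomorphism field which preserves smoothness of local vector fields is a smooth section
of the endomorphism bundle. -/
theorem contMDiffOn_hom_of_apply {A : EndField n M} {U : Set M} (hU : IsOpen U)
    (hA : ∀ W : Set M, IsOpen W → W ⊆ U → ∀ X : VField n M, X.SmoothOn W →
      VField.SmoothOn (fun x => A x (X x)) W) :
    ContMDiffOn (𝓡 n) ((𝓡 n).prod
        𝓘(ℝ, EuclideanSpace ℝ (Fin n) →L[ℝ] EuclideanSpace ℝ (Fin n))) ∞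
      (fun x => (⟨x, A x⟩ : Bundle.TotalSpace
        (EuclideanSpace ℝ (Fin n) →L[ℝ] EuclideanSpace ℝ (Fin n))
        fun x : M => TangentSpace (𝓡 n) x →L[ℝ] TangentSpace (𝓡 n) x)) U := by
  intro x₀ hx₀
  refine ContMDiffAt.contMDiffWithinAt ?_
  rw [contMDiffAt_hom_bundle]
  refine ⟨contMDiffAt_id, ?_⟩
  set t := trivializationAt (EuclideanSpace ℝ (Fin n)) (TangentSpace (𝓡 n) : M → Type _) x₀ with ht
  have ht₀ : x₀ ∈ t.baseSet := FiberBundle.mem_baseSet_trivializationAt' x₀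
  have hW : IsOpen (U ∩ t.baseSet) := hU.inter t.open_baseSet
  let b := EuclideanSpace.basisFun (Fin n) ℝ
  let X : Fin n → VField n M := fun i y => t.symm y (b i)
  have hX : ∀ i, (X i).SmoothOn (U ∩ t.baseSet) := fun i => by
    refine VField.SmoothOn.mono (U := t.baseSet) ?_ Set.inter_subset_right
    refine (t.contMDiffOn_section_baseSet_iff).2 ?_
    refine (contMDiffOn_const (c := b i)).congr fun y hy => ?_
    change (t ⟨y, t.symm y (b i)⟩).2 = _
    rw [t.apply_mk_symm hy]
  have hAX : ∀ i, ContMDiffAt (𝓡 n) 𝓘(ℝ, EuclideanSpace ℝ (Fin n)) ∞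
      (fun y => (t ⟨y, A y (X i y)⟩).2) x₀ := fun i =>
    ((t.contMDiffOn_section_iff hW Set.inter_subset_right).1
      (hA _ hW Set.inter_subset_left _ (hX i))).contMDiffAt (hW.mem_nhds ⟨hx₀, ht₀⟩)
  -- In the trivialization `A` is the sum of `proj i ⊗ A(b i)`, a fixed linear expression in its
  -- values on the coordinate frame, which are smooth by hypothesis.
  let P : Fin n → EuclideanSpace ℝ (Fin n) →L[ℝ]
      (EuclideanSpace ℝ (Fin n) →L[ℝ] EuclideanSpace ℝ (Fin n)) := fun i =>
    ContinuousLinearMap.smulRightL ℝ _ _ (EuclideanSpace.proj (𝕜 := ℝ) i)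
  have hs : ContMDiffAt (𝓡 n) 𝓘(ℝ, EuclideanSpace ℝ (Fin n) →L[ℝ] EuclideanSpace ℝ (Fin n)) ∞
      (fun y => ∑ i, P i ((t ⟨y, A y (X i y)⟩).2)) x₀ :=
    ContMDiffAt.sum fun i _ => (P i).contMDiff.contMDiffAt.comp x₀ (hAX i)
  refine hs.congr_of_eventuallyEq ?_
  filter_upwards [hW.mem_nhds ⟨hx₀, ht₀⟩] with y hy
  rw [ContinuousLinearMap.inCoordinates_eq hy.2 hy.2]
  refine ContinuousLinearMap.ext fun v => ?_
  have hv : v = ∑ i, v i • b i := by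
    conv_lhs => rw [← b.sum_repr v]
    rfl
  conv_lhs => rw [hv]
  rw [map_sum, sum_apply]
  refine Finset.sum_congr rfl fun i _ => ?_
  rw [map_smul]
  rfl

namespace IsAffineConnOn

variable {cov : ConnOp n M} {U W : Set M} {x : M}

theorem congr_near (h : IsAffineConnOn cov U) (hU : IsOpen U) (hx : x ∈ U) {X Y : VField n M}
    (hX : X.DiffAt x) (hXY : ∀ᶠ y in 𝓝 x, Y y = X y) : cov Y x = cov X x :=
  h.isCov.congr_of_eventuallyEq (VField.DiffAt.congr hX hXY) hX (hU.mem_nhds hx) hXY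

theorem map_add (h : IsAffineConnOn cov U) (hx : x ∈ U) {X Y : VField n M}
    (hX : X.DiffAt x) (hY : Y.DiffAt x) (v : TangentSpace (𝓡 n) x) :
    cov (fun y => X y + Y y) x v = cov X x v + cov Y x v :=
  congrArg (fun L => L v) (h.isCov.add hX hY hx)

theorem map_smul (h : IsAffineConnOn cov U) (hx : x ∈ U) {f : M → ℝ} {X : VField n M}
    (hf : MDifferentiableAt (𝓡 n) 𝓘(ℝ, ℝ) f x) (hX : X.DiffAt x) (v : TangentSpace (𝓡 n) x) :
    cov (fun y => f y • X y) x v = f x • cov X x v + mvfderiv (𝓡 n) f x v • X x :=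
  congrArg (fun L => L v) (h.isCov.leibniz hX hf hx)

theorem map_zero (h : IsAffineConnOn cov U) (hx : x ∈ U) (v : TangentSpace (𝓡 n) x) :
    cov (fun _ => 0) x v = 0 :=
  congrArg (fun L => L v) (h.isCov.zero hx)

theorem map_sum (h : IsAffineConnOn cov U) (hx : x ∈ U) {ι : Type*} (s : Finset ι)
    {X : ι → VField n M} (hX : ∀ i ∈ s, (X i).DiffAt x) (v : TangentSpace (𝓡 n) x) :
    cov (fun y => ∑ i ∈ s, X i y) x v = ∑ i ∈ s, cov (X i) x v := by
  classical
  induction s using Finset.induction_on with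
  | empty => simpa using h.map_zero hx v
  | insert a s ha ih =>
    simp only [Finset.sum_insert ha]
    rw [h.map_add hx (hX a (Finset.mem_insert_self a s))
      (VField.DiffAt.sum fun i hi => hX i (Finset.mem_insert_of_mem hi)),
      ih fun i hi => hX i (Finset.mem_insert_of_mem hi)]

/-- Smoothness of a connection is only postulated for sections smooth on all of `U`. A bump function
extends `X` from `W`, and locality identifies the two derivatives where the bump equals one. -/
theorem smoothOn_apply [T2Space M] (h : IsAffineConnOn cov U) (hU : IsOpen U) (hW : IsOpen W)
    (hWU : W ⊆ U) {X Y : VField n M} (hX : X.SmoothOn W) (hY : Y.SmoothOn W) :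
    VField.SmoothOn (fun x => cov X x (Y x)) W := by
  refine VField.smoothOn_of_locally fun x hx => ?_
  obtain ⟨ρ, hρ, hsupp, V, hV, hxV, hVW, hρV⟩ := exists_bump (n := n) hW hx
  have hX' : ContMDiff (𝓡 n) ((𝓡 n).prod 𝓘(ℝ, EuclideanSpace ℝ (Fin n))) ∞
      (fun x => (⟨x, (ρ • X) x⟩ : TangentBundle (𝓡 n) M)) :=
    hρ.contMDiffOn.smul_section_of_tsupport hW hsupp hX
  have hc := (h.smooth.contMDiff (σ := ρ • X) hX'.contMDiffOn).mono (hVW.trans hWU)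
  have := ContMDiffOn.clm_bundle_apply hc (hY.mono hVW)
  refine ⟨V, hV, hxV, VField.SmoothOn.congr this fun y hy => ?_⟩
  have hd : VField.DiffAt (ρ • X) y := (hX'.contMDiffAt (x := y)).mdifferentiableAt (by simp)
  have e := h.congr_near hU (hWU (hVW hy)) (Y := X) hd <| by
    filter_upwards [hV.mem_nhds hy] with z hz
    change X z = ρ z • X z
    rw [hρV z hz, one_smul]
  change cov X y (Y y) = cov (ρ • X) y (Y y)
  rw [e]

theorem of_smoothOn_apply (hU : IsOpen U)
    (h : IsCovariantDerivativeOn (EuclideanSpace ℝ (Fin n)) cov U)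
    (hs : ∀ X : VField n M, X.SmoothOn U → ∀ W : Set M, IsOpen W → W ⊆ U → ∀ Y : VField n M,
      Y.SmoothOn W → VField.SmoothOn (fun x => cov X x (Y x)) W) : IsAffineConnOn cov U where
  isCov := h
  smooth := ⟨fun {X} hX => contMDiffOn_hom_of_apply hU (hs X hX)⟩

theorem mono [T2Space M] (h : IsAffineConnOn cov U) (hU : IsOpen U) (hW : IsOpen W) (hWU : W ⊆ U) :
    IsAffineConnOn cov W :=
  of_smoothOn_apply hW (h.isCov.mono hWU) fun _ hX _ hV hVW _ hY =>
    h.smoothOn_apply hU hV (hVW.trans hWU) (hX.mono hVW) hY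

end IsAffineConnOn

/-- The projective change of a connection operator by a one-form. -/
def projChange (cov : ConnOp n M) (Υ : OneForm n M) : ConnOp n M := fun σ x =>
  cov σ x + (Υ x).smulRight (σ x) + Υ x (σ x) • ContinuousLinearMap.id ℝ (TangentSpace (𝓡 n) x)

theorem projChange_apply (cov : ConnOp n M) (Υ : OneForm n M) (σ : VField n M) (x : M)
    (v : TangentSpace (𝓡 n) x) :
    projChange cov Υ σ x v = cov σ x v + Υ x v • σ x + Υ x (σ x) • v := rfl

theorem isProjChangeOn_projChange (cov : ConnOp n M) (Υ : OneForm n M) (U : Set M) :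
    IsProjChangeOn U cov Υ (projChange cov Υ) := fun _ _ _ _ _ => rfl

theorem IsAffineConnOn.projChange [T2Space M] {cov : ConnOp n M} {Υ : OneForm n M} {U : Set M}
    (hU : IsOpen U) (h : IsAffineConnOn cov U) (hΥ : Υ.SmoothOn U) :
    IsAffineConnOn (projChange cov Υ) U := by
  refine IsAffineConnOn.of_smoothOn_apply hU ⟨?_, ?_⟩ fun X hX W hW hWU Y hY => ?_
  · intro X Y x hX hY hx
    ext1 v
    have := h.map_add hx hX hY v
    change cov (X + Y) x v = _ at this
    simp only [projChange_apply, this, add_apply, Pi.add_apply, _root_.map_add]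
    module
  · intro X f x hX hf hx
    ext1 v
    have := h.map_smul hx hf hX v
    change cov (f • X) x v = _ at this
    simp only [projChange_apply, this, add_apply, Pi.smul_apply', _root_.map_smul,
      smul_apply, ContinuousLinearMap.smulRight_apply, smul_eq_mul]
    module
  · have hX' := hX.mono hWU
    exact ((h.smoothOn_apply hU hW hWU hX' hY).add (hX'.smul (hΥ W hW hWU Y hY))).add
      (hY.smul (hΥ W hW hWU X hX'))

theorem IsTorsionFreeOn.projChange {cov : ConnOp n M} {Υ : OneForm n M} {U : Set M}
    (h : IsTorsionFreeOn cov U) : IsTorsionFreeOn (projChange cov Υ) U := by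
  intro X Y x hx hX hY
  rw [← h X Y x hx hX hY, projChange_apply, projChange_apply]
  module

theorem OneForm.SmoothOn.mono {Υ : OneForm n M} {U W : Set M} (h : Υ.SmoothOn U) (hWU : W ⊆ U) :
    Υ.SmoothOn W := fun V hV hVW X hX => h V hV (hVW.trans hWU) X hX

/-- Turns a projective change on `U` into a global one without altering it near a given point. -/
theorem OneForm.SmoothOn.bump_smul {Υ : OneForm n M} {U : Set M} (hU : IsOpen U)
    (h : Υ.SmoothOn U) {ρ : M → ℝ} (hρ : ContMDiff (𝓡 n) 𝓘(ℝ, ℝ) ∞ ρ) (hsupp : tsupport ρ ⊆ U) :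
    OneForm.SmoothOn (fun x => ρ x • Υ x) Set.univ := by
  intro W hW _ X hX x hx
  refine ContMDiffAt.contMDiffWithinAt ?_
  by_cases hxU : x ∈ U
  · have hΥ := h (W ∩ U) (hW.inter hU) Set.inter_subset_right X (hX.mono Set.inter_subset_left)
    exact (hρ.contMDiffAt.mul (hΥ.contMDiffAt ((hW.inter hU).mem_nhds ⟨hx, hxU⟩)))
  · refine (contMDiffAt_const (c := (0 : ℝ))).congr_of_eventuallyEq ?_
    filter_upwards [(isClosed_tsupport ρ).isOpen_compl.mem_nhds fun hx' => hxU (hsupp hx')]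
      with y hy
    simp [image_eq_zero_of_notMem_tsupport hy]

end AffineConnections

/-! ### Submersions -/

section Submersions

variable {n r : ℕ} {M : Type*} [TopologicalSpace M] [ChartedSpace (EuclideanSpace ℝ (Fin n)) M]
  [IsManifold (𝓡 n) ∞ M]
  {N : Type*} [TopologicalSpace N] [ChartedSpace (EuclideanSpace ℝ (Fin r)) N]
  [IsManifold (𝓡 r) ∞ N]

/-- A functional equal to `1` on `κ` detects exactly the direction that `D` kills, so it completes
`D` to an isomorphism. -/
theorem exists_equiv_prod_of_ker_eq_span {E F : Type*} [NormedAddCommGroup E] [NormedSpace ℝ E]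
    [CompleteSpace E] [NormedAddCommGroup F] [NormedSpace ℝ F] [CompleteSpace F] (D : E →L[ℝ] F)
    (hD : Function.Surjective D) {κ : E} (hκ : κ ≠ 0) (hker : ∀ v, D v = 0 ↔ ∃ c : ℝ, v = c • κ) :
    ∃ (P : E →L[ℝ] ℝ) (e : E ≃L[ℝ] F × ℝ), (e : E →L[ℝ] F × ℝ) = D.prod P := by
  obtain ⟨P, hP⟩ := SeparatingDual.exists_eq_one (R := ℝ) hκ
  have hκ0 : D κ = 0 := (hker κ).2 ⟨1, (one_smul _ _).symm⟩
  have hbij : Function.Bijective (D.prod P) := by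
    constructor
    · rw [injective_iff_map_eq_zero]
      intro v hv
      have hv1 : D v = 0 := congrArg Prod.fst hv
      have hv2 : P v = 0 := congrArg Prod.snd hv
      obtain ⟨c, rfl⟩ := (hker v).1 hv1
      rw [map_smul, hP, smul_eq_mul, mul_one] at hv2
      rw [hv2, zero_smul]
    · rintro ⟨w, c⟩
      obtain ⟨v, rfl⟩ := hD w
      exact ⟨v + (c - P v) • κ, Prod.ext (by simp [hκ0]) (by simp [hP])⟩
  exact ⟨P, ContinuousLinearEquiv.ofBijective (D.prod P) (LinearMap.ker_eq_bot.2 hbij.1)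
    (LinearMap.range_eq_top.2 hbij.2), ContinuousLinearEquiv.coe_ofBijective _ _ _⟩

theorem mfderiv_extChartAt_injective (y₀ : N) {y : N}
    (hy : y ∈ (extChartAt (𝓡 r) y₀).source) {w : TangentSpace (𝓡 r) y}
    (hw : mvfderiv (𝓡 r) (extChartAt (𝓡 r) y₀) y w = 0) : w = 0 := by
  have h := (isInvertible_mfderiv_extChartAt hy).injective
  exact h ((show mfderiv (𝓡 r) 𝓘(ℝ, EuclideanSpace ℝ (Fin r)) (extChartAt (𝓡 r) y₀) y w = 0
    from hw).trans (map_zero _).symm)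

/-! ### Local normal form of a leaf space and functions constant on the fibres -/

namespace IsLocalLeafSpace

variable {k : VField n M} {U : Set M} {prj : M → N} (h : IsLocalLeafSpace r k U prj)

include h

theorem mdifferentiableAt {x : M} (hx : x ∈ U) : MDifferentiableAt (𝓡 n) (𝓡 r) prj x :=
  (h.smooth.contMDiffAt (h.isOpen.mem_nhds hx)).mdifferentiableAt (by simp)

/-- The normal form of a submersion, by the inverse function theorem: a chart of the leaf space
pulled back by `prj`, together with one function `t` transversal to the fibres, is a coordinate
system with inverse `Ψ`. -/
theorem exists_product_coordinates {x₀ : M} (hx₀ : x₀ ∈ U) (hk : k x₀ ≠ 0) :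
    ∃ (Ψ : EuclideanSpace ℝ (Fin r) × ℝ → M) (t : M → ℝ), ContinuousAt t x₀ ∧
      ContMDiffAt 𝓘(ℝ, EuclideanSpace ℝ (Fin r) × ℝ) (𝓡 n) ∞ Ψ
        (extChartAt (𝓡 r) (prj x₀) (prj x₀), t x₀) ∧
      (∀ᶠ p in 𝓝 (extChartAt (𝓡 r) (prj x₀) (prj x₀), t x₀),
        prj (Ψ p) ∈ (extChartAt (𝓡 r) (prj x₀)).source ∧
          extChartAt (𝓡 r) (prj x₀) (prj (Ψ p)) = p.1) ∧
      ∀ᶠ x in 𝓝 x₀, Ψ (extChartAt (𝓡 r) (prj x₀) (prj x), t x) = x := by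
  set φ := extChartAt (𝓡 n) x₀ with hφ
  set ψ := extChartAt (𝓡 r) (prj x₀) with hψ
  set f : EuclideanSpace ℝ (Fin n) → EuclideanSpace ℝ (Fin r) := fun z => ψ (prj (φ.symm z)) with hf
  set a := φ x₀ with ha
  have hprj₀ := h.smooth.contMDiffAt (h.isOpen.mem_nhds hx₀)
  have hfs : ContDiffAt ℝ ∞ f a := by
    have := (contMDiffAt_iff.1 hprj₀).2
    rwa [show Set.range (𝓡 n) = Set.univ from ModelWithCorners.range_eq_univ _,
      contDiffWithinAt_univ] at this
  let D : EuclideanSpace ℝ (Fin n) →L[ℝ] EuclideanSpace ℝ (Fin r) := mfderiv (𝓡 n) (𝓡 r) prj x₀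
  have hD : HasFDerivAt f D a := by
    have := (h.mdifferentiableAt hx₀).hasMFDerivAt.2
    rw [show Set.range (𝓡 n) = Set.univ from ModelWithCorners.range_eq_univ _] at this
    exact hasFDerivWithinAt_univ.1 this
  obtain ⟨P, e, he⟩ := exists_equiv_prod_of_ker_eq_span D (h.submersion x₀ hx₀)
    (κ := k x₀) hk (h.ker x₀ hx₀)
  -- The linear functional `P`, nonzero on `k x₀`, supplies the missing coordinate; the derivative
  -- of `G` at `a` is the isomorphism `e`.
  set G : EuclideanSpace ℝ (Fin n) → EuclideanSpace ℝ (Fin r) × ℝ := fun z => (f z, P z) with hG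
  have hGs : ContDiffAt ℝ ∞ G a := hfs.prodMk P.contDiff.contDiffAt
  have hGd : HasStrictFDerivAt G
      (e : EuclideanSpace ℝ (Fin n) →L[ℝ] EuclideanSpace ℝ (Fin r) × ℝ) a := by
    rw [he]
    exact (hfs.hasStrictFDerivAt' hD (by simp)).prodMk P.hasStrictFDerivAt
  set H := hGd.toOpenPartialHomeomorph G with hH
  have hHG : (H : EuclideanSpace ℝ (Fin n) → EuclideanSpace ℝ (Fin r) × ℝ) = G :=
    hGd.toOpenPartialHomeomorph_coe
  have haH : a ∈ H.source := hGd.mem_toOpenPartialHomeomorph_source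
  have hsymm : H.symm (G a) = a := by rw [← hHG]; exact H.left_inv haH
  have htgt : G a ∈ H.target := by rw [← hHG]; exact H.map_source haH
  have hx₀a : φ.symm a = x₀ := extChartAt_to_inv x₀
  have hGa : G a = (ψ (prj x₀), P (φ x₀)) := by simp only [hG, hf, hx₀a]; rfl
  have hHs : ContDiffAt ℝ ∞ H.symm (G a) := by
    refine H.contDiffAt_symm htgt (f₀' := e) ?_ ?_
    · rw [hsymm, hHG]; exact hGd.hasFDerivAt
    · rw [hsymm, hHG]; exact hGs
  have hΨc : ContinuousAt (fun p => φ.symm (H.symm p)) (G a) := by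
    refine ContinuousAt.comp (g := φ.symm) ?_ hHs.continuousAt
    rw [hsymm]
    exact continuousAt_extChartAt_symm x₀
  refine ⟨fun p => φ.symm (H.symm p), fun x => P (φ x), ?_, ?_, ?_, ?_⟩
  · exact P.continuous.continuousAt.comp (continuousAt_extChartAt x₀)
  · rw [← hGa]
    refine ContMDiffAt.comp (G a) (I' := 𝓘(ℝ, EuclideanSpace ℝ (Fin n))) (g := φ.symm) ?_
      hHs.contMDiffAt
    rw [hsymm]
    have := (contMDiffOn_extChartAt_symm (I := 𝓡 n) (n := ∞) x₀)
    exact this.contMDiffAt (extChartAt_target_mem_nhds x₀)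
  · rw [← hGa]
    have h1 : ∀ᶠ p in 𝓝 (G a), prj (φ.symm (H.symm p)) ∈ ψ.source := by
      have : ContinuousAt (fun p => prj (φ.symm (H.symm p))) (G a) := by
        refine ContinuousAt.comp (g := prj) ?_ hΨc
        rw [hsymm, hx₀a]
        exact hprj₀.continuousAt
      refine this.preimage_mem_nhds ?_
      rw [hsymm, hx₀a]
      exact extChartAt_source_mem_nhds _
    filter_upwards [h1, H.open_target.mem_nhds htgt] with p hp hpt
    refine ⟨hp, ?_⟩
    have : G (H.symm p) = p := by rw [← hHG]; exact H.right_inv hpt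
    exact congrArg Prod.fst this
  · have h1 : ∀ᶠ x in 𝓝 x₀, φ x ∈ H.source :=
      (continuousAt_extChartAt x₀).preimage_mem_nhds (H.open_source.mem_nhds haH)
    filter_upwards [h1, extChartAt_source_mem_nhds (I := 𝓡 n) x₀] with x hx hxs
    have e1 : φ.symm (φ x) = x := φ.left_inv hxs
    have e2 : (ψ (prj x), P (φ x)) = H (φ x) := by
      rw [hHG]; simp only [hG, hf, e1]
    change φ.symm (H.symm (ψ (prj x), P (φ x))) = x
    rw [e2, H.left_inv hx, e1]

/-- Freeze the fibre coordinate at its value `t x₀`. -/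
theorem exists_local_section {x₀ : M} (hx₀ : x₀ ∈ U) (hk : k x₀ ≠ 0) :
    ∃ s : N → M, s (prj x₀) = x₀ ∧ ContMDiffAt (𝓡 r) (𝓡 n) ∞ s (prj x₀) ∧
      ∀ᶠ y in 𝓝 (prj x₀), prj (s y) = y := by
  obtain ⟨Ψ, t, -, hΨ, h1, h2⟩ := h.exists_product_coordinates hx₀ hk
  have hc : ContMDiffAt (𝓡 r) 𝓘(ℝ, EuclideanSpace ℝ (Fin r) × ℝ) ∞
      (fun y => (extChartAt (𝓡 r) (prj x₀) y, t x₀)) (prj x₀) :=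
    (contMDiffAt_extChartAt (I := 𝓡 r)).prodMk_space contMDiffAt_const
  refine ⟨fun y => Ψ (extChartAt (𝓡 r) (prj x₀) y, t x₀), h2.self_of_nhds, hΨ.comp (prj x₀) hc, ?_⟩
  filter_upwards [hc.continuousAt.eventually h1, extChartAt_source_mem_nhds (I := 𝓡 r) (prj x₀)]
    with y hy hys
  exact (extChartAt (𝓡 r) (prj x₀)).injOn hy.1 hys hy.2

/-- A function which is constant along `k` is locally constant on the fibres. -/
theorem eventually_eq_on_fibre {x₀ : M} (hx₀ : x₀ ∈ U) (hk : k x₀ ≠ 0) {ψ : M → ℝ}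
    (hψ : ∀ᶠ x in 𝓝 x₀, MDifferentiableAt (𝓡 n) 𝓘(ℝ, ℝ) ψ x ∧ mvfderiv (𝓡 n) ψ x (k x) = 0) :
    ∀ᶠ x in 𝓝 x₀, prj x = prj x₀ → ψ x = ψ x₀ := by
  obtain ⟨Ψ, t, ht, hΨ, h1, h2⟩ := h.exists_product_coordinates hx₀ hk
  set φ := extChartAt (𝓡 r) (prj x₀) with hφ
  set η := φ (prj x₀) with hη
  have hΨx₀ : Ψ (η, t x₀) = x₀ := h2.self_of_nhds
  have hΨd : ∀ᶠ p in 𝓝 (η, t x₀),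
      MDifferentiableAt 𝓘(ℝ, EuclideanSpace ℝ (Fin r) × ℝ) (𝓡 n) Ψ p := by
    have h3 := (contMDiffAt_iff_contMDiffAt_nhds (n := 1) (by simp)).1
      (hΨ.of_le (show (1 : ℕ∞ω) ≤ ∞ from WithTop.coe_le_coe.2 le_top))
    exact h3.mono fun p hp => hp.mdifferentiableAt (by simp)
  have hΨU : ∀ᶠ p in 𝓝 (η, t x₀), Ψ p ∈ U := by
    refine hΨ.continuousAt.preimage_mem_nhds ?_
    rw [hΨx₀]; exact h.isOpen.mem_nhds hx₀
  have hΨψ : ∀ᶠ p in 𝓝 (η, t x₀), MDifferentiableAt (𝓡 n) 𝓘(ℝ, ℝ) ψ (Ψ p) ∧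
      mvfderiv (𝓡 n) ψ (Ψ p) (k (Ψ p)) = 0 := by
    have h3 := hψ
    rw [← hΨx₀] at h3
    exact hΨ.continuousAt.eventually h3
  obtain ⟨ε, hε, hball⟩ := Metric.eventually_nhds_iff_ball.1
    (h1.eventually_nhds.and (hΨd.and (hΨU.and hΨψ)))
  -- Along `c ↦ Ψ (η, c)` the projection is constant, so the velocity lies in its kernel and is a
  -- multiple of `k`, a direction in which `ψ` has derivative zero.
  have hline : ∀ c ∈ Metric.ball (t x₀) ε, HasDerivAt (fun c => ψ (Ψ (η, c))) 0 c := by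
    intro c hc
    have hc' : (η, c) ∈ Metric.ball (η, t x₀) ε := by
      rw [Metric.mem_ball, Prod.dist_eq, dist_self, max_eq_right dist_nonneg]; exact hc
    obtain ⟨g1, g2, g3, g4, g5⟩ := hball _ hc'
    have hγ : HasMFDerivAt 𝓘(ℝ, ℝ) 𝓘(ℝ, EuclideanSpace ℝ (Fin r) × ℝ)
        (fun c : ℝ => (η, c)) c (ContinuousLinearMap.inr ℝ (EuclideanSpace ℝ (Fin r)) ℝ) :=
      (hasFDerivAt_prodMk_right η c).hasMFDerivAt
    have hΨγ := g2.hasMFDerivAt.comp c hγ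
    set v : TangentSpace (𝓡 n) (Ψ (η, c)) :=
      mfderiv 𝓘(ℝ, EuclideanSpace ℝ (Fin r) × ℝ) (𝓡 n) Ψ (η, c)
        ((0, 1) : EuclideanSpace ℝ (Fin r) × ℝ) with hv
    have hkey : mfderiv (𝓡 n) (𝓡 r) prj (Ψ (η, c)) v = 0 := by
      refine mfderiv_extChartAt_injective (prj x₀) g1.self_of_nhds.1 ?_
      have hφd : MDifferentiableAt (𝓡 r) 𝓘(ℝ, EuclideanSpace ℝ (Fin r)) φ (prj (Ψ (η, c))) := by
        refine mdifferentiableAt_extChartAt ?_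
        rw [← extChartAt_source (𝓡 r)]
        exact g1.self_of_nhds.1
      have hcomp := (hφd.hasMFDerivAt.comp _ (h.mdifferentiableAt g3).hasMFDerivAt).comp c hΨγ
      have hconst : HasMFDerivAt 𝓘(ℝ, ℝ) 𝓘(ℝ, EuclideanSpace ℝ (Fin r))
          ((φ ∘ prj) ∘ (Ψ ∘ fun c : ℝ => (η, c))) c 0 := by
        refine (hasMFDerivAt_const η c).congr_of_eventuallyEq ?_
        have hcont : Filter.Tendsto (fun c : ℝ => (η, c)) (𝓝 c) (𝓝 (η, c)) :=
          (Continuous.prodMk_right η).continuousAt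
        filter_upwards [hcont.eventually g1] with d hd
        exact hd.2
      have := hasMFDerivAt_unique hcomp hconst
      exact congrArg (fun L : ℝ →L[ℝ] EuclideanSpace ℝ (Fin r) => L 1) this
    obtain ⟨a, ha⟩ := (h.ker _ g3 v).1 hkey
    have hfin := g4.hasMFDerivAt.comp c hΨγ
    obtain ⟨L, hL, hL1⟩ : ∃ L : ℝ →L[ℝ] ℝ, HasFDerivAt (fun c => ψ (Ψ (η, c))) L c ∧
        L 1 = mvfderiv (𝓡 n) ψ (Ψ (η, c)) v := ⟨_, hasMFDerivAt_iff_hasFDerivAt.1 hfin, rfl⟩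
    refine hL.hasDerivAt.congr_deriv (hL1.trans ?_)
    rw [ha, map_smul, g5, smul_zero]
  have hconst : ∀ c ∈ Metric.ball (t x₀) ε, ψ (Ψ (η, c)) = ψ (Ψ (η, t x₀)) := fun c hc =>
    Metric.isOpen_ball.is_const_of_deriv_eq_zero (convex_ball _ _).isPreconnected
      (fun d hd => (hline d hd).differentiableAt.differentiableWithinAt)
      (fun d hd => (hline d hd).deriv) hc (Metric.mem_ball_self hε)
  filter_upwards [h2, ht.preimage_mem_nhds (Metric.ball_mem_nhds _ hε)] with x hx hxt hxx
  have := hconst (t x) hxt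
  rw [hΨx₀] at this
  rw [← this, hη, ← hxx, hx]

/-- A function on `U ∩ prj ⁻¹' W` which is constant along `k` is constant on the fibres. -/
theorem eq_of_prj_eq (hk : ∀ x ∈ U, k x ≠ 0) {W : Set N} (hW : IsOpen W) {ψ : M → ℝ}
    (hψ : ∀ x ∈ U ∩ prj ⁻¹' W,
      MDifferentiableAt (𝓡 n) 𝓘(ℝ, ℝ) ψ x ∧ mvfderiv (𝓡 n) ψ x (k x) = 0)
    {x x' : M} (hx : x ∈ U) (hx' : x' ∈ U) (hxW : prj x ∈ W) (hxx' : prj x = prj x') :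
    ψ x = ψ x' := by
  -- Having equal `ψ`-values is an equivalence relation whose classes are open in the fibre, and the
  -- fibre is preconnected.
  refine (h.connected (prj x)).induction₂ (fun a b => ψ a = ψ b) ?_
    (fun _ _ _ _ _ _ => Eq.trans) (fun _ _ _ _ => Eq.symm) ⟨hx, rfl⟩ ⟨hx', hxx'.symm⟩
  rintro a ⟨ha, hax⟩
  have hopen : U ∩ prj ⁻¹' W ∈ 𝓝 a := Filter.inter_mem (h.isOpen.mem_nhds ha)
    ((h.mdifferentiableAt ha).continuousAt.preimage_mem_nhds (hW.mem_nhds (by rwa [hax])))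
  filter_upwards [nhdsWithin_le_nhds (h.eventually_eq_on_fibre ha (hk a ha)
    (Filter.mem_of_superset hopen hψ)), self_mem_nhdsWithin] with b hb hbx
  exact (hb (hbx.2.trans hax.symm)).symm

end IsLocalLeafSpace

end Submersions

/-! ### Horizontal lifts -/

section HorizontalLifts

variable {n r : ℕ} {M : Type*} [TopologicalSpace M] [ChartedSpace (EuclideanSpace ℝ (Fin n)) M]
  [IsManifold (𝓡 n) ∞ M]
  {N : Type*} [TopologicalSpace N] [ChartedSpace (EuclideanSpace ℝ (Fin r)) N]
  [IsManifold (𝓡 r) ∞ N]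

/-- Fields that have the right images at `x₀` have almost the right images nearby: the matrix `T` of
these images equals `1` at `x₀`, hence is invertible near it, and its inverse corrects the fields.
-/
theorem exists_smooth_dual_frame {F : M → EuclideanSpace ℝ (Fin r)} {U : Set M} (hU : IsOpen U)
    (hF : ContMDiffOn (𝓡 n) 𝓘(ℝ, EuclideanSpace ℝ (Fin r)) ∞ F U) {x₀ : M} (hx₀ : x₀ ∈ U)
    (hsurj : ∀ w : EuclideanSpace ℝ (Fin r), ∃ v : TangentSpace (𝓡 n) x₀,
      mvfderiv (𝓡 n) F x₀ v = w) :
    ∃ V : Set M, IsOpen V ∧ x₀ ∈ V ∧ V ⊆ U ∧ ∃ G : Fin r → VField n M,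
      (∀ i, (G i).SmoothOn V) ∧
      ∀ x ∈ V, ∀ i, mvfderiv (𝓡 n) F x (G i x) = EuclideanSpace.single i (1 : ℝ) := by
  obtain ⟨V₀, hV₀, hxV₀, hext⟩ := exists_localExt_smoothOn (n := n) x₀
  choose v hv using fun i : Fin r => hsurj (EuclideanSpace.single i (1 : ℝ))
  set V₁ := V₀ ∩ U with hV₁
  have hV₁o : IsOpen V₁ := hV₀.inter hU
  let X : Fin r → VField n M := fun i => localExt (v i)
  have hX : ∀ i, (X i).SmoothOn V₁ := fun i => (hext (v i)).mono Set.inter_subset_left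
  let D : Fin r → M → EuclideanSpace ℝ (Fin r) := fun i x => mvfderiv (𝓡 n) F x (X i x)
  have hD : ∀ i, ContMDiffOn (𝓡 n) 𝓘(ℝ, EuclideanSpace ℝ (Fin r)) ∞ (D i) V₁ := fun i =>
    contMDiffOn_mvfderiv_apply hV₁o (hF.mono Set.inter_subset_right) (hX i)
  let T : M → EuclideanSpace ℝ (Fin r) →L[ℝ] EuclideanSpace ℝ (Fin r) := fun x =>
    ∑ i, ContinuousLinearMap.smulRightL ℝ _ _ (EuclideanSpace.proj (𝕜 := ℝ) i) (D i x)
  have hTapp : ∀ x w, T x w = ∑ i, w i • D i x := fun x w => by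
    simp [T, sum_apply]
  have hT : ContMDiffOn (𝓡 n) 𝓘(ℝ, EuclideanSpace ℝ (Fin r) →L[ℝ] EuclideanSpace ℝ (Fin r)) ∞
      T V₁ := by
    refine contMDiffOn_finsetSum fun i _ => ?_
    exact ((ContinuousLinearMap.smulRightL ℝ (EuclideanSpace ℝ (Fin r)) (EuclideanSpace ℝ (Fin r))
      (EuclideanSpace.proj (𝕜 := ℝ) i)).contMDiff (n := ∞)).comp_contMDiffOn (hD i)
  have hT₀ : T x₀ = 1 := by
    ext w j
    rw [hTapp]
    have : ∀ i, D i x₀ = EuclideanSpace.single i (1 : ℝ) := fun i => by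
      rw [← hv i]
      exact congrArg _ (localExt_self (v i))
    simp [this, Pi.single_apply]
  set V := V₁ ∩ T ⁻¹' {A | IsUnit A} with hVdef
  have hVo : IsOpen V := hT.continuousOn.isOpen_inter_preimage hV₁o Units.isOpen
  have hinv : ContMDiffOn (𝓡 n)
      𝓘(ℝ, EuclideanSpace ℝ (Fin r) →L[ℝ] EuclideanSpace ℝ (Fin r)) ∞
      (fun x => Ring.inverse (T x)) V := by
    rintro x ⟨hx, u, hu⟩
    have h1 : ContDiffAt ℝ ∞ Ring.inverse (T x) := hu ▸ contDiffAt_ringInverse ℝ u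
    exact (h1.contMDiffAt.comp x (hT.contMDiffAt (hV₁o.mem_nhds hx))).contMDiffWithinAt
  refine ⟨V, hVo, ⟨⟨hxV₀, hx₀⟩, by simp [hT₀]⟩, fun x hx => hx.1.2,
    fun i x => ∑ j, (Ring.inverse (T x) (EuclideanSpace.single i 1)) j • X j x, fun i => ?_, ?_⟩
  · refine VField.SmoothOn.sum fun j _ =>
      VField.SmoothOn.smul ?_ ((hX j).mono Set.inter_subset_left)
    have := (((EuclideanSpace.proj (𝕜 := ℝ) j).comp (ContinuousLinearMap.apply ℝ _
      (EuclideanSpace.single i (1 : ℝ)))).contMDiff (n := ∞)).comp_contMDiffOn hinv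
    exact this
  · rintro x ⟨hx, hu⟩ i
    rw [map_sum]
    simp only [map_smul]
    rw [← hTapp]
    change (T x * Ring.inverse (T x)) _ = _
    rw [Ring.mul_inverse_cancel _ hu]
    rfl

namespace IsLocalLeafSpace

variable {k : VField n M} {U : Set M} {prj : M → N} (h : IsLocalLeafSpace r k U prj)

include h

theorem k_mem_ker {x : M} (hx : x ∈ U) : mfderiv (𝓡 n) (𝓡 r) prj x (k x) = 0 :=
  (h.ker x hx _).2 ⟨1, (one_smul _ _).symm⟩

/-- If `k` vanished at `x`, the differential of `prj` would be injective from dimension `r + 1` to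
dimension `r`. -/
theorem k_ne_zero (hnr : n = r + 1) {x : M} (hx : x ∈ U) : k x ≠ 0 := by
  intro hk
  have hinj : Function.Injective (mfderiv (𝓡 n) (𝓡 r) prj x) := by
    rw [injective_iff_map_eq_zero]
    intro v hv
    obtain ⟨a, rfl⟩ := (h.ker x hx v).1 hv
    rw [hk, smul_zero]
  have := LinearMap.finrank_le_finrank_of_injective
    (f := (mfderiv (𝓡 n) (𝓡 r) prj x).toLinearMap) hinj
  rw [finrank_tangentSpace, finrank_tangentSpace] at this
  omega

theorem isOpen_preimage {W : Set N} (hW : IsOpen W) : IsOpen (U ∩ prj ⁻¹' W) :=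
  h.smooth.continuousOn.isOpen_inter_preimage h.isOpen hW

theorem chart_smoothOn (y₀ : N) :
    ContMDiffOn (𝓡 n) 𝓘(ℝ, EuclideanSpace ℝ (Fin r)) ∞ (fun x => extChartAt (𝓡 r) y₀ (prj x))
      (U ∩ prj ⁻¹' (chartAt (EuclideanSpace ℝ (Fin r)) y₀).source) :=
  (contMDiffOn_extChartAt (I := 𝓡 r) (n := ∞)).comp (h.smooth.mono Set.inter_subset_left)
    fun _ hx => hx.2

theorem mvfderiv_chart {y₀ : N} {x : M} (hx : x ∈ U)
    (hxy : prj x ∈ (chartAt (EuclideanSpace ℝ (Fin r)) y₀).source) (v : TangentSpace (𝓡 n) x) :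
    mvfderiv (𝓡 n) (fun x => extChartAt (𝓡 r) y₀ (prj x)) x v
      = mvfderiv (𝓡 r) (extChartAt (𝓡 r) y₀) (prj x) (mfderiv (𝓡 n) (𝓡 r) prj x v) :=
  mvfderiv_comp_mfderiv (mdifferentiableAt_extChartAt hxy) (h.mdifferentiableAt hx) v

theorem mvfderiv_chart_k {y₀ : N} {x : M} (hx : x ∈ U)
    (hxy : prj x ∈ (chartAt (EuclideanSpace ℝ (Fin r)) y₀).source) :
    mvfderiv (𝓡 n) (fun x => extChartAt (𝓡 r) y₀ (prj x)) x (k x) = 0 := by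
  rw [h.mvfderiv_chart hx hxy, h.k_mem_ker hx, map_zero]

theorem mfderiv_eq_of_mvfderiv_chart_eq {y₀ : N} {x : M} (hx : x ∈ U)
    (hxy : prj x ∈ (chartAt (EuclideanSpace ℝ (Fin r)) y₀).source) {v : TangentSpace (𝓡 n) x}
    (hv : mvfderiv (𝓡 n) (fun x => extChartAt (𝓡 r) y₀ (prj x)) x v = 0) :
    ∃ a : ℝ, v = a • k x := by
  rw [h.mvfderiv_chart hx hxy] at hv
  exact (h.ker x hx v).1 (mfderiv_extChartAt_injective y₀ (by rwa [extChartAt_source]) hv)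

/-- Near any point there is a frame of `ker τ` which consists of lifts of the coordinate vector
fields on the leaf space. -/
theorem exists_adapted_frame {U' : Set M} (hU' : IsOpen U') (hUU' : U' ⊆ U) (hks : k.SmoothOn U')
    {τ : OneForm n M} (hτ : τ.SmoothOn U') (hτk : ∀ x ∈ U', τ x (k x) = 1) {x₀ : M}
    (hx₀ : x₀ ∈ U') :
    ∃ V : Set M, IsOpen V ∧ x₀ ∈ V ∧
      V ⊆ U' ∩ prj ⁻¹' (chartAt (EuclideanSpace ℝ (Fin r)) (prj x₀)).source ∧
      ∃ G : Fin r → VField n M, (∀ i, (G i).SmoothOn V) ∧ (∀ x ∈ V, ∀ i, τ x (G i x) = 0) ∧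
        (∀ x ∈ V, ∀ i, mvfderiv (𝓡 n) (fun x => extChartAt (𝓡 r) (prj x₀) (prj x)) x (G i x)
          = EuclideanSpace.single i (1 : ℝ)) ∧
        ∀ x ∈ V, ∀ v : TangentSpace (𝓡 n) x,
          v = (∑ i, (mvfderiv (𝓡 n) (fun x => extChartAt (𝓡 r) (prj x₀) (prj x)) x v) i • G i x)
            + τ x v • k x := by
  have hmem := mem_chart_source (EuclideanSpace ℝ (Fin r)) (prj x₀)
  obtain ⟨V, hV, hxV, hVU, G, hG, hGe⟩ := exists_smooth_dual_frame
    (U := U' ∩ prj ⁻¹' (chartAt (EuclideanSpace ℝ (Fin r)) (prj x₀)).source)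
    ((h.smooth.mono hUU').continuousOn.isOpen_inter_preimage hU'
      (chartAt (EuclideanSpace ℝ (Fin r)) (prj x₀)).open_source)
    ((h.chart_smoothOn (prj x₀)).mono fun x hx => ⟨hUU' hx.1, hx.2⟩) (x₀ := x₀) ⟨hx₀, hmem⟩ (by
      intro w
      obtain ⟨w', hw'⟩ := (isInvertible_mfderiv_extChartAt (I := 𝓡 r)
        (mem_extChartAt_source (prj x₀))).surjective w
      obtain ⟨v, hv⟩ := h.submersion x₀ (hUU' hx₀) w'
      exact ⟨v, by rw [h.mvfderiv_chart (hUU' hx₀) hmem, hv]; exact hw'⟩)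
  have hVU' : V ⊆ U' := fun x hx => (hVU hx).1
  have hk0 : ∀ x ∈ V, mvfderiv (𝓡 n) (fun x => extChartAt (𝓡 r) (prj x₀) (prj x)) x (k x) = 0 :=
    fun x hx => h.mvfderiv_chart_k (hUU' (hVU hx).1) (hVU hx).2
  -- Subtracting `τ(G i) k` moves the frame into `ker τ` and leaves its projection unchanged.
  have h1 : ∀ x ∈ V, ∀ i, mvfderiv (𝓡 n) (fun x => extChartAt (𝓡 r) (prj x₀) (prj x)) x
      (G i x - τ x (G i x) • k x) = EuclideanSpace.single i (1 : ℝ) := fun x hx i => by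
    rw [map_sub, map_smul, hk0 x hx, smul_zero, sub_zero, hGe x hx i]
  have h2 : ∀ x ∈ V, ∀ i, τ x (G i x - τ x (G i x) • k x) = 0 := fun x hx i => by
    rw [map_sub, map_smul, hτk x (hVU' hx), smul_eq_mul, mul_one, sub_self]
  refine ⟨V, hV, hxV, hVU, fun i x => G i x - τ x (G i x) • k x, fun i => ?_, h2, h1, ?_⟩
  · exact (hG i).sub ((hks.mono hVU').smul (hτ V hV hVU' _ (hG i)))
  · intro x hx v
    -- The defect of the expansion projects to zero, so it is a multiple of `k`, whose coefficient
    -- `τ` reads off.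
    obtain ⟨a, ha⟩ := h.mfderiv_eq_of_mvfderiv_chart_eq (hUU' (hVU hx).1) (hVU hx).2
      (v := v - ∑ i, (mvfderiv (𝓡 n) (fun x => extChartAt (𝓡 r) (prj x₀) (prj x)) x v) i •
        (G i x - τ x (G i x) • k x)) (by
        rw [map_sub, map_sum]
        simp only [map_smul, h1 x hx]
        ext j
        simp [Pi.single_apply])
    have h3 := congrArg (τ x) ha
    rw [map_sub, map_sum, map_smul, hτk x (hVU' hx)] at h3
    simp only [map_smul, h2 x hx, smul_eq_mul, mul_zero, mul_one, Finset.sum_const_zero,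
      sub_zero] at h3
    rw [h3, ← ha]
    exact (add_sub_cancel _ _).symm

end IsLocalLeafSpace

/-- The lift to `x` of a tangent vector of `N` with respect to the one-form `τ`. -/
def horLift (τ : OneForm n M) (k : VField n M) (prj : M → N) (x : M)
    (w : TangentSpace (𝓡 r) (prj x)) : TangentSpace (𝓡 n) x :=
  Function.invFun (mfderiv (𝓡 n) (𝓡 r) prj x) w -
    τ x (Function.invFun (mfderiv (𝓡 n) (𝓡 r) prj x) w) • k x

namespace IsLocalLeafSpace

variable {k : VField n M} {U : Set M} {prj : M → N} (h : IsLocalLeafSpace r k U prj)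
  {τ : OneForm n M}

include h

theorem mfderiv_horLift {x : M} (hx : x ∈ U) (w : TangentSpace (𝓡 r) (prj x)) :
    mfderiv (𝓡 n) (𝓡 r) prj x (horLift τ k prj x w) = w := by
  rw [horLift, map_sub, map_smul, h.k_mem_ker hx, smul_zero, sub_zero]
  exact Function.invFun_eq (h.submersion x hx w)

omit h in
theorem apply_horLift {x : M} (hτk : τ x (k x) = 1) (w : TangentSpace (𝓡 r) (prj x)) :
    τ x (horLift τ k prj x w) = 0 := by
  rw [horLift, map_sub, map_smul, hτk, smul_eq_mul, mul_one, sub_self]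

/-- Two lifts in `ker τ` differ by a multiple of `k`, which `τ` detects. This uniqueness makes the
lift linear although the preimage used to define it is arbitrary. -/
theorem eq_horLift {x : M} (hx : x ∈ U) (hτk : τ x (k x) = 1) {v : TangentSpace (𝓡 n) x}
    (hv : τ x v = 0) {w : TangentSpace (𝓡 r) (prj x)} (hvw : mfderiv (𝓡 n) (𝓡 r) prj x v = w) :
    v = horLift τ k prj x w := by
  obtain ⟨a, ha⟩ := (h.ker x hx (v - horLift τ k prj x w)).1 (by
    rw [map_sub, h.mfderiv_horLift hx, hvw, sub_self])
  have h1 := congrArg (τ x) ha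
  rw [map_sub, map_smul, apply_horLift hτk, hv, hτk, smul_eq_mul, mul_one, sub_zero] at h1
  rw [← h1, zero_smul, sub_eq_zero] at ha
  exact ha

theorem horLift_add {x : M} (hx : x ∈ U) (hτk : τ x (k x) = 1) (w w' : TangentSpace (𝓡 r) (prj x)) :
    horLift τ k prj x (w + w') = horLift τ k prj x w + horLift τ k prj x w' :=
  (h.eq_horLift hx hτk (by simp [apply_horLift hτk]) (by
    rw [map_add, h.mfderiv_horLift hx, h.mfderiv_horLift hx])).symm

theorem horLift_smul {x : M} (hx : x ∈ U) (hτk : τ x (k x) = 1) (a : ℝ)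
    (w : TangentSpace (𝓡 r) (prj x)) :
    horLift τ k prj x (a • w) = a • horLift τ k prj x w :=
  (h.eq_horLift hx hτk (by simp [apply_horLift hτk]) (by
    rw [map_smul, h.mfderiv_horLift hx])).symm

/-- The arbitrary preimage in the definition of the lift shows no regularity. Written in the adapted
frame, the coefficients are the chart components of `Y` pulled back, so smoothness and
differentiability become visible. -/
theorem exists_horLift_eq_sum (hks : k.SmoothOn U) (hτ : τ.SmoothOn U)
    (hτk : ∀ x ∈ U, τ x (k x) = 1) {x₀ : M} (hx₀ : x₀ ∈ U) :
    ∃ V : Set M, IsOpen V ∧ x₀ ∈ V ∧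
      V ⊆ U ∩ prj ⁻¹' (chartAt (EuclideanSpace ℝ (Fin r)) (prj x₀)).source ∧
      ∃ G : Fin r → VField n M, (∀ i, (G i).SmoothOn V) ∧ ∀ x ∈ V, ∀ Y : VField r N,
        horLift τ k prj x (Y (prj x)) =
          ∑ i, (mvfderiv (𝓡 r) (extChartAt (𝓡 r) (prj x₀)) (prj x) (Y (prj x))) i • G i x := by
  obtain ⟨V, hV, hxV, hVU, G, hG, hGτ, -, hv⟩ :=
    h.exists_adapted_frame h.isOpen subset_rfl hks hτ hτk hx₀
  refine ⟨V, hV, hxV, hVU, G, hG, fun x hx Y => ?_⟩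
  have := hv x hx (horLift τ k prj x (Y (prj x)))
  rw [apply_horLift (hτk x (hVU hx).1), zero_smul, add_zero,
    h.mvfderiv_chart (hVU hx).1 (hVU hx).2, h.mfderiv_horLift (hVU hx).1] at this
  exact this

theorem smoothOn_horLift (hks : k.SmoothOn U) (hτ : τ.SmoothOn U)
    (hτk : ∀ x ∈ U, τ x (k x) = 1) {W : Set N} (hW : IsOpen W) {Y : VField r N}
    (hY : Y.SmoothOn W) : VField.SmoothOn (fun x => horLift τ k prj x (Y (prj x)))
      (U ∩ prj ⁻¹' W) := by
  refine VField.smoothOn_of_locally fun x₀ hx₀ => ?_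
  obtain ⟨V, hV, hxV, hVU, G, hG, hGe⟩ := h.exists_horLift_eq_sum hks hτ hτk hx₀.1
  have hsub : V ∩ (U ∩ prj ⁻¹' W) ⊆ V := Set.inter_subset_left
  refine ⟨V ∩ (U ∩ prj ⁻¹' W), hV.inter (h.isOpen_preimage hW), ⟨hxV, hx₀⟩,
    VField.SmoothOn.congr (VField.SmoothOn.sum (s := Finset.univ)
      (X := fun i x => (mvfderiv (𝓡 r) (extChartAt (𝓡 r) (prj x₀)) (prj x) (Y (prj x))) i • G i x)
      fun i _ => VField.SmoothOn.smul ?_ ((hG i).mono hsub)) fun x hx => hGe x hx.1 Y⟩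
  have h1 := contMDiffOn_mvfderiv_apply
    (hW.inter (chartAt (EuclideanSpace ℝ (Fin r)) (prj x₀)).open_source)
    ((contMDiffOn_extChartAt (I := 𝓡 r) (n := ∞) (x := prj x₀)).mono Set.inter_subset_right)
    (hY.mono Set.inter_subset_left)
  have h2 := h1.comp (h.smooth.mono (s := U) (t := V ∩ (U ∩ prj ⁻¹' W)) fun x hx => hx.2.1)
    fun x hx => ⟨hx.2.2, (hVU hx.1).2⟩
  exact ((EuclideanSpace.proj (𝕜 := ℝ) i).contMDiff (n := ∞)).comp_contMDiffOn h2

theorem diffAt_horLift (hks : k.SmoothOn U) (hτ : τ.SmoothOn U)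
    (hτk : ∀ x ∈ U, τ x (k x) = 1) {Y : VField r N} {x₀ : M} (hx₀ : x₀ ∈ U)
    (hY : Y.DiffAt (prj x₀)) : VField.DiffAt (fun x => horLift τ k prj x (Y (prj x))) x₀ := by
  obtain ⟨V, hV, hxV, hVU, G, hG, hGe⟩ := h.exists_horLift_eq_sum hks hτ hτk hx₀
  refine VField.DiffAt.congr (VField.DiffAt.sum (s := Finset.univ)
      (X := fun i x => (mvfderiv (𝓡 r) (extChartAt (𝓡 r) (prj x₀)) (prj x) (Y (prj x))) i • G i x)
      fun i _ => VField.DiffAt.smul ?_ ((hG i).diffAt hV hxV))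
      ((hV.eventually_mem hxV).mono fun x hx => hGe x hx Y)
  have h1 := mdifferentiableAt_mvfderiv_apply
    (chartAt (EuclideanSpace ℝ (Fin r)) (prj x₀)).open_source
    (contMDiffOn_extChartAt (I := 𝓡 r) (n := ∞) (x := prj x₀)) (hVU hxV).2 hY
  have h2 := h1.comp x₀ (h.mdifferentiableAt hx₀)
  exact ((EuclideanSpace.proj (𝕜 := ℝ) i).contMDiff (n := ∞)).mdifferentiableAt (by simp)
    |>.comp x₀ h2

end IsLocalLeafSpace

end HorizontalLifts

/-! ### Tractor splittings -/

section TractorSplittings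

variable {n r : ℕ} {M : Type*} [TopologicalSpace M] [ChartedSpace (EuclideanSpace ℝ (Fin n)) M]
  [IsManifold (𝓡 n) ∞ M]
  {N : Type*} [TopologicalSpace N] [ChartedSpace (EuclideanSpace ℝ (Fin r)) N]
  [IsManifold (𝓡 r) ∞ N]

/-- A linear complex structure on a real vector space has trace zero. -/
theorem trace_eq_zero_of_mul_self_eq_neg_one {V : Type*} [AddCommGroup V] [Module ℝ V]
    [FiniteDimensional ℝ V] (j : Module.End ℝ V) (hj : j * j = -1) :
    LinearMap.trace ℝ V j = 0 := by
  set jc : Module.End ℂ (TensorProduct ℝ ℂ V) := j.baseChange ℂ with hjc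
  have hjc2 : jc * jc = -1 := by
    rw [hjc, ← LinearMap.baseChange_mul, hj, LinearMap.baseChange_neg, LinearMap.baseChange_one]
  -- A projection onto an eigenspace of the complexification. Its trace is a rank, hence real, while
  -- its imaginary part is `-tr j / 2`.
  set q : Module.End ℂ (TensorProduct ℝ ℂ V) := (2⁻¹ : ℂ) • (1 - Complex.I • jc) with hq
  have hidem : IsIdempotentElem q := by
    have : (1 - Complex.I • jc) * (1 - Complex.I • jc) = (2 : ℂ) • (1 - Complex.I • jc) := by
      rw [sub_mul, mul_sub, mul_sub, smul_mul_smul_comm, hjc2, Complex.I_mul_I]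
      simp only [one_mul, mul_one, smul_neg, neg_smul, neg_neg, one_smul, two_smul]
      abel
    rw [IsIdempotentElem, hq, smul_mul_smul_comm, this, smul_smul]
    norm_num
  have h1 := (LinearMap.IsIdempotentElem.isProj_range q hidem).trace
  have h2 : LinearMap.trace ℂ _ jc = ((LinearMap.trace ℝ V j : ℝ) : ℂ) :=
    LinearMap.trace_baseChange j ℂ
  rw [hq, map_smul, map_sub, map_smul, h2, LinearMap.trace_one] at h1
  have h3 := congrArg Complex.im h1
  simpa using h3

/-- The trace of an endomorphism of `V × ℝ`. -/
theorem trace_prod_real {V : Type*} [AddCommGroup V] [Module ℝ V] [FiniteDimensional ℝ V]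
    (j : Module.End ℝ (V × ℝ)) (a : Module.End ℝ V) (ha : ∀ v, (j (v, 0)).1 = a v) :
    LinearMap.trace ℝ (V × ℝ) j = LinearMap.trace ℝ V a + (j (0, 1)).2 := by
  have h1 : j = (j ∘ₗ LinearMap.inl ℝ V ℝ) ∘ₗ LinearMap.fst ℝ V ℝ +
      (j ∘ₗ LinearMap.inr ℝ V ℝ) ∘ₗ LinearMap.snd ℝ V ℝ := by
    ext x <;> simp [Prod.mk_zero_zero]
  have h2 : LinearMap.fst ℝ V ℝ ∘ₗ j ∘ₗ LinearMap.inl ℝ V ℝ = a := by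
    ext v; simp [ha]
  have h3 : LinearMap.trace ℝ ℝ (LinearMap.snd ℝ V ℝ ∘ₗ j ∘ₗ LinearMap.inr ℝ V ℝ)
      = (j (0, 1)).2 := by
    rw [LinearMap.trace_eq_matrix_trace ℝ (Module.Basis.singleton Unit ℝ)]
    simp [Matrix.trace, LinearMap.toMatrix_apply]
  conv_lhs => rw [h1]
  rw [map_add, LinearMap.trace_comp_comm', LinearMap.trace_comp_comm' (LinearMap.snd ℝ V ℝ),
    h2, h3]

theorem localExt_zero (x : M) : ∀ᶠ y in 𝓝 x, localExt (0 : TangentSpace (𝓡 n) x) y = 0 := by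
  set e := trivializationAt (EuclideanSpace ℝ (Fin n)) (TangentSpace (𝓡 n) (M := M)) x with he
  have hx := FiberBundle.mem_baseSet_trivializationAt' (F := EuclideanSpace ℝ (Fin n))
    (E := TangentSpace (𝓡 n) (M := M)) x
  have h1 : (e ⟨x, 0⟩).2 = 0 := by
    have h := e.coe_linearMapAt_of_mem (R := ℝ) hx
    rw [← congrFun h 0, _root_.map_zero]
  filter_upwards [e.open_baseSet.mem_nhds hx] with y hy
  change e.symm y (e ⟨x, 0⟩).2 = 0
  rw [h1]
  exact (e.symmₗ_apply (R := ℝ) hy 0).symm.trans (_root_.map_zero _)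

variable {U : Set M} {cov cov' : ConnOp n M}

/-- The Schouten tensor is evaluated on local extensions, so linearity in a slot is not part of its
definition. Here the extension of `0` vanishes near `x`, which kills every curvature term; this is
all that differentiating the canonical tractor requires. -/
theorem IsAffineConnOn.schouten_zero (h : IsAffineConnOn cov U) (hU : IsOpen U) {x : M} (hx : x ∈ U)
    (v : TangentSpace (𝓡 n) x) : schouten cov x v 0 = 0 := by
  have h0 : VField.DiffAt (fun x => (0 : TangentSpace (𝓡 n) x)) x :=
    (VField.smoothOn_zero (U := Set.univ)).diffAt isOpen_univ (Set.mem_univ x)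
  have hZ : ∀ᶠ y in 𝓝 x, cov (localExt (0 : TangentSpace (𝓡 n) x)) y = 0 := by
    filter_upwards [(localExt_zero (n := n) x).eventually_nhds, hU.eventually_mem hx] with y hy hyU
    rw [h.congr_near hU hyU ((VField.smoothOn_zero (U := Set.univ)).diffAt isOpen_univ
      (Set.mem_univ y)) hy]
    ext1 w
    exact h.map_zero hyU w
  have h1 : ricci cov x v 0 = 0 := by
    refine Finset.sum_eq_zero fun i _ => ?_
    have key : ∀ Y : VField n M, ∀ w,
        cov (fun y => cov (localExt (0 : TangentSpace (𝓡 n) x)) y (Y y)) x w = 0 := fun Y w => by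
      rw [h.congr_near hU hx h0 (hZ.mono fun y hy => by rw [hy]; rfl), h.map_zero hx]
    rw [curvature, key, key, hZ.self_of_nhds]
    simp
  have h2 : ricci cov x 0 v = 0 := by
    refine Finset.sum_eq_zero fun i _ => ?_
    have hb : ∀ X : VField n M,
        VectorField.mlieBracket (𝓡 n) X (localExt (0 : TangentSpace (𝓡 n) x)) x = 0 := fun X => by
      have hb := mlieBracket_fun_smul_right (X := X) (f := fun _ => 0)
        (mdifferentiableAt_const (x := x)) h0
      rw [mlieBracket_congr (X' := X) (Filter.Eventually.of_forall fun _ => rfl)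
        (localExt_zero (n := n) x)]
      simpa only [smul_zero, zero_smul, add_zero] using hb
    have key : ∀ Z : VField n M, ∀ w,
        cov (fun y => cov Z y (localExt (0 : TangentSpace (𝓡 n) x) y)) x w = 0 := fun Z w => by
      rw [h.congr_near hU hx h0 ((localExt_zero (n := n) x).mono fun y hy => by
        rw [hy, _root_.map_zero]), h.map_zero hx]
    rw [curvature, key, hb, localExt_self]
    simp
  rw [schouten, h1, h2]
  simp

/-- The Schouten tensor depends on the connection only locally. -/
theorem schouten_congr [T2Space M] (hU : IsOpen U) (h : IsAffineConnOn cov U)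
    (h' : IsAffineConnOn cov' U)
    (heq : ∀ x ∈ U, ∀ σ : VField n M, σ.DiffAt x → cov' σ x = cov σ x) {x : M} (hx : x ∈ U)
    (v w : TangentSpace (𝓡 n) x) : schouten cov' x v w = schouten cov x v w := by
  obtain ⟨V₀, hV₀, hxV₀, hext⟩ := exists_localExt_smoothOn (n := n) x
  set V := V₀ ∩ U with hVdef
  have hV : IsOpen V := hV₀.inter hU
  have hxV : x ∈ V := ⟨hxV₀, hx⟩
  have hext' : ∀ v : TangentSpace (𝓡 n) x, (localExt v).SmoothOn V := fun v =>
    (hext v).mono Set.inter_subset_left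
  have hcurv : ∀ u v w : TangentSpace (𝓡 n) x,
      curvature cov' (localExt u) (localExt v) (localExt w) x
        = curvature cov (localExt u) (localExt v) (localExt w) x := by
    intro u v w
    have key : ∀ u v : TangentSpace (𝓡 n) x,
        cov' (fun y => cov' (localExt w) y (localExt v y)) x (localExt u x)
          = cov (fun y => cov (localExt w) y (localExt v y)) x (localExt u x) := by
      intro u v
      have hs := h.smoothOn_apply hU hV Set.inter_subset_right (hext' w) (hext' v)
      rw [h'.congr_near hU hx (hs.diffAt hV hxV) ((hV.eventually_mem hxV).mono fun y hy => by
        rw [heq y hy.2 _ ((hext' w).diffAt hV hy)]), heq x hx _ (hs.diffAt hV hxV)]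
    rw [curvature, curvature, key, key, heq x hx _ ((hext' w).diffAt hV hxV)]
  have hric : ∀ v w, ricci cov' x v w = ricci cov x v w := fun v w => by
    simp only [ricci, hcurv]
  rw [schouten, schouten, hric, hric]

/-- A connection of the restricted class agrees near every point with one of the class. -/
theorem ProjStructure.exists_eq_near [T2Space M] (p : ProjStructure n M) (hU : IsOpen U)
    (hcov : cov ∈ p.restrict U) {x₀ : M} (hx₀ : x₀ ∈ U) :
    ∃ c : p.carrier, ∃ V : Set M, IsOpen V ∧ x₀ ∈ V ∧ V ⊆ U ∧
      ∀ x ∈ V, ∀ σ : VField n M, σ.DiffAt x → c.1 σ x = cov σ x := by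
  obtain ⟨-, -, c₀, hc₀, Υ, hΥ, hch⟩ := hcov
  obtain ⟨ρ, hρ, hsupp, V, hV, hxV, hVU, hρ1⟩ := exists_bump (n := n) hU hx₀
  obtain ⟨b, hb, hbt, hp⟩ := p.isClass
  have hc₀' := hc₀
  rw [hp] at hc₀'
  obtain ⟨ha, ht, Υ₀, hΥ₀, hch₀⟩ := hc₀'
  have hΥρ := hΥ.bump_smul hU hρ hsupp
  -- The local change `Υ` is cut off by `ρ`, so that it becomes a global change which is unaltered
  -- on `V`.
  refine ⟨⟨projChange c₀ (fun x => ρ x • Υ x), ?_⟩, V, hV, hxV, hVU, fun x hx σ hσ => ?_⟩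
  · rw [hp]
    refine ⟨ha.projChange isOpen_univ hΥρ, ht.projChange, fun x => Υ₀ x + ρ x • Υ x,
      fun W hW hWU X hX => ?_, hch₀.trans (isProjChangeOn_projChange _ _ _)⟩
    exact (hΥ₀ W hW hWU X hX).add (hΥρ W hW hWU X hX)
  · ext1 v
    rw [projChange_apply, hch σ x (hVU hx) hσ v, hρ1 x hx, one_smul]

theorem ProjStructure.affine (p : ProjStructure n M) (c : p.carrier) :
    IsAffineConnOn c.1 Set.univ ∧ IsTorsionFreeOn c.1 Set.univ := by
  obtain ⟨b, hb, hbt, hp⟩ := p.isClass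
  obtain ⟨h1, h2, -⟩ := hp.subset c.2
  exact ⟨h1, h2⟩

/-- A pair of a vector field and a function, as a section of `T ⊗ E(1)`. -/
def tractorSecOf (p : ProjStructure n M) (c : p.carrier) (ν : VField n M) (ρ : M → ℝ) :
    TractorSec p := fun x => (tractorSplit p c x).symm (ν x, ρ x)

/-- Two splittings differ by the smooth function `Υ(ν)`, so one splitting suffices to test
smoothness. -/
theorem tractorSecOf_smoothOn {p : ProjStructure n M} {c : p.carrier} {W : Set M} (hW : IsOpen W)
    {ν : VField n M} (hν : ν.SmoothOn W) {ρ : M → ℝ} (hρ : SmoothFunOn n ρ W) :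
    (tractorSecOf p c ν ρ).SmoothOn W := by
  intro c'
  obtain ⟨Υ, hΥ, hch⟩ := p.exists_change c c'
  have key : ∀ x, tractorSplit p c' x (tractorSecOf p c ν ρ x) = (ν x, ρ x - Υ x (ν x)) := by
    intro x
    have h1 : tractorSplit p c x (tractorSecOf p c ν ρ x) = (ν x, ρ x) :=
      LinearEquiv.apply_symm_apply _ _
    have h2 : (tractorSecOf p c ν ρ x).1 c' = _ := (tractorSecOf p c ν ρ x).2 c c' Υ hch
    have h3 : (tractorSecOf p c ν ρ x).1 c = (ν x, ρ x) := h1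
    rw [h3] at h2
    exact h2
  simp only [key]
  exact ⟨hν, hρ.sub (hΥ W hW (Set.subset_univ _) ν hν)⟩

/-- A tractor endomorphism in the splitting given by `c`. -/
def tractorEndSplit (p : ProjStructure n M) (J : TractorEnd p) (c : p.carrier) (x : M) :
    Module.End ℝ (TangentSpace (𝓡 n) x × ℝ) :=
  (tractorSplit p c x).conj (J x)

theorem tractorSplit_apply_secOf (p : ProjStructure n M) (J : TractorEnd p) (c : p.carrier)
    (ν : VField n M) (ρ : M → ℝ) (x : M) :
    tractorSplit p c x (J x (tractorSecOf p c ν ρ x))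
      = tractorEndSplit p J c x (ν x, ρ x) := rfl

theorem tractorEndSplit_canonical (p : ProjStructure n M) (J : TractorEnd p) (c : p.carrier)
    (x : M) : (tractorEndSplit p J c x (0, 1)).1 = underlyingField p J x := by
  have h : (tractorSplit p c x).symm (0, 1) = canonicalTractor p x := by
    rw [LinearEquiv.symm_apply_eq]
    rfl
  rw [underlyingField, tractorProj_eq p c, ← h]
  rfl

/-! ### The blocks of the tractor complex structure in a splitting -/

namespace IsParallelTractorComplexStructure

variable {p : ProjStructure n M} {J : TractorEnd p} (hJ : IsParallelTractorComplexStructure p J)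
  (c : p.carrier)

include hJ

theorem split_sq (x : M) : tractorEndSplit p J c x * tractorEndSplit p J c x = -1 := by
  refine LinearMap.ext fun t => ?_
  have h : J x (J x ((tractorSplit p c x).symm t)) = -(tractorSplit p c x).symm t :=
    congrArg (fun A : Module.End ℝ (TractorFibre p x) => A ((tractorSplit p c x).symm t)) (hJ.sq x)
  change tractorSplit p c x (J x ((tractorSplit p c x).symm
    (tractorSplit p c x (J x ((tractorSplit p c x).symm t))))) = -t
  rw [LinearEquiv.symm_apply_apply, h, map_neg, LinearEquiv.apply_symm_apply]

theorem split_smoothOn {W : Set M} (hW : IsOpen W) {ν : VField n M} (hν : ν.SmoothOn W)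
    {ρ : M → ℝ} (hρ : SmoothFunOn n ρ W) :
    VField.SmoothOn (fun x => (tractorEndSplit p J c x (ν x, ρ x)).1) W ∧
      SmoothFunOn n (fun x => (tractorEndSplit p J c x (ν x, ρ x)).2) W :=
  hJ.smooth W hW _ (tractorSecOf_smoothOn (c := c) hW hν hρ) c

theorem split_parallel {W : Set M} (hW : IsOpen W) {ν : VField n M} (hν : ν.SmoothOn W)
    {ρ : M → ℝ} (hρ : SmoothFunOn n ρ W) {x : M} (hx : x ∈ W) (v : TangentSpace (𝓡 n) x) :
    (c.1 (fun y => (tractorEndSplit p J c y (ν y, ρ y)).1) x v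
        + (tractorEndSplit p J c x (ν x, ρ x)).2 • v,
      mvfderiv (𝓡 n) (fun y => (tractorEndSplit p J c y (ν y, ρ y)).2) x v
        - schouten c.1 x v (tractorEndSplit p J c x (ν x, ρ x)).1)
      = tractorEndSplit p J c x (c.1 ν x v + ρ x • v,
          mvfderiv (𝓡 n) ρ x v - schouten c.1 x v (ν x)) := by
  have h := congrArg (tractorSplit p c x) (hJ.parallel c W hW _
    (tractorSecOf_smoothOn (c := c) hW hν hρ) x hx v)
  simp only [tractorConn, tractorSplit_apply_secOf, LinearEquiv.apply_symm_apply] at h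
  refine h.trans ?_
  have e : ∀ y, tractorSplit p c y (tractorSecOf p c ν ρ y) = (ν y, ρ y) := fun y =>
    LinearEquiv.apply_symm_apply _ _
  simp only [e]
  rfl

theorem underlyingField_smoothOn (W : Set M) (hW : IsOpen W) :
    (underlyingField p J).SmoothOn W := by
  have c := p.nonempty.some
  have := (hJ.split_smoothOn c hW (VField.smoothOn_zero) (ρ := fun _ => 1) contMDiffOn_const).1
  simpa only [tractorEndSplit_canonical] using this

/-- The weight function of the canonical section. -/
theorem split_apply_vector (x : M) (v : TangentSpace (𝓡 n) x) :
    tractorEndSplit p J c x (v, 0)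
      = (c.1 (underlyingField p J) x v + (tractorEndSplit p J c x (0, 1)).2 • v,
        mvfderiv (𝓡 n) (fun y => (tractorEndSplit p J c y (0, 1)).2) x v
          - schouten c.1 x v (underlyingField p J x)) := by
  -- The derivative of the canonical section `(0, 1)` is `(v, 0)`, so parallelism expresses `𝕁(v,
  -- 0)` as the derivative of `𝕁(0, 1)`.
  have h := hJ.split_parallel c isOpen_univ (VField.smoothOn_zero) (ρ := fun _ => 1)
    contMDiffOn_const (Set.mem_univ x) v
  simp only [tractorEndSplit_canonical] at h
  rw [h, (p.affine c).1.map_zero (Set.mem_univ x),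
    (p.affine c).1.schouten_zero isOpen_univ (Set.mem_univ x)]
  simp [mvfderiv_const]

/-- With `b` the weight component of `𝕁(0, 1)`, the trace of `𝕁` is `(div k + n b) + b`, and a
complex structure is trace-free. Hence divergence-free scales are those with `b = 0`. -/
theorem divergence_eq (x : M) : divergence c.1 (underlyingField p J) x
    = -((n + 1) * (tractorEndSplit p J c x (0, 1)).2) := by
  have h1 := trace_eq_zero_of_mul_self_eq_neg_one _ (hJ.split_sq c x)
  rw [trace_prod_real _ ((c.1 (underlyingField p J) x).toLinearMap +
    (tractorEndSplit p J c x (0, 1)).2 • LinearMap.id) (fun v => by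
      rw [hJ.split_apply_vector c x v]; rfl), map_add, map_smul, LinearMap.trace_id,
    finrank_tangentSpace, smul_eq_mul] at h1
  rw [divergence]
  linarith

end IsParallelTractorComplexStructure

/-- The algebraic data which a parallel tractor complex structure with underlying field `k` induces
in a scale for which `k` is divergence-free. -/
structure IsScaleData (k : VField n M) (U : Set M) (cov : ConnOp n M) (τ : OneForm n M) :
    Prop where
  affine : IsAffineConnOn cov U
  torsionFree : IsTorsionFreeOn cov U
  smooth_field : k.SmoothOn U
  smooth_form : τ.SmoothOn U
  cov_field : ∀ x ∈ U, cov k x (k x) = 0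
  sq : ∀ x ∈ U, ∀ v : TangentSpace (𝓡 n) x, cov k x (cov k x v) = -v + τ x v • k x
  deriv : ∀ W : Set M, IsOpen W → W ⊆ U → ∀ ν : VField n M, ν.SmoothOn W → ∀ x ∈ W,
    ∀ v : TangentSpace (𝓡 n) x, ∃ a : ℝ,
      cov (fun y => cov k y (ν y)) x v = cov k x (cov ν x v) + τ x (ν x) • v + a • k x

/-- The Schouten tensor paired with a vector field, as a one-form. -/
def schoutenForm (cov : ConnOp n M) (k : VField n M) : OneForm n M := fun x =>
  open Classical in
  if h : IsLinearMap ℝ (fun v => schouten cov x v (k x)) then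
    LinearMap.toContinuousLinearMap (h.mk' _) else 0

/-- In a splitting near a point of an open set on which `k` is divergence-free. -/
theorem IsParallelTractorComplexStructure.exists_local [T2Space M] {p : ProjStructure n M}
    {J : TractorEnd p} (hJ : IsParallelTractorComplexStructure p J) (hU : IsOpen U)
    (hcov : cov ∈ p.restrict U) (hdiv : ∀ x ∈ U, divergence cov (underlyingField p J) x = 0)
    {x₀ : M} (hx₀ : x₀ ∈ U) : ∃ c : p.carrier, ∃ V : Set M, IsOpen V ∧ x₀ ∈ V ∧ V ⊆ U ∧
      (∀ x ∈ V, ∀ σ : VField n M, σ.DiffAt x → c.1 σ x = cov σ x) ∧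
      (∀ x ∈ V, ∀ v : TangentSpace (𝓡 n) x, tractorEndSplit p J c x (v, 0)
        = (cov (underlyingField p J) x v, -schouten cov x v (underlyingField p J x))) ∧
      (∀ x ∈ V, tractorEndSplit p J c x (0, 1) = (underlyingField p J x, 0)) := by
  obtain ⟨c, V, hV, hxV, hVU, heq⟩ := p.exists_eq_near hU hcov hx₀
  have hk := hJ.underlyingField_smoothOn Set.univ isOpen_univ
  have hkd : ∀ x, (underlyingField p J).DiffAt x := fun x => hk.diffAt isOpen_univ (Set.mem_univ x)
  have hb : ∀ x ∈ V, (tractorEndSplit p J c x (0, 1)).2 = 0 := fun x hx => by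
    have h1 := hJ.divergence_eq c x
    have h2 : divergence c.1 (underlyingField p J) x = 0 := by
      rw [← hdiv x (hVU hx), divergence, divergence, heq x hx _ (hkd x)]
    rw [h2, zero_eq_neg, mul_eq_zero] at h1
    exact h1.resolve_left (by positivity)
  have haff := (p.affine c).1.mono isOpen_univ hV (Set.subset_univ V)
  have hsch : ∀ x ∈ V, ∀ v w : TangentSpace (𝓡 n) x, schouten c.1 x v w = schouten cov x v w :=
    fun x hx v w => schouten_congr hV (hcov.1.mono hU hV hVU) haff heq hx v w
  refine ⟨c, V, hV, hxV, hVU, heq, fun x hx v => ?_, fun x hx =>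
    Prod.ext (tractorEndSplit_canonical p J c x) (hb x hx)⟩
  rw [hJ.split_apply_vector c x v, hb x hx, hsch x hx, heq x hx _ (hkd x),
    mvfderiv_congr ((hV.eventually_mem hx).mono fun y hy => hb y hy), mvfderiv_const]
  simp

/-- With `b = 0` the endomorphism is `(v, b) ↦ (∇_v k + b k, -τ(v))`. All algebraic and differential
relations are the vector components of `𝕁² = -1` and of parallelism in this form. -/
theorem IsParallelTractorComplexStructure.isScaleData [T2Space M] {p : ProjStructure n M}
    {J : TractorEnd p} (hJ : IsParallelTractorComplexStructure p J) (hU : IsOpen U)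
    (hcov : cov ∈ p.restrict U) (hdiv : ∀ x ∈ U, divergence cov (underlyingField p J) x = 0) :
    (∀ x ∈ U, ∀ v, schoutenForm cov (underlyingField p J) x v
      = schouten cov x v (underlyingField p J x)) ∧
    IsScaleData (underlyingField p J) U cov (schoutenForm cov (underlyingField p J)) := by
  set k := underlyingField p J with hkdef
  have hk := hJ.underlyingField_smoothOn Set.univ isOpen_univ
  have hkU : k.SmoothOn U := hk.mono (Set.subset_univ U)
  -- Linearity of `v ↦ P(v, k)` is inherited from `𝕁`, of which it is minus a matrix entry. So the
  -- zero default in `schoutenForm` is never taken on `U`.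
  have hτ : ∀ x ∈ U, ∀ v, schoutenForm cov k x v = schouten cov x v (k x) := by
    intro x hx v
    obtain ⟨c, V, hV, hxV, hVU, heq, hj, hj1⟩ := hJ.exists_local hU hcov hdiv hx
    have hlin : IsLinearMap ℝ (fun v => schouten cov x v (k x)) := by
      have h1 : ∀ v, schouten cov x v (k x) = -(tractorEndSplit p J c x (v, 0)).2 := fun v => by
        rw [hj x hxV]; simp [hkdef]
      constructor
      · intro v w
        have : ((v + w, 0) : TangentSpace (𝓡 n) x × ℝ) = (v, 0) + (w, 0) := by simp
        rw [h1, h1, h1, this, map_add, Prod.snd_add, neg_add]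
      · intro a v
        have : ((a • v, 0) : TangentSpace (𝓡 n) x × ℝ) = a • (v, 0) := by simp
        rw [h1, h1, this, map_smul, Prod.smul_snd, smul_neg]
    rw [schoutenForm, dif_pos hlin]
    rfl
  have hloc : ∀ x₀ ∈ U, ∃ c : p.carrier, ∃ V : Set M, IsOpen V ∧ x₀ ∈ V ∧ V ⊆ U ∧
      (∀ x ∈ V, ∀ σ : VField n M, σ.DiffAt x → c.1 σ x = cov σ x) ∧
      (∀ x ∈ V, ∀ (v : TangentSpace (𝓡 n) x) (b : ℝ), tractorEndSplit p J c x (v, b)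
        = (cov k x v + b • k x, -schoutenForm cov k x v)) := by
    intro x₀ hx₀
    obtain ⟨c, V, hV, hxV, hVU, heq, hj, hj1⟩ := hJ.exists_local hU hcov hdiv hx₀
    refine ⟨c, V, hV, hxV, hVU, heq, fun x hx v b => ?_⟩
    have : ((v, b) : TangentSpace (𝓡 n) x × ℝ) = (v, 0) + b • (0, 1) := by simp
    rw [this, map_add, map_smul, hj x hx, hj1 x hx, hτ x (hVU hx)]
    simp [hkdef]
  refine ⟨hτ, hcov.1, hcov.2.1, hkU, ?_, ?_, ?_, ?_⟩
  · intro W hW hWU X hX x₀ hx₀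
    obtain ⟨c, V, hV, hxV, hVU, heq, hj⟩ := hloc x₀ (hWU hx₀)
    have h1 := (hJ.split_smoothOn c (hW.inter hV) (hX.mono Set.inter_subset_left)
      (ρ := fun _ => 0) contMDiffOn_const).2
    have h2 : SmoothFunOn n (fun x => schoutenForm cov k x (X x)) (W ∩ V) := by
      refine ContMDiffOn.congr (ContMDiffOn.neg h1) fun x hx => ?_
      rw [hj x hx.2, neg_neg]
    exact (h2.contMDiffAt ((hW.inter hV).mem_nhds ⟨hx₀, hxV⟩)).contMDiffWithinAt
  · intro x hx
    obtain ⟨c, V, hV, hxV, hVU, heq, hj⟩ := hloc x hx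
    have h1 := congrArg (fun A : Module.End ℝ (TangentSpace (𝓡 n) x × ℝ) => A (0, 1))
      (hJ.split_sq c x)
    simp only [Module.End.mul_apply, hj x hxV, map_zero, zero_add, one_smul, neg_zero, zero_smul,
      add_zero] at h1
    exact congrArg Prod.fst h1 |>.trans (by simp)
  · intro x hx v
    obtain ⟨c, V, hV, hxV, hVU, heq, hj⟩ := hloc x hx
    have h1 := congrArg (fun A : Module.End ℝ (TangentSpace (𝓡 n) x × ℝ) => A (v, 0))
      (hJ.split_sq c x)
    simp only [Module.End.mul_apply, hj x hxV, zero_smul, add_zero] at h1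
    have h2 : cov k x (cov k x v) + -schoutenForm cov k x v • k x = -v :=
      (congrArg Prod.fst h1).trans (by simp)
    rw [← h2, neg_smul]
    abel
  · intro W hW hWU ν hν x hx v
    obtain ⟨c, V, hV, hxV, hVU, heq, hj⟩ := hloc x (hWU hx)
    have hWV := hW.inter hV
    have hνV := hν.mono (W := W ∩ V) Set.inter_subset_left
    have h1 := congrArg Prod.fst (hJ.split_parallel c hWV hνV (ρ := fun _ => 0) contMDiffOn_const
      ⟨hx, hxV⟩ v)
    simp only [hj x hxV, zero_smul, add_zero] at h1
    have hs := hcov.1.smoothOn_apply hU hWV (fun y hy => hVU hy.2)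
      (hkU.mono fun y hy => hVU hy.2) hνV
    rw [(p.affine c).1.congr_near isOpen_univ (Set.mem_univ x) (hs.diffAt hWV ⟨hx, hxV⟩)
      ((hWV.eventually_mem ⟨hx, hxV⟩).mono fun y hy => by
        rw [hj y hy.2, zero_smul, add_zero]), heq x hxV _ (hs.diffAt hWV ⟨hx, hxV⟩),
      heq x hxV _ (hνV.diffAt hWV ⟨hx, hxV⟩)] at h1
    -- The coefficient of `k` is the weight component of the tractor derivative of `(ν, 0)`. It
    -- disappears on the leaf space, so its value need not be recorded.
    refine ⟨mvfderiv (𝓡 n) (fun _ => (0 : ℝ)) x v - schouten c.1 x v (ν x), ?_⟩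
    rw [add_right_comm, ← h1, neg_smul]
    abel

end TractorSplittings

/-! ### Symmetry of scales -/

section SymmetryOfScales

variable {n r : ℕ} {M : Type*} [TopologicalSpace M] [ChartedSpace (EuclideanSpace ℝ (Fin n)) M]
  [IsManifold (𝓡 n) ∞ M]
  {N : Type*} [TopologicalSpace N] [ChartedSpace (EuclideanSpace ℝ (Fin r)) N]
  [IsManifold (𝓡 r) ∞ N]

/-- Cramer's rule: alternating forms vanish on dependent families, so `g` is a basis, and replacing
its `i`-th entry by `v` extracts the `i`-th coordinate. -/
theorem exists_basis_of_alternatingMap_eq_one {E : Type*} [AddCommGroup E] [Module ℝ E]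
    [FiniteDimensional ℝ E] (hE : Module.finrank ℝ E = n) (β : E [⋀^Fin n]→ₗ[ℝ] ℝ) (g : Fin n → E)
    (hg : β g = 1) : ∃ b : Module.Basis (Fin n) ℝ E, (∀ i, b i = g i) ∧
      ∀ v i, b.repr v i = β (Function.update g i v) := by
  have hli : LinearIndependent ℝ g := by
    by_contra hg'
    rw [β.map_linearDependent g hg'] at hg
    exact zero_ne_one hg
  let b := basisOfLinearIndependentOfCardEqFinrank' g hli (by simp [hE])
  have hb : ∀ i, b i = g i := fun i => by simp [b]
  refine ⟨b, hb, fun v i => ?_⟩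
  conv_rhs => rw [← b.sum_repr v]
  rw [AlternatingMap.map_update_sum, Finset.sum_eq_single i]
  · rw [AlternatingMap.map_update_smul, hb, Function.update_eq_self, hg, smul_eq_mul, mul_one]
  · intro j _ hj
    rw [AlternatingMap.map_update_smul, hb, β.map_update_self _ hj.symm, smul_zero]
  · simp

theorem sum_alternatingMap_update_apply {E : Type*} [AddCommGroup E] [Module ℝ E]
    [FiniteDimensional ℝ E] (hE : Module.finrank ℝ E = n) (β : E [⋀^Fin n]→ₗ[ℝ] ℝ) (g : Fin n → E)
    (hg : β g = 1) (A : Module.End ℝ E) :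
    ∑ i, β (Function.update g i (A (g i))) = LinearMap.trace ℝ E A := by
  obtain ⟨b, hb, hrepr⟩ := exists_basis_of_alternatingMap_eq_one hE β g hg
  rw [LinearMap.trace_eq_matrix_trace ℝ b]
  simp [Matrix.trace, LinearMap.toMatrix_apply, hrepr, hb]

theorem eq_sum_alternatingMap_update {E : Type*} [AddCommGroup E] [Module ℝ E]
    [FiniteDimensional ℝ E] (hE : Module.finrank ℝ E = n) (β : E [⋀^Fin n]→ₗ[ℝ] ℝ) (g : Fin n → E)
    (hg : β g = 1) (v : E) : v = ∑ i, β (Function.update g i v) • g i := by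
  obtain ⟨b, hb, hrepr⟩ := exists_basis_of_alternatingMap_eq_one hE β g hg
  conv_lhs => rw [← b.sum_repr v]
  simp only [hrepr, hb]

theorem mlieBracket_fun_sum_right {ι : Type*} (s : Finset ι) {X : VField n M} {Y : ι → VField n M}
    {x : M} (hY : ∀ i ∈ s, (Y i).DiffAt x) :
    VectorField.mlieBracket (𝓡 n) X (fun y => ∑ i ∈ s, Y i y) x
      = ∑ i ∈ s, VectorField.mlieBracket (𝓡 n) X (Y i) x := by
  classical
  induction s using Finset.induction_on with
  | empty =>
    have h0 : VField.DiffAt (fun x => (0 : TangentSpace (𝓡 n) x)) x :=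
      (VField.smoothOn_zero (U := Set.univ)).diffAt isOpen_univ (Set.mem_univ x)
    have hb := mlieBracket_fun_smul_right (X := X) (f := fun _ => 0)
      (mdifferentiableAt_const (x := x)) h0
    simpa only [Finset.sum_empty, smul_zero, zero_smul, add_zero] using hb
  | insert a s ha ih =>
    simp only [Finset.sum_insert ha]
    rw [mlieBracket_fun_add_right (hY a (Finset.mem_insert_self a s))
      (VField.DiffAt.sum fun i hi => hY i (Finset.mem_insert_of_mem hi)),
      ih fun i hi => hY i (Finset.mem_insert_of_mem hi)]

theorem mvfderiv_fun_finsetSum {ι : Type*} (s : Finset ι) {f : ι → M → ℝ} {x : M}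
    (hf : ∀ i ∈ s, MDifferentiableAt (𝓡 n) 𝓘(ℝ, ℝ) (f i) x) (v : TangentSpace (𝓡 n) x) :
    mvfderiv (𝓡 n) (fun y => ∑ i ∈ s, f i y) x v = ∑ i ∈ s, mvfderiv (𝓡 n) (f i) x v := by
  classical
  suffices MDifferentiableAt (𝓡 n) 𝓘(ℝ, ℝ) (fun y => ∑ i ∈ s, f i y) x ∧
      mvfderiv (𝓡 n) (fun y => ∑ i ∈ s, f i y) x v = ∑ i ∈ s, mvfderiv (𝓡 n) (f i) x v from this.2
  induction s using Finset.induction_on with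
  | empty => exact ⟨by simpa using mdifferentiableAt_const, by simp [mvfderiv_const]⟩
  | insert a s ha ih =>
    obtain ⟨h1, h2⟩ := ih fun i hi => hf i (Finset.mem_insert_of_mem hi)
    have h3 := hf a (Finset.mem_insert_self a s)
    simp only [Finset.sum_insert ha]
    refine ⟨h3.add h1, ?_⟩
    rw [mvfderiv_fun_add h3 h1, ← h2]
    rfl

variable {U : Set M} {cov : ConnOp n M} {k : VField n M}

/-- The compatibility of a volume form with a connection. -/
def IsParallelVolumeOn (cov : ConnOp n M) (U : Set M)
    (μ : Π x : M, (TangentSpace (𝓡 n) x) [⋀^Fin n]→ₗ[ℝ] ℝ) : Prop :=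
  ∀ W : Set M, IsOpen W → W ⊆ U → ∀ X : Fin n → VField n M, (∀ i, (X i).SmoothOn W) →
    SmoothFunOn n (fun x => μ x (fun i => X i x)) W ∧
    ∀ x ∈ W, ∀ v : TangentSpace (𝓡 n) x,
      mvfderiv (𝓡 n) (fun y => μ y (fun i => X i y)) x v
        = ∑ i, μ x (Function.update (fun j => X j x) i (cov (X i) x v))

variable {μ : Π x : M, (TangentSpace (𝓡 n) x) [⋀^Fin n]→ₗ[ℝ] ℝ}

/-- A local frame is normalised by dividing one of its members by its volume; `i₀` names that
member, so a slot must exist. -/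
theorem IsParallelVolumeOn.exists_frame (hμ : IsParallelVolumeOn cov U μ) (hU : IsOpen U)
    (hμ0 : ∀ x ∈ U, μ x ≠ 0) (i₀ : Fin n) {x₀ : M} (hx₀ : x₀ ∈ U) :
    ∃ V : Set M, IsOpen V ∧ x₀ ∈ V ∧ V ⊆ U ∧ ∃ G : Fin n → VField n M, (∀ i, (G i).SmoothOn V) ∧
      ∀ x ∈ V, μ x (fun i => G i x) = 1 := by
  obtain ⟨V₀, hV₀, hxV₀, hext⟩ := exists_localExt_smoothOn (n := n) x₀
  let b : Module.Basis (Fin n) ℝ (TangentSpace (𝓡 n) x₀) :=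
    (EuclideanSpace.basisFun (Fin n) ℝ).toBasis
  let X : Fin n → VField n M := fun i => localExt (b i)
  let f : M → ℝ := fun x => μ x (fun i => X i x)
  have hX : ∀ i, (X i).SmoothOn (V₀ ∩ U) := fun i => (hext (b i)).mono Set.inter_subset_left
  have hf : SmoothFunOn n f (V₀ ∩ U) := (hμ _ (hV₀.inter hU) Set.inter_subset_right X hX).1
  have hf0 : f x₀ ≠ 0 := by
    have h1 : f x₀ = μ x₀ b := congrArg (μ x₀) (funext fun i => localExt_self (b i))
    rw [h1]
    intro h2
    exact hμ0 x₀ hx₀ ((AlternatingMap.map_basis_eq_zero_iff b (μ x₀)).1 h2)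
  have hV : IsOpen ((V₀ ∩ U) ∩ f ⁻¹' {0}ᶜ) :=
    hf.continuousOn.isOpen_inter_preimage (hV₀.inter hU) isOpen_compl_singleton
  have hfV := ContMDiffOn.mono hf (Set.inter_subset_left (t := f ⁻¹' {0}ᶜ))
  refine ⟨_, hV, ⟨⟨hxV₀, hx₀⟩, hf0⟩, fun x hx => hx.1.2,
    fun i x => Function.update (fun i => X i x) i₀ ((f x)⁻¹ • X i₀ x) i, fun i => ?_, ?_⟩
  · by_cases hi : i = i₀
    · subst hi
      simp only [Function.update_self]
      exact VField.SmoothOn.smul (ContMDiffOn.inv₀ hfV fun x hx => hx.2)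
        ((hX i).mono Set.inter_subset_left)
    · simp only [Function.update_of_ne hi]
      exact (hX i).mono Set.inter_subset_left
  · rintro x ⟨-, hx⟩
    change μ x (Function.update (fun i => X i x) i₀ ((f x)⁻¹ • X i₀ x)) = 1
    rw [AlternatingMap.map_update_smul, Function.update_eq_self]
    exact inv_mul_cancel₀ hx

theorem IsParallelVolumeOn.smoothOn_update (hμ : IsParallelVolumeOn cov U μ) {V : Set M}
    (hV : IsOpen V) (hVU : V ⊆ U) {G : Fin n → VField n M} (hG : ∀ i, (G i).SmoothOn V) (j : Fin n)
    {Z : VField n M} (hZ : Z.SmoothOn V) :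
    SmoothFunOn n (fun x => μ x (Function.update (fun i => G i x) j (Z x))) V := by
  have h := (hμ V hV hVU (Function.update G j Z) fun i => by
    by_cases hi : i = j
    · subst hi; rwa [Function.update_self]
    · rw [Function.update_of_ne hi]; exact hG i).1
  refine ContMDiffOn.congr h fun x _ => congrArg (μ x) (funext fun i => ?_)
  by_cases hi : i = j
  · subst hi; simp
  · simp [Function.update_of_ne hi]

/-- Trace of the Lie derivative of a special connection along a divergence-free field. -/
theorem IsParallelVolumeOn.trace_lieDerivConn [T2Space M] (hμ : IsParallelVolumeOn cov U μ)
    (hU : IsOpen U)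
    (h : IsAffineConnOn cov U) (ht : IsTorsionFreeOn cov U) (hdiv : ∀ x ∈ U, divergence cov k x = 0)
    {V : Set M} (hV : IsOpen V) (hVU : V ⊆ U) (hk : k.SmoothOn V)
    {G : Fin n → VField n M} (hG : ∀ i, (G i).SmoothOn V) (hG1 : ∀ x ∈ V, μ x (fun i => G i x) = 1)
    {Z : VField n M} (hZ : Z.SmoothOn V) {x : M} (hx : x ∈ V) :
    ∑ i, μ x (Function.update (fun j => G j x) i (lieDerivConn cov k Z (G i) x)) = 0 := by
  -- By Cramer's rule these are the coordinates with respect to the unimodular frame `G`.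
  let l : Fin n → Π x : M, TangentSpace (𝓡 n) x → ℝ := fun j x v =>
    μ x (Function.update (fun i => G i x) j v)
  have ladd : ∀ j x v w, l j x (v + w) = l j x v + l j x w := fun j x v w =>
    (μ x).map_update_add _ _ _ _
  have lsmul : ∀ j x (a : ℝ) v, l j x (a • v) = a * l j x v := fun j x a v =>
    (μ x).map_update_smul _ _ _ _
  have lsub : ∀ j x v w, l j x (v - w) = l j x v - l j x w := fun j x v w =>
    (μ x).map_update_sub _ _ _ _
  have lsum : ∀ j x (v : Fin n → TangentSpace (𝓡 n) x), l j x (∑ i, v i) = ∑ i, l j x (v i) :=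
    fun j x v => (μ x).map_update_sum _ _ _ _
  have lG : ∀ j, ∀ y ∈ V, ∀ i, l j y (G i y) = if i = j then 1 else 0 := fun j y hy i => by
    split_ifs with hij
    · subst hij
      exact (congrArg (μ y) (Function.update_eq_self _ _)).trans (hG1 y hy)
    · exact (μ y).map_update_self _ (Ne.symm hij)
  have lexp : ∀ y ∈ V, ∀ v, v = ∑ j, l j y v • G j y := fun y hy v =>
    eq_sum_alternatingMap_update (finrank_tangentSpace y) (μ y) _ (hG1 y hy) v
  have lsmooth : ∀ j (X : VField n M), X.SmoothOn V → SmoothFunOn n (fun y => l j y (X y)) V :=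
    fun j X hX => hμ.smoothOn_update hV hVU hG j hX
  -- The volume of `G` is constant and the volume form parallel, so the connection matrix is
  -- trace-free.
  have lcov : ∀ y ∈ V, ∀ v, ∑ i, l i y (cov (G i) y v) = 0 := fun y hy v => by
    rw [← (hμ V hV hVU G hG).2 y hy v,
      mvfderiv_congr ((hV.eventually_mem hy).mono fun z hz => hG1 z hz), mvfderiv_const]
    rfl
  -- By torsion-freeness `[k, G i] = ∇_k G i - ∇_{G i} k`; the second term traces to the divergence,
  -- so the matrix of `L_k` is trace-free as well.
  have lbr : ∀ y ∈ V, ∑ i, l i y (VectorField.mlieBracket (𝓡 n) k (G i) y) = 0 := fun y hy => by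
    have h1 : ∀ i, VectorField.mlieBracket (𝓡 n) k (G i) y
        = cov (G i) y (k y) - cov k y (G i y) := fun i =>
      (ht k (G i) y (hVU hy) (hk.diffAt hV hy) ((hG i).diffAt hV hy)).symm
    simp only [h1, lsub, Finset.sum_sub_distrib, lcov y hy, zero_sub, neg_eq_zero]
    have h2 := sum_alternatingMap_update_apply (finrank_tangentSpace y) (μ y) _ (hG1 y hy)
      (cov k y).toLinearMap
    exact h2.trans (hdiv y (hVU hy))
  have hbs : ∀ i, VField.SmoothOn (VectorField.mlieBracket (𝓡 n) k (G i)) V := fun i =>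
    hk.mlieBracket hV (hG i)
  have hcs : ∀ i, VField.SmoothOn (fun y => cov (G i) y (Z y)) V := fun i =>
    h.smoothOn_apply hU hV hVU (hG i) hZ
  have hd : ∀ j (X : VField n M), X.SmoothOn V →
      MDifferentiableAt (𝓡 n) 𝓘(ℝ, ℝ) (fun y => l j y (X y)) x := fun j X hX =>
    SmoothFunOn.mdifferentiableAt (lsmooth j X hX) hV hx
  have hGd : ∀ i, (G i).DiffAt x := fun i => (hG i).diffAt hV hx
  have e1 : ∀ i, VectorField.mlieBracket (𝓡 n) k (fun y => cov (G i) y (Z y)) x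
      = ∑ j, (mvfderiv (𝓡 n) (fun y => l j y (cov (G i) y (Z y))) x (k x) • G j x
        + l j x (cov (G i) x (Z x)) • VectorField.mlieBracket (𝓡 n) k (G j) x) := fun i => by
    rw [mlieBracket_congr (X' := k) (Filter.Eventually.of_forall fun _ => rfl)
      ((hV.eventually_mem hx).mono fun y hy => lexp y hy (cov (G i) y (Z y))),
      mlieBracket_fun_sum_right _ fun j _ => VField.DiffAt.smul (hd j _ (hcs i)) (hGd j)]
    exact Finset.sum_congr rfl fun j _ => mlieBracket_fun_smul_right (hd j _ (hcs i)) (hGd j)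
  have e2 : ∀ i, cov (VectorField.mlieBracket (𝓡 n) k (G i)) x (Z x)
      = ∑ j, (l j x (VectorField.mlieBracket (𝓡 n) k (G i) x) • cov (G j) x (Z x)
        + mvfderiv (𝓡 n) (fun y => l j y (VectorField.mlieBracket (𝓡 n) k (G i) y)) x (Z x)
          • G j x) := fun i => by
    have hs : ∀ j ∈ Finset.univ, VField.DiffAt
      (fun y => l j y (VectorField.mlieBracket (𝓡 n) k (G i) y) • G j y) x := fun j _ =>
        VField.DiffAt.smul (hd j _ (hbs i)) (hGd j)
    rw [h.congr_near hU (hVU hx) (VField.DiffAt.sum hs) ((hV.eventually_mem hx).mono fun y hy =>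
      lexp y hy (VectorField.mlieBracket (𝓡 n) k (G i) y)), h.map_sum (hVU hx) _ hs]
    exact Finset.sum_congr rfl fun j _ => h.map_smul (hVU hx) (hd j _ (hbs i)) (hGd j) _
  have s1 : ∑ i, mvfderiv (𝓡 n) (fun y => l i y (cov (G i) y (Z y))) x (k x) = 0 := by
    rw [← mvfderiv_fun_finsetSum _ fun i _ => hd i _ (hcs i),
      mvfderiv_congr ((hV.eventually_mem hx).mono fun y hy => lcov y hy (Z y)), mvfderiv_const]
    rfl
  have s2 : ∑ i, mvfderiv (𝓡 n) (fun y => l i y (VectorField.mlieBracket (𝓡 n) k (G i) y)) x (Z x)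
      = 0 := by
    rw [← mvfderiv_fun_finsetSum _ fun i _ => hd i _ (hbs i),
      mvfderiv_congr ((hV.eventually_mem hx).mono fun y hy => lbr y hy), mvfderiv_const]
    rfl
  change ∑ i, l i x (lieDerivConn cov k Z (G i) x) = 0
  simp only [lieDerivConn, e1, e2, lsub, lsum, ladd, lsmul, lG _ x hx, Finset.sum_sub_distrib,
    Finset.sum_add_distrib, mul_ite, mul_one, mul_zero, Finset.sum_ite_eq',
    Finset.mem_univ, if_true, s1, s2, lcov x hx, zero_add, add_zero, sub_zero]
  -- What remains is the trace of a commutator, of the matrix of `∇_Z` with that of `L_k`.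
  rw [Finset.sum_comm, sub_eq_zero]
  exact Finset.sum_congr rfl fun i _ => Finset.sum_congr rfl fun j _ => mul_comm _ _

/-- A special connection is invariant under a divergence-free projective symmetry. -/
theorem IsProjSymmetry.lieDerivConn_eq_zero [T2Space M] {p : ProjStructure n M}
    (hks : IsProjSymmetry p k) (hU : IsOpen U) (hk : k.SmoothOn U) (hcov : cov ∈ p.restrict U)
    (hsp : IsSpecialOn cov U) (hdiv : ∀ x ∈ U, divergence cov k x = 0) (i₀ : Fin n)
    {W : Set M} (hW : IsOpen W) (hWU : W ⊆ U) {X Y : VField n M} (hX : X.SmoothOn W)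
    (hY : Y.SmoothOn W) {x : M} (hx : x ∈ W) : lieDerivConn cov k X Y x = 0 := by
  obtain ⟨c, V, hV, hxV, hVU, heq⟩ := p.exists_eq_near hU hcov (hWU hx)
  obtain ⟨θ, hθ⟩ := hks c.1 c.2 x
  -- The symmetry condition concerns global connections of the class; by locality it passes to
  -- `cov`, which agrees with one of them near `x`.
  have hcongr : ∀ W : Set M, IsOpen W → x ∈ W → W ⊆ U → ∀ X Y : VField n M, X.SmoothOn W →
      Y.SmoothOn W → lieDerivConn cov k X Y x = θ (X x) • Y x + θ (Y x) • X x := by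
    intro W hW hx hWU X Y hX hY
    rw [← hθ W hW hx X Y hX hY, lieDerivConn, lieDerivConn, heq x hxV _ (hY.diffAt hW hx),
      heq x hxV _ (((hk.mono hWU).mlieBracket hW hY).diffAt hW hx)]
    congr 2
    exact mlieBracket_congr (Filter.Eventually.of_forall fun _ => rfl)
      (((hV.inter hW).eventually_mem ⟨hxV, hx⟩).mono fun y hy => by
        rw [heq y hy.1 _ (hY.diffAt hW hy.2)])
  obtain ⟨μ, hμ0, hμ⟩ := hsp
  obtain ⟨V', hV', hxV', hVU', G, hG, hG1⟩ :=
    IsParallelVolumeOn.exists_frame (cov := cov) hμ hU hμ0 i₀ (hWU hx)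
  obtain ⟨V₀, hV₀, hxV₀, hext⟩ := exists_localExt_smoothOn (n := n) x
  -- The trace of `Y ↦ θ(z) Y + θ(Y) z` is `(n + 1) θ(z)`, and the trace of the Lie derivative
  -- vanishes.
  have hθ0 : ∀ z, θ z = 0 := by
    intro z
    have hV1 := hV'.inter hV₀
    have hsub : V' ∩ V₀ ⊆ U := fun y hy => hVU' hy.1
    have hG' : ∀ i, (G i).SmoothOn (V' ∩ V₀) := fun i => (hG i).mono Set.inter_subset_left
    have hz := (hext z).mono (W := V' ∩ V₀) Set.inter_subset_right
    have h1 := IsParallelVolumeOn.trace_lieDerivConn (cov := cov) hμ hU hcov.1 hcov.2.1 hdiv hV1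
      hsub (hk.mono hsub) hG' (fun y hy => hG1 y hy.1) hz ⟨hxV', hxV₀⟩
    have h2 : ∀ i, lieDerivConn cov k (localExt z) (G i) x = θ z • G i x + θ (G i x) • z :=
      fun i => by
        rw [hcongr _ hV1 ⟨hxV', hxV₀⟩ hsub _ _ hz (hG' i), localExt_self]
    have h3 := sum_alternatingMap_update_apply (finrank_tangentSpace x) (μ x) _ (hG1 x hxV')
      (θ.smulRight z).toLinearMap
    have h4 : LinearMap.trace ℝ (TangentSpace (𝓡 n) x) (θ.smulRight z).toLinearMap = θ z :=
      LinearMap.trace_smulRight _ _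
    simp only [h2, AlternatingMap.map_update_add, AlternatingMap.map_update_smul,
      Function.update_eq_self, hG1 x hxV', Finset.sum_add_distrib, smul_eq_mul, mul_one,
      Finset.sum_const, Finset.card_univ, Fintype.card_fin, nsmul_eq_mul] at h1
    rw [h4] at h3
    simp only [ContinuousLinearMap.coe_coe, ContinuousLinearMap.smulRight_apply,
      AlternatingMap.map_update_smul, smul_eq_mul] at h3
    rw [h3] at h1
    have h5 : ((n : ℝ) + 1) * θ z = 0 := by linarith
    exact (mul_eq_zero.1 h5).resolve_left (by positivity)
  rw [hcongr W hW hx hWU X Y hX hY, hθ0, hθ0, zero_smul, zero_smul, add_zero]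

end SymmetryOfScales

/-! ### Special connections -/

section SpecialConnections

variable {n r : ℕ} {M : Type*} [TopologicalSpace M] [ChartedSpace (EuclideanSpace ℝ (Fin n)) M]
  [IsManifold (𝓡 n) ∞ M]
  {N : Type*} [TopologicalSpace N] [ChartedSpace (EuclideanSpace ℝ (Fin r)) N]
  [IsManifold (𝓡 r) ∞ N]

theorem mvfderiv_fun_finsetProd {ι : Type*} [DecidableEq ι] (s : Finset ι) {f : ι → M → ℝ} {x : M}
    (hf : ∀ i ∈ s, MDifferentiableAt (𝓡 n) 𝓘(ℝ, ℝ) (f i) x) (v : TangentSpace (𝓡 n) x) :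
    MDifferentiableAt (𝓡 n) 𝓘(ℝ, ℝ) (fun y => ∏ i ∈ s, f i y) x ∧
    mvfderiv (𝓡 n) (fun y => ∏ i ∈ s, f i y) x v
      = ∑ i ∈ s, (∏ j ∈ s.erase i, f j x) * mvfderiv (𝓡 n) (f i) x v := by
  induction s using Finset.induction_on with
  | empty => exact ⟨by simpa using mdifferentiableAt_const, by simp [mvfderiv_const]⟩
  | insert a s ha ih =>
    obtain ⟨h1, h2⟩ := ih fun i hi => hf i (Finset.mem_insert_of_mem hi)
    have h3 := hf a (Finset.mem_insert_self a s)
    simp only [Finset.prod_insert ha, Finset.sum_insert ha, Finset.erase_insert ha]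
    refine ⟨h3.mul h1, ?_⟩
    have h4 : mvfderiv (𝓡 n) (fun y => f a y * ∏ i ∈ s, f i y) x v
        = f a x * mvfderiv (𝓡 n) (fun y => ∏ i ∈ s, f i y) x v
          + (∏ i ∈ s, f i x) * mvfderiv (𝓡 n) (f a) x v := by
      have h5 := mvfderiv_smul h3 h1
      have h6 := congrArg (fun L : TangentSpace (𝓡 n) x →L[ℝ] ℝ => L v) h5
      refine h6.trans ?_
      simp [mul_comm]
    rw [h4, h2, add_comm, Finset.mul_sum]
    congr 1
    refine Finset.sum_congr rfl fun i hi => ?_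
    have hai : a ≠ i := fun h => ha (h ▸ hi)
    rw [Finset.erase_insert_of_ne hai, Finset.prod_insert (fun h => ha (Finset.mem_of_mem_erase h)),
      mul_assoc]

/-- The derivative of a determinant. -/
theorem mvfderiv_det {ι : Type*} [Fintype ι] [DecidableEq ι] {A : M → Matrix ι ι ℝ} {x : M}
    (hA : ∀ i j, MDifferentiableAt (𝓡 n) 𝓘(ℝ, ℝ) (fun y => A y i j) x)
    (v : TangentSpace (𝓡 n) x) :
    mvfderiv (𝓡 n) (fun y => (A y).det) x v
      = ∑ i, ((A x).updateRow i fun j => mvfderiv (𝓡 n) (fun y => A y i j) x v).det := by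
  have h1 : ∀ B : Matrix ι ι ℝ, B.det = ∑ σ : Equiv.Perm ι, ((Equiv.Perm.sign σ : ℤ) : ℝ) *
      ∏ i, B i (σ i) := fun B => by
    rw [← Matrix.det_transpose, Matrix.det_apply']
    rfl
  have hp : ∀ σ : Equiv.Perm ι, _ := fun σ =>
    mvfderiv_fun_finsetProd Finset.univ (f := fun i y => A y i (σ i)) (fun i _ => hA i (σ i)) v
  have hc : ∀ σ : Equiv.Perm ι, MDifferentiableAt (𝓡 n) 𝓘(ℝ, ℝ)
      (fun y => ((Equiv.Perm.sign σ : ℤ) : ℝ) * ∏ i, A y i (σ i)) x := fun σ =>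
    mdifferentiableAt_const.mul (hp σ).1
  have hcv : ∀ σ : Equiv.Perm ι, mvfderiv (𝓡 n)
      (fun y => ((Equiv.Perm.sign σ : ℤ) : ℝ) * ∏ i, A y i (σ i)) x v
        = ((Equiv.Perm.sign σ : ℤ) : ℝ) * ∑ i, (∏ j ∈ Finset.univ.erase i, A x j (σ j)) *
          mvfderiv (𝓡 n) (fun y => A y i (σ i)) x v := fun σ => by
    rw [← (hp σ).2]
    have h5 := mvfderiv_smul (a := fun _ : M => ((Equiv.Perm.sign σ : ℤ) : ℝ))
      (mdifferentiableAt_const (x := x)) (hp σ).1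
    have h6 := congrArg (fun L : TangentSpace (𝓡 n) x →L[ℝ] ℝ => L v) h5
    refine h6.trans ?_
    simp [mvfderiv_const]
  simp only [h1]
  rw [mvfderiv_fun_finsetSum _ (fun σ _ => hc σ)]
  simp only [hcv]
  rw [Finset.sum_comm]
  refine Finset.sum_congr rfl fun σ _ => ?_
  rw [Finset.mul_sum]
  refine Finset.sum_congr rfl fun i _ => ?_
  congr 1
  rw [← Finset.prod_erase_mul _ _ (Finset.mem_univ i), Matrix.updateRow_self]
  congr 1
  refine Finset.prod_congr rfl fun j hj => ?_
  rw [Matrix.updateRow_ne (Finset.ne_of_mem_erase hj)]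

/-- By Cramer's rule the `i`-th summand is the diagonal entry `(B A adj B) i i`; cyclicity of the
trace brings `adj B` next to `B`. -/
theorem sum_det_updateRow_mul {ι : Type*} [Fintype ι] [DecidableEq ι] (B A : Matrix ι ι ℝ) :
    ∑ i, (B.updateRow i ((B * A) i)).det = A.trace * B.det := by
  have h1 : ∀ i, (B.updateRow i ((B * A) i)).det = (B * A * B.adjugate) i i := fun i => by
    rw [← Matrix.cramer_transpose_apply, Matrix.cramer_eq_adjugate_mulVec,
      ← Matrix.adjugate_transpose, Matrix.mul_apply]
    exact Finset.sum_congr rfl fun j _ => mul_comm _ _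
  simp only [h1]
  change (B * A * B.adjugate).trace = _
  rw [Matrix.trace_mul_comm, ← Matrix.mul_assoc, Matrix.adjugate_mul, Matrix.smul_mul,
    Matrix.one_mul, Matrix.trace_smul, smul_eq_mul, mul_comm]

theorem trace_eq_sum_of_dual_frame {E : Type*} [AddCommGroup E] [Module ℝ E]
    [FiniteDimensional ℝ E] {ι : Type*} [Fintype ι] (η : ι → E →ₗ[ℝ] ℝ) (g : ι → E)
    (hg : ∀ v, v = ∑ i, η i v • g i) (A : Module.End ℝ E) :
    LinearMap.trace ℝ E A = ∑ i, η i (A (g i)) := by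
  have h1 : A = ∑ i, (η i).smulRight (A (g i)) := by
    ext v
    conv_lhs => rw [hg v]
    simp
  conv_lhs => rw [h1]
  rw [map_sum]
  exact Finset.sum_congr rfl fun i _ => LinearMap.trace_smulRight _ _

variable {V : Set M} {cov : ConnOp n M}

theorem IsSpecialOn.mono {V' : Set M} (h : IsSpecialOn cov V) (hV : V' ⊆ V) :
    IsSpecialOn cov V' := by
  obtain ⟨μ, h0, h1⟩ := h
  exact ⟨μ, fun x hx => h0 x (hV hx), fun W hW hWU => h1 W hW (hWU.trans hV)⟩

theorem IsAdaptedScaleOn.mono [T2Space M] {p : ProjStructure n M} {k : VField n M} {V' : Set M}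
    (h : IsAdaptedScaleOn p k V cov) (hVo : IsOpen V) (hVo' : IsOpen V') (hV : V' ⊆ V) :
    IsAdaptedScaleOn p k V' cov := by
  obtain ⟨⟨h1, h2, c, hc, Υ, hΥ, hch⟩, h3, h4⟩ := h
  exact ⟨⟨h1.mono hVo hVo' hV, fun X Y x hx => h2 X Y x (hV hx), c, hc, Υ, hΥ.mono hV,
    fun σ x hx => hch σ x (hV hx)⟩, h3.mono hV, fun x hx => h4 x (hV hx)⟩

/-- A projective change to a connection which preserves the volume form of a given frame. -/
theorem exists_special_change [T2Space M] (hV : IsOpen V) (h : IsAffineConnOn cov V)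
    (η : Fin n → OneForm n M) (hη : ∀ i, (η i).SmoothOn V) (H : Fin n → VField n M)
    (hH : ∀ i, (H i).SmoothOn V) (hηH : ∀ x ∈ V, ∀ i j, η i x (H j x) = if i = j then 1 else 0)
    (hHη : ∀ x ∈ V, ∀ v : TangentSpace (𝓡 n) x, v = ∑ i, η i x v • H i x) :
    ∃ Υ : OneForm n M, Υ.SmoothOn V ∧ IsSpecialOn (projChange cov Υ) V ∧
      ∀ x ∈ V, ∀ v, ∑ i, η i x (projChange cov Υ (H i) x v) = 0 := by
  let T : OneForm n M := fun x => ∑ i, (η i x).comp (cov (H i) x)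
  -- A projective change by `Υ` adds `(n + 1) Υ` to the trace `T` of the connection form, so this
  -- choice cancels it.
  let Υ : OneForm n M := fun x => (-((n : ℝ) + 1)⁻¹) • T x
  have hTapp : ∀ x v, T x v = ∑ i, η i x (cov (H i) x v) := fun x v => by simp [T, sum_apply]
  have hΥ : Υ.SmoothOn V := by
    intro W hW hWU X hX
    have h1 : SmoothFunOn n (fun x => T x (X x)) W := by
      simp only [hTapp]
      exact contMDiffOn_finsetSum fun i _ =>
        hη i W hW hWU _ (h.smoothOn_apply hV hW hWU ((hH i).mono hWU) hX)
    exact ContMDiffOn.mul contMDiffOn_const h1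
  have hzero : ∀ x ∈ V, ∀ v, ∑ i, η i x (projChange cov Υ (H i) x v) = 0 := by
    intro x hx v
    have h1 : ∑ i, η i x v * Υ x (H i x) = Υ x v := by
      conv_rhs => rw [hHη x hx v, map_sum]
      simp
    have h2 : Υ x v = -((n : ℝ) + 1)⁻¹ * T x v := rfl
    simp only [projChange_apply, map_add, map_smul, smul_eq_mul, Finset.sum_add_distrib, ← hTapp,
      hηH x hx, if_true, mul_one, Finset.sum_const, Finset.card_univ, Fintype.card_fin,
      nsmul_eq_mul]
    simp only [mul_comm (Υ x _) (η _ x v), h1]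
    have h3 : (n : ℝ) + 1 ≠ 0 := by positivity
    rw [h2]
    field_simp
    ring
  have haff := IsAffineConnOn.projChange hV h hΥ
  set cov' := projChange cov Υ with hcov'
  let μ : Π x : M, (TangentSpace (𝓡 n) x) [⋀^Fin n]→ₗ[ℝ] ℝ := fun x =>
    (Matrix.detRowAlternating (R := ℝ) (n := Fin n)).compLinearMap
      (LinearMap.pi fun i => (η i x).toLinearMap)
  have hμ : ∀ x (X : Fin n → TangentSpace (𝓡 n) x),
      μ x X = (Matrix.of fun i j => η j x (X i)).det := fun x X => rfl
  refine ⟨Υ, hΥ, ⟨μ, fun x hx h0 => ?_, fun W hW hWU X hX => ⟨?_, fun x hx v => ?_⟩⟩, hzero⟩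
  · have h1 : μ x (fun i => H i x) = 1 := by
      rw [hμ, show (Matrix.of fun i j => η j x (H i x)) = (1 : Matrix (Fin n) (Fin n) ℝ) by
        ext i j
        simp [hηH x hx, Matrix.one_apply, eq_comm], Matrix.det_one]
    rw [h0] at h1
    exact zero_ne_one h1
  · have h1 : ∀ i j, SmoothFunOn n (fun x => η j x (X i x)) W := fun i j =>
      hη j W hW hWU (X i) (hX i)
    simp only [hμ, Matrix.det_apply']
    exact contMDiffOn_finsetSum fun σ _ => ContMDiffOn.mul contMDiffOn_const
      (contMDiffOn_finsetProd fun i _ => h1 _ _)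
  · have hd : ∀ i j, MDifferentiableAt (𝓡 n) 𝓘(ℝ, ℝ) (fun y => η j y (X i y)) x := fun i j =>
      SmoothFunOn.mdifferentiableAt (hη j W hW hWU (X i) (hX i)) hW hx
    have hHd : ∀ j, (H j).DiffAt x := fun j => (hH j).diffAt hV (hWU hx)
    simp only [hμ]
    rw [mvfderiv_det (A := fun y => Matrix.of fun i j => η j y (X i y)) hd]
    set B : Matrix (Fin n) (Fin n) ℝ := Matrix.of fun i j => η j x (X i x) with hB
    set A : Matrix (Fin n) (Fin n) ℝ := Matrix.of fun i j => η j x (cov' (H i) x v) with hA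
    have hA0 : A.trace = 0 := hzero x (hWU hx) v
    have hcovX : ∀ i, cov' (X i) x v = ∑ j, (η j x (X i x) • cov' (H j) x v
        + mvfderiv (𝓡 n) (fun y => η j y (X i y)) x v • H j x) := fun i => by
      have hs : ∀ j ∈ Finset.univ, VField.DiffAt (fun y => η j y (X i y) • H j y) x := fun j _ =>
        VField.DiffAt.smul (hd i j) (hHd j)
      rw [haff.congr_near hV (hWU hx) (VField.DiffAt.sum hs)
        ((hW.eventually_mem hx).mono fun y hy => hHη y (hWU hy) (X i y)),
        haff.map_sum (hWU hx) _ hs]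
      exact Finset.sum_congr rfl fun j _ => haff.map_smul (hWU hx) (hd i j) (hHd j) v
    -- In the coframe, `∇'_v X i` is the derivative of the components of `X i` plus row `i` of `B *
    -- A`. The latter part contributes `tr A · det B = 0`, and the former is the derivative of the
    -- determinant.
    have hrow : ∀ i, (Matrix.of fun i' j => η j x (Function.update (fun j => X j x) i
        (cov' (X i) x v) i')) = B.updateRow i
          ((fun j => mvfderiv (𝓡 n) (fun y => η j y (X i y)) x v) + (B * A) i) := fun i => by
      ext i' j
      by_cases hi : i' = i
      · subst hi
        rw [Matrix.updateRow_self, Matrix.of_apply, Function.update_self, hcovX]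
        simp only [map_sum, map_add, map_smul, smul_eq_mul, hηH x (hWU hx), mul_ite, mul_one,
          mul_zero, Finset.sum_add_distrib, Finset.sum_ite_eq, Finset.mem_univ, if_true,
          Pi.add_apply, Matrix.mul_apply, hB, hA, Matrix.of_apply]
        exact add_comm _ _
      · rw [Matrix.updateRow_ne hi, Matrix.of_apply, Function.update_of_ne hi]
        rfl
    have hfin : ∑ i, (B.updateRow i
          ((fun j => mvfderiv (𝓡 n) (fun y => η j y (X i y)) x v) + (B * A) i)).det
        = ∑ i, (B.updateRow i fun j => mvfderiv (𝓡 n) (fun y => η j y (X i y)) x v).det := by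
      simp only [Matrix.det_updateRow_add, Finset.sum_add_distrib, sum_det_updateRow_mul, hA0,
        zero_mul, add_zero]
    exact hfin.symm.trans (Finset.sum_congr rfl fun i _ => congrArg Matrix.det (hrow i).symm)

end SpecialConnections

/-! ### Adapted scales -/

section AdaptedScales

variable {n r : ℕ} {M : Type*} [TopologicalSpace M] [ChartedSpace (EuclideanSpace ℝ (Fin n)) M]
  [IsManifold (𝓡 n) ∞ M]
  {N : Type*} [TopologicalSpace N] [ChartedSpace (EuclideanSpace ℝ (Fin r)) N]
  [IsManifold (𝓡 r) ∞ N]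

theorem mvfderiv_clm_comp {F G : Type*} [NormedAddCommGroup F] [NormedSpace ℝ F]
    [NormedAddCommGroup G] [NormedSpace ℝ G] (P : F →L[ℝ] G) {f : M → F} {x : M}
    (hf : MDifferentiableAt (𝓡 n) 𝓘(ℝ, F) f x) (v : TangentSpace (𝓡 n) x) :
    mvfderiv (𝓡 n) (fun y => P (f y)) x v = P (mvfderiv (𝓡 n) f x v) :=
  congrArg (fun L : EuclideanSpace ℝ (Fin n) →L[ℝ] G => L v)
    ((P.hasFDerivAt (x := f x)).hasMFDerivAt.comp x hf.hasMFDerivAt).mfderiv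

/-- Divide the differential of a coordinate function that grows along `k` by its derivative along
`k`. Such an auxiliary form completes a frame before any adapted scale, and hence `P(·, k)`, is
available. -/
theorem exists_local_dual_form {k : VField n M} {U : Set M} (hU : IsOpen U) (hk : k.SmoothOn U)
    {x₀ : M} (hx₀ : x₀ ∈ U) (hk0 : k x₀ ≠ 0) : ∃ U' : Set M, IsOpen U' ∧ x₀ ∈ U' ∧ U' ⊆ U ∧
      ∃ τ : OneForm n M, τ.SmoothOn U' ∧ ∀ x ∈ U', τ x (k x) = 1 := by
  have hne : mvfderiv (𝓡 n) (extChartAt (𝓡 n) x₀) x₀ (k x₀) ≠ 0 := fun h0 =>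
    hk0 (mfderiv_extChartAt_injective x₀ (mem_extChartAt_source x₀) h0)
  obtain ⟨P, hP⟩ := SeparatingDual.exists_eq_one (R := ℝ) hne
  let g : M → ℝ := fun x => P (extChartAt (𝓡 n) x₀ x)
  set S := U ∩ (chartAt (EuclideanSpace ℝ (Fin n)) x₀).source with hSdef
  have hS : IsOpen S := hU.inter (chartAt (EuclideanSpace ℝ (Fin n)) x₀).open_source
  have hg : SmoothFunOn n g S := (P.contMDiff (n := ∞)).comp_contMDiffOn
    ((contMDiffOn_extChartAt (I := 𝓡 n) (n := ∞) (x := x₀)).mono Set.inter_subset_right)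
  let f : M → ℝ := fun x => mvfderiv (𝓡 n) g x (k x)
  have hf : SmoothFunOn n f S := contMDiffOn_mvfderiv_apply hS hg (hk.mono Set.inter_subset_left)
  have hxS : x₀ ∈ S := ⟨hx₀, mem_chart_source _ x₀⟩
  have hf0 : f x₀ = 1 := by
    have h2 : MDifferentiableAt (𝓡 n) 𝓘(ℝ, EuclideanSpace ℝ (Fin n)) (extChartAt (𝓡 n) x₀) x₀ :=
      mdifferentiableAt_extChartAt (mem_chart_source _ x₀)
    exact (mvfderiv_clm_comp P h2 (k x₀)).trans hP
  have hV : IsOpen (S ∩ f ⁻¹' {0}ᶜ) :=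
    hf.continuousOn.isOpen_inter_preimage hS isOpen_compl_singleton
  refine ⟨_, hV, ⟨hxS, by simp [hf0]⟩, fun x hx => hx.1.1,
    fun x => (f x)⁻¹ • mvfderiv (𝓡 n) g x, fun W hW hWU X hX => ?_, fun x hx =>
      inv_mul_cancel₀ hx.2⟩
  exact ContMDiffOn.mul (ContMDiffOn.inv₀ (hf.mono fun x hx => (hWU hx).1) fun x hx => (hWU hx).2)
    (contMDiffOn_mvfderiv_apply hW (hg.mono fun x hx => (hWU hx).1) hX)

/-- The frame `H` consists of `k` and lifts of coordinate fields. The brackets `[k, H i]` have no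
component along `H i`, so the special connection that preserves the volume of `H` has `div k` equal
to the trace of its connection form on `k`, which is zero. -/
theorem IsLocalLeafSpace.exists_adaptedScale {M : Type*} [TopologicalSpace M] [T2Space M]
    [ChartedSpace (EuclideanSpace ℝ (Fin (r + 1))) M] [IsManifold (𝓡 (r + 1)) ∞ M]
    (p : ProjStructure (r + 1) M) {k : VField (r + 1) M} {U : Set M} {prj : M → N}
    (h : IsLocalLeafSpace r k U prj) (hk : k.SmoothOn U) {x₀ : M} (hx₀ : x₀ ∈ U) :
    ∃ V : Set M, IsOpen V ∧ x₀ ∈ V ∧ V ⊆ U ∧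
      ∀ V' : Set M, IsOpen V' → V' ⊆ V → ∃ cov, IsAdaptedScaleOn p k V' cov := by
  obtain ⟨U', hU', hxU', hUU', τ, hτ, hτk⟩ :=
    exists_local_dual_form h.isOpen hk hx₀ (h.k_ne_zero rfl hx₀)
  obtain ⟨V, hV, hxV, hVU, G, hG, hGτ, hGF, hexp⟩ :=
    h.exists_adapted_frame hU' hUU' (hk.mono hUU') hτ hτk hxU'
  set F : M → EuclideanSpace ℝ (Fin r) := fun x => extChartAt (𝓡 r) (prj x₀) (prj x) with hF
  have hFs : ContMDiffOn (𝓡 (r + 1)) 𝓘(ℝ, EuclideanSpace ℝ (Fin r)) ∞ F V :=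
    (h.chart_smoothOn (prj x₀)).mono fun x hx => ⟨hUU' (hVU hx).1, (hVU hx).2⟩
  have hFk : ∀ x ∈ V, mvfderiv (𝓡 (r + 1)) F x (k x) = 0 := fun x hx =>
    h.mvfderiv_chart_k (hUU' (hVU hx).1) (hVU hx).2
  have hVU' : V ⊆ U := fun x hx => hUU' (hVU hx).1
  have hkV : k.SmoothOn V := hk.mono hVU'
  let ηF : Fin r → OneForm (r + 1) M := fun i x =>
    (EuclideanSpace.proj (𝕜 := ℝ) i).comp (mvfderiv (𝓡 (r + 1)) F x)
  let η : Fin (r + 1) → OneForm (r + 1) M := fun i => Fin.lastCases τ ηF i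
  let H : Fin (r + 1) → VField (r + 1) M := fun i => Fin.lastCases k G i
  have hηl : η (Fin.last r) = τ := Fin.lastCases_last
  have hηc : ∀ i : Fin r, η i.castSucc = ηF i := fun i => Fin.lastCases_castSucc _
  have hHl : H (Fin.last r) = k := Fin.lastCases_last
  have hHc : ∀ i : Fin r, H i.castSucc = G i := fun i => Fin.lastCases_castSucc _
  have hηFapp : ∀ i x v, ηF i x v = (mvfderiv (𝓡 (r + 1)) F x v) i := fun i x v => rfl
  have hηs : ∀ i, (η i).SmoothOn V := fun i => by
    refine Fin.lastCases ?_ (fun i => ?_) i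
    · rw [hηl]
      exact hτ.mono fun x hx => (hVU hx).1
    · rw [hηc]
      intro W hW hWU X hX
      exact ((EuclideanSpace.proj (𝕜 := ℝ) i).contMDiff (n := ∞)).comp_contMDiffOn
        (contMDiffOn_mvfderiv_apply hW (hFs.mono hWU) hX)
  have hHs : ∀ i, (H i).SmoothOn V := fun i => by
    refine Fin.lastCases ?_ (fun i => ?_) i
    · rw [hHl]; exact hkV
    · rw [hHc]; exact hG i
  have hdual : ∀ x ∈ V, ∀ i j, η i x (H j x) = if i = j then 1 else 0 := by
    intro x hx i j
    refine Fin.lastCases ?_ (fun i => ?_) i <;> refine Fin.lastCases ?_ (fun j => ?_) j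
    · rw [hηl, hHl, hτk x (hVU hx).1, if_pos rfl]
    · rw [hηl, hHc, hGτ x hx, if_neg (Fin.castSucc_lt_last j).ne']
    · rw [hηc, hHl, hηFapp, hFk x hx, if_neg (Fin.castSucc_lt_last i).ne]
      rfl
    · rw [hηc, hHc, hηFapp, hGF x hx]
      simp [Fin.castSucc_inj]
  have hexp' : ∀ x ∈ V, ∀ v : TangentSpace (𝓡 (r + 1)) x, v = ∑ i, η i x v • H i x := by
    intro x hx v
    rw [Fin.sum_univ_castSucc]
    simp only [hηl, hHl, hηc, hHc]
    exact hexp x hx v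
  obtain ⟨c⟩ := p.nonempty
  have haff := (p.affine c).1.mono isOpen_univ hV (Set.subset_univ V)
  obtain ⟨Υ, hΥ, hsp, hzero⟩ := exists_special_change hV haff η hηs H hHs hdual hexp'
  have haff' := haff.projChange hV hΥ
  have htf : IsTorsionFreeOn (projChange c.1 Υ) V :=
    IsTorsionFreeOn.projChange fun X Y x _ => (p.affine c).2 X Y x (Set.mem_univ x)
  -- The derivative of a leaf-space coordinate along `k` is `0` and along each lift is constant, so
  -- its derivative along their bracket vanishes.
  have hbr : ∀ x ∈ V, ∀ i, η i x (VectorField.mlieBracket (𝓡 (r + 1)) k (H i) x) = 0 := by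
    intro x hx i
    refine Fin.lastCases ?_ (fun i => ?_) i
    · rw [hHl, mlieBracket_self_apply, map_zero]
    · rw [hHc, hηc]
      let f : M → ℝ := fun y => F y i
      have hf : SmoothFunOn (r + 1) f V :=
        ((EuclideanSpace.proj (𝕜 := ℝ) i).contMDiff (n := ∞)).comp_contMDiffOn hFs
      have hfF : ∀ y ∈ V, ∀ v, mvfderiv (𝓡 (r + 1)) f y v = (mvfderiv (𝓡 (r + 1)) F y v) i := by
        exact fun y hy v => mvfderiv_clm_comp (EuclideanSpace.proj (𝕜 := ℝ) i)
          (SmoothFunOn.mdifferentiableAt hFs hV hy) v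
      rw [hηFapp, ← hfF x hx, mvfderiv_mlieBracket hV hf hx hkV (hG i),
        mvfderiv_congr (g := fun _ => (1 : ℝ)) ((hV.eventually_mem hx).mono fun y hy => by
          beta_reduce; rw [hfF y hy, hGF y hy]; simp),
        mvfderiv_congr (f := fun y => mvfderiv (𝓡 (r + 1)) f y (k y)) (g := fun _ => (0 : ℝ))
          ((hV.eventually_mem hx).mono fun y hy => by
            beta_reduce; rw [hfF y hy, hFk y hy]; rfl),
        mvfderiv_const, mvfderiv_const]
      simp
  have hscale : IsAdaptedScaleOn p k V (projChange c.1 Υ) := by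
    refine ⟨⟨haff', htf, c.1, c.2, Υ, hΥ, isProjChangeOn_projChange _ _ _⟩, hsp, fun x hx => ?_⟩
    rw [divergence, trace_eq_sum_of_dual_frame (fun i => (η i x).toLinearMap) (fun i => H i x)
      (hexp' x hx)]
    have h1 : ∀ i, η i x (projChange c.1 Υ k x (H i x))
        = η i x (projChange c.1 Υ (H i) x (k x)) := fun i => by
      have h2 := congrArg (η i x)
        (htf k (H i) x hx (hkV.diffAt hV hx) ((hHs i).diffAt hV hx))
      rw [hbr x hx, map_sub, sub_eq_zero] at h2
      exact h2.symm
    exact (Finset.sum_congr rfl fun i _ => h1 i).trans (hzero x hx (k x))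
  exact ⟨V, hV, hxV, hVU', fun V' hV' hVV' => ⟨_, hscale.mono hV hV' hVV'⟩⟩

end AdaptedScales

/-! ### Descent -/

section Descent

variable {n r : ℕ} {M : Type*} [TopologicalSpace M] [ChartedSpace (EuclideanSpace ℝ (Fin n)) M]
  [IsManifold (𝓡 n) ∞ M]
  {N : Type*} [TopologicalSpace N] [ChartedSpace (EuclideanSpace ℝ (Fin r)) N]
  [IsManifold (𝓡 r) ∞ N]

/-- The coordinate frame does this. It reduces identities for fields differentiable at one point to
the smooth fields `G i`. -/
theorem exists_frame_expansion (x₀ : M) : ∃ V : Set M, IsOpen V ∧ x₀ ∈ V ∧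
    ∃ G : Fin n → VField n M, (∀ i, (G i).SmoothOn V) ∧ ∀ X : VField n M, X.DiffAt x₀ →
      ∃ c : Fin n → M → ℝ, (∀ i, MDifferentiableAt (𝓡 n) 𝓘(ℝ, ℝ) (c i) x₀) ∧
        ∀ᶠ y in 𝓝 x₀, X y = ∑ i, c i y • G i y := by
  have hS := (chartAt (EuclideanSpace ℝ (Fin n)) x₀).open_source
  have hF := contMDiffOn_extChartAt (I := 𝓡 n) (n := ∞) (x := x₀)
  obtain ⟨V, hV, hxV, hVS, G, hG, hGe⟩ := exists_smooth_dual_frame hS hF (mem_chart_source _ x₀)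
    fun w => (isInvertible_mfderiv_extChartAt (I := 𝓡 n) (mem_extChartAt_source x₀)).surjective w
  refine ⟨V, hV, hxV, G, hG, fun X hX =>
    ⟨fun i x => (mvfderiv (𝓡 n) (extChartAt (𝓡 n) x₀) x (X x)) i, fun i => ?_,
      (hV.eventually_mem hxV).mono fun x hx => ?_⟩⟩
  · exact ((EuclideanSpace.proj (𝕜 := ℝ) i).contMDiff (n := ∞)).mdifferentiableAt (by simp)
      |>.comp x₀ (mdifferentiableAt_mvfderiv_apply hS hF (hVS hxV) hX)
  · rw [← sub_eq_zero]
    refine mfderiv_extChartAt_injective x₀ (by rw [extChartAt_source]; exact hVS hx) ?_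
    rw [map_sub, map_sum]
    simp only [map_smul, hGe x hx]
    ext j
    simp [Pi.single_apply]

theorem IsAffineConnOn.eq_sum {cov : ConnOp n M} {U : Set M} (h : IsAffineConnOn cov U)
    (hU : IsOpen U) {x : M} (hx : x ∈ U) {X : VField n M} {G : Fin n → VField n M}
    (hG : ∀ i, (G i).DiffAt x) {c : Fin n → M → ℝ}
    (hc : ∀ i, MDifferentiableAt (𝓡 n) 𝓘(ℝ, ℝ) (c i) x) (hX : ∀ᶠ y in 𝓝 x, X y = ∑ i, c i y • G i y)
    (v : TangentSpace (𝓡 n) x) :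
    cov X x v = ∑ i, (c i x • cov (G i) x v + mvfderiv (𝓡 n) (c i) x v • G i x) := by
  have hs : ∀ i ∈ Finset.univ, VField.DiffAt (fun y => c i y • G i y) x := fun i _ =>
    VField.DiffAt.smul (hc i) (hG i)
  rw [h.congr_near hU hx (VField.DiffAt.sum hs) hX, h.map_sum hx _ hs]
  exact Finset.sum_congr rfl fun i _ => h.map_smul hx (hc i) (hG i) v

/-- The torsion is linear over functions in each slot, since the derivative terms of connection and
bracket cancel, so it suffices to check a smooth frame. -/
theorem IsAffineConnOn.isTorsionFreeOn_of_smooth {cov : ConnOp n M} {U : Set M}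
    (h : IsAffineConnOn cov U) (hU : IsOpen U)
    (ht : ∀ W : Set M, IsOpen W → W ⊆ U → ∀ X Y : VField n M, X.SmoothOn W → Y.SmoothOn W →
      ∀ x ∈ W, cov Y x (X x) - cov X x (Y x) = VectorField.mlieBracket (𝓡 n) X Y x) :
    IsTorsionFreeOn cov U := by
  intro X Y x hx hX hY
  obtain ⟨V, hV, hxV, G, hG, hexp⟩ := exists_frame_expansion (n := n) x
  have hGd : ∀ i, (G i).DiffAt x := fun i => (hG i).diffAt hV hxV
  let T : VField n M → VField n M → TangentSpace (𝓡 n) x := fun X Y =>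
    cov Y x (X x) - cov X x (Y x) - VectorField.mlieBracket (𝓡 n) X Y x
  have hanti : ∀ X Y, T X Y = -T Y X := fun X Y => by
    simp only [T, VectorField.mlieBracket_swap_apply (V := X)]
    abel
  have hlin : ∀ X Y : VField n M, Y.DiffAt x → (∀ i, T X (G i) = 0) → T X Y = 0 := by
    intro X Y hY h0
    obtain ⟨c, hc, hYc⟩ := hexp Y hY
    have h1 : VectorField.mlieBracket (𝓡 n) X Y x = ∑ i, (mvfderiv (𝓡 n) (c i) x (X x) • G i x
        + c i x • VectorField.mlieBracket (𝓡 n) X (G i) x) := by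
      rw [mlieBracket_congr (X' := X) (Filter.Eventually.of_forall fun _ => rfl) hYc,
        mlieBracket_fun_sum_right _ fun i _ => VField.DiffAt.smul (hc i) (hGd i)]
      exact Finset.sum_congr rfl fun i _ => mlieBracket_fun_smul_right (hc i) (hGd i)
    have h2 : cov X x (Y x) = ∑ i, c i x • cov X x (G i x) := by
      rw [hYc.self_of_nhds, _root_.map_sum]
      exact Finset.sum_congr rfl fun i _ => _root_.map_smul _ _ _
    have h3 : T X Y = ∑ i, c i x • T X (G i) := by
      simp only [T, h1, h2, h.eq_sum hU hx hGd hc hYc, ← Finset.sum_sub_distrib]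
      refine Finset.sum_congr rfl fun i _ => ?_
      module
    rw [h3]
    simp [h0]
  rw [← sub_eq_zero]
  refine hlin X Y hY fun i => ?_
  rw [hanti, neg_eq_zero]
  refine hlin _ X hX fun j => ?_
  exact sub_eq_zero.2 (ht (V ∩ U) (hV.inter hU) Set.inter_subset_right _ _
    ((hG i).mono Set.inter_subset_left) ((hG j).mono Set.inter_subset_left) x ⟨hxV, hx⟩)

theorem IsAffineConnOn.isComplexConn_of_smooth {cov : ConnOp n M} {J : EndField n M}
    (h : IsAffineConnOn cov Set.univ) (hJ : J.Smooth)
    (hc : ∀ W : Set M, IsOpen W → ∀ Y : VField n M, Y.SmoothOn W → ∀ x ∈ W, ∀ v,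
      cov (fun y => J y (Y y)) x v = J x (cov Y x v)) : IsComplexConn J cov := by
  intro Y x hY v
  obtain ⟨V, hV, hxV, G, hG, hexp⟩ := exists_frame_expansion (n := n) x
  have hGd : ∀ i, (G i).DiffAt x := fun i => (hG i).diffAt hV hxV
  obtain ⟨c, hcd, hYc⟩ := hexp Y hY
  rw [h.eq_sum isOpen_univ (Set.mem_univ x) hGd hcd hYc,
    h.eq_sum isOpen_univ (Set.mem_univ x) (G := fun i y => J y (G i y))
      (fun i => (hJ V hV _ (hG i)).diffAt hV hxV) hcd (hYc.mono fun y hy => by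
        rw [hy, _root_.map_sum]
        exact Finset.sum_congr rfl fun i _ => _root_.map_smul _ _ _), _root_.map_sum]
  refine Finset.sum_congr rfl fun i _ => ?_
  rw [hc V hV _ (hG i) x hxV, _root_.map_add, _root_.map_smul, _root_.map_smul]

/-- A torsion-free complex connection forces the Nijenhuis tensor to vanish. -/
theorem IsTorsionFreeComplexConn.isIntegrable {J : EndField n M} {cov : ConnOp n M}
    (h : IsTorsionFreeComplexConn J cov) (hJ : J.Smooth) (hsq : ∀ x v, J x (J x v) = -v) :
    IsIntegrable J := by
  intro W hW X Y hX hY x hx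
  have hXd := hX.diffAt hW hx
  have hYd := hY.diffAt hW hx
  have hJXd := (hJ W hW X hX).diffAt hW hx
  have hJYd := (hJ W hW Y hY).diffAt hW hx
  have hu := Set.mem_univ x
  rw [← h.torsionFree _ _ x hu hJXd hJYd, ← h.torsionFree _ _ x hu hJXd hYd,
    ← h.torsionFree _ _ x hu hXd hJYd, ← h.torsionFree _ _ x hu hXd hYd]
  simp only [h.complex X x hXd, h.complex Y x hYd, map_sub, hsq]
  abel

namespace IsLocalLeafSpace

variable {k : VField n M} {U : Set M} {prj : M → N} (h : IsLocalLeafSpace r k U prj)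

include h

theorem mvfderiv_chart_comp {y₀ : N} {W : Set N}
    (hWy : W ⊆ (chartAt (EuclideanSpace ℝ (Fin r)) y₀).source) {X : VField n M} {Y : VField r N}
    (hXY : ∀ x ∈ U ∩ prj ⁻¹' W, mfderiv (𝓡 n) (𝓡 r) prj x (X x) = Y (prj x)) {x : M}
    (hx : x ∈ U ∩ prj ⁻¹' W) :
    mvfderiv (𝓡 n) (fun x => extChartAt (𝓡 r) y₀ (prj x)) x (X x)
      = mvfderiv (𝓡 r) (extChartAt (𝓡 r) y₀) (prj x) (Y (prj x)) := by
  rw [h.mvfderiv_chart hx.1 (hWy hx.2), hXY x hx]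

/-- The Lie bracket of projectable vector fields is projectable. -/
theorem mfderiv_mlieBracket {W : Set N} (hW : IsOpen W) {X X' : VField n M} {Y Y' : VField r N}
    (hX : X.SmoothOn (U ∩ prj ⁻¹' W)) (hX' : X'.SmoothOn (U ∩ prj ⁻¹' W)) (hY : Y.SmoothOn W)
    (hY' : Y'.SmoothOn W)
    (hXY : ∀ x ∈ U ∩ prj ⁻¹' W, mfderiv (𝓡 n) (𝓡 r) prj x (X x) = Y (prj x))
    (hXY' : ∀ x ∈ U ∩ prj ⁻¹' W, mfderiv (𝓡 n) (𝓡 r) prj x (X' x) = Y' (prj x)) {x : M}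
    (hx : x ∈ U ∩ prj ⁻¹' W) :
    mfderiv (𝓡 n) (𝓡 r) prj x (VectorField.mlieBracket (𝓡 n) X X' x)
      = VectorField.mlieBracket (𝓡 r) Y Y' (prj x) := by
  set φ := extChartAt (𝓡 r) (prj x) with hφ
  set W' := W ∩ (chartAt (EuclideanSpace ℝ (Fin r)) (prj x)).source with hW'
  have hW'o : IsOpen W' := hW.inter (chartAt (EuclideanSpace ℝ (Fin r)) (prj x)).open_source
  have hS := h.isOpen_preimage hW'o
  have hSS : U ∩ prj ⁻¹' W' ⊆ U ∩ prj ⁻¹' W := fun z hz => ⟨hz.1, hz.2.1⟩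
  have hxW' : prj x ∈ W' := ⟨hx.2, mem_chart_source _ _⟩
  have hxS : x ∈ U ∩ prj ⁻¹' W' := ⟨hx.1, hxW'⟩
  rw [← sub_eq_zero]
  refine mfderiv_extChartAt_injective (prj x) (mem_extChartAt_source _) ?_
  rw [map_sub, sub_eq_zero, ← h.mvfderiv_chart hx.1 hxW'.2]
  ext i
  let P : EuclideanSpace ℝ (Fin r) →L[ℝ] ℝ := EuclideanSpace.proj i
  change P _ = P _
  have hφs : ContMDiffOn (𝓡 r) 𝓘(ℝ, EuclideanSpace ℝ (Fin r)) ∞ φ W' :=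
    (contMDiffOn_extChartAt (I := 𝓡 r) (n := ∞)).mono Set.inter_subset_right
  have hf : SmoothFunOn r (fun y => P (φ y)) W' := (P.contMDiff (n := ∞)).comp_contMDiffOn hφs
  have hφπ : ContMDiffOn (𝓡 n) 𝓘(ℝ, EuclideanSpace ℝ (Fin r)) ∞ (fun x => φ (prj x))
      (U ∩ prj ⁻¹' W') := (h.chart_smoothOn (prj x)).mono fun z hz => ⟨hz.1, hz.2.2⟩
  have hg : SmoothFunOn n (fun x => P (φ (prj x))) (U ∩ prj ⁻¹' W') :=
    (P.contMDiff (n := ∞)).comp_contMDiffOn hφπ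
  rw [← mvfderiv_clm_comp P (SmoothFunOn.mdifferentiableAt hφπ hS hxS),
    ← mvfderiv_clm_comp P (SmoothFunOn.mdifferentiableAt hφs hW'o hxW'),
    mvfderiv_mlieBracket hS hg hxS (hX.mono hSS) (hX'.mono hSS),
    mvfderiv_mlieBracket hW'o hf hxW' (hY.mono Set.inter_subset_left)
      (hY'.mono Set.inter_subset_left)]
  -- Both brackets are tested on a coordinate function: iterated derivatives of a pulled-back
  -- function along projectable fields are the pullbacks of those on the leaf space.
  have key : ∀ (Z Z' : VField n M) (V V' : VField r N), V'.SmoothOn W' →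
      (∀ x ∈ U ∩ prj ⁻¹' W', mfderiv (𝓡 n) (𝓡 r) prj x (Z x) = V (prj x)) →
      (∀ x ∈ U ∩ prj ⁻¹' W', mfderiv (𝓡 n) (𝓡 r) prj x (Z' x) = V' (prj x)) →
      mvfderiv (𝓡 n) (fun z => mvfderiv (𝓡 n) (fun x => P (φ (prj x))) z (Z' z)) x (Z x)
        = mvfderiv (𝓡 r) (fun y => mvfderiv (𝓡 r) (fun y => P (φ y)) y (V' y)) (prj x)
            (V (prj x)) := by
    intro Z Z' V V' hV' hZV hZV'
    have e : ∀ z ∈ U ∩ prj ⁻¹' W', mvfderiv (𝓡 n) (fun x => P (φ (prj x))) z (Z' z)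
        = (fun y => mvfderiv (𝓡 r) (fun y => P (φ y)) y (V' y)) (prj z) := fun z hz => by
      rw [mvfderiv_clm_comp P (SmoothFunOn.mdifferentiableAt hφπ hS hz),
        h.mvfderiv_chart_comp Set.inter_subset_right hZV' hz]
      beta_reduce
      rw [mvfderiv_clm_comp P (SmoothFunOn.mdifferentiableAt hφs hW'o hz.2)]
    rw [mvfderiv_congr ((hS.eventually_mem hxS).mono e), mvfderiv_comp_mfderiv
      (SmoothFunOn.mdifferentiableAt (contMDiffOn_mvfderiv_apply hW'o hf hV') hW'o hxW')
      (h.mdifferentiableAt hx.1), hZV x hxS]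
  rw [key X X' Y Y' (hY'.mono Set.inter_subset_left) (fun z hz => hXY z (hSS hz))
    (fun z hz => hXY' z (hSS hz)), key X' X Y' Y (hY.mono Set.inter_subset_left)
    (fun z hz => hXY' z (hSS hz)) (fun z hz => hXY z (hSS hz))]

theorem mfderiv_mlieBracket_field {W : Set N} (hW : IsOpen W) (hk : k.SmoothOn U) {X : VField n M}
    {Y : VField r N} (hX : X.SmoothOn (U ∩ prj ⁻¹' W)) (hY : Y.SmoothOn W)
    (hXY : ∀ x ∈ U ∩ prj ⁻¹' W, mfderiv (𝓡 n) (𝓡 r) prj x (X x) = Y (prj x)) {x : M}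
    (hx : x ∈ U ∩ prj ⁻¹' W) :
    mfderiv (𝓡 n) (𝓡 r) prj x (VectorField.mlieBracket (𝓡 n) k X x) = 0 := by
  rw [h.mfderiv_mlieBracket hW (hk.mono Set.inter_subset_left) hX VField.smoothOn_zero hY
    (fun z hz => h.k_mem_ker hz.1) hXY hx]
  have h0 := mlieBracket_fun_smul_right (X := Y) (f := fun _ => 0)
    (mdifferentiableAt_const (x := prj x)) (hY.diffAt hW hx.2)
  rw [VectorField.mlieBracket_swap_apply]
  simpa [mvfderiv_const] using h0

omit h in
/-- The push-forward of a vector field along a section of the projection. -/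
def _root_.ProjGeom.descField (prj : M → N) (σ : N → M) (X : VField n M) : VField r N := fun y =>
  mfderiv (𝓡 n) (𝓡 r) prj (σ y) (X (σ y))

variable {σ : N → M} (hσU : ∀ y, σ y ∈ U) (hσ : ∀ y, prj (σ y) = y)

include hσU hσ

/-- If `[k, X]` is vertical, the chart components of the projection of `X` have zero derivative
along `k`, hence are constant on the fibres. So the push-forward does not depend on the point of the
fibre picked by `σ`. -/
theorem descField_apply (hk : ∀ x ∈ U, k x ≠ 0) (hks : k.SmoothOn U) {W : Set N} (hW : IsOpen W)
    {X : VField n M} (hX : X.SmoothOn (U ∩ prj ⁻¹' W))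
    (hkX : ∀ x ∈ U ∩ prj ⁻¹' W,
      mfderiv (𝓡 n) (𝓡 r) prj x (VectorField.mlieBracket (𝓡 n) k X x) = 0) {x : M}
    (hx : x ∈ U ∩ prj ⁻¹' W) :
    descField prj σ X (prj x) = mfderiv (𝓡 n) (𝓡 r) prj x (X x) := by
  set φ := extChartAt (𝓡 r) (prj x) with hφ
  set W' := W ∩ (chartAt (EuclideanSpace ℝ (Fin r)) (prj x)).source with hW'
  have hW'o : IsOpen W' := hW.inter (chartAt (EuclideanSpace ℝ (Fin r)) (prj x)).open_source
  have hS := h.isOpen_preimage hW'o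
  have hSS : U ∩ prj ⁻¹' W' ⊆ U ∩ prj ⁻¹' W := fun z hz => ⟨hz.1, hz.2.1⟩
  have hxW' : prj x ∈ W' := ⟨hx.2, mem_chart_source _ _⟩
  have hxS : x ∈ U ∩ prj ⁻¹' W' := ⟨hx.1, hxW'⟩
  have hφπ : ContMDiffOn (𝓡 n) 𝓘(ℝ, EuclideanSpace ℝ (Fin r)) ∞ (fun x => φ (prj x))
      (U ∩ prj ⁻¹' W') := (h.chart_smoothOn (prj x)).mono fun z hz => ⟨hz.1, hz.2.2⟩
  -- Tangent spaces at `prj (σ (prj x))` and `prj x` share the model space; this moves a vector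
  -- along the equality of base points.
  have hcast : ∀ y' : N, y' = prj x → ∀ u : EuclideanSpace ℝ (Fin r),
      mvfderiv (𝓡 r) φ y' u = mvfderiv (𝓡 r) φ (prj x) u := by
    rintro _ rfl u
    rfl
  rw [← sub_eq_zero]
  refine mfderiv_extChartAt_injective (prj x) (mem_extChartAt_source _) ?_
  rw [map_sub, sub_eq_zero, ← h.mvfderiv_chart hx.1 hxW'.2]
  refine (hcast _ (hσ (prj x)) _).symm.trans ?_
  have hxσ : prj (σ (prj x)) ∈ W' := by rw [hσ]; exact hxW'
  refine (h.mvfderiv_chart (hσU _) hxσ.2 _).symm.trans ?_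
  ext i
  let P : EuclideanSpace ℝ (Fin r) →L[ℝ] ℝ := EuclideanSpace.proj i
  change P _ = P _
  have hg : SmoothFunOn n (fun x => P (φ (prj x))) (U ∩ prj ⁻¹' W') :=
    (P.contMDiff (n := ∞)).comp_contMDiffOn hφπ
  have hψ := contMDiffOn_mvfderiv_apply hS hg (hX.mono hSS)
  have hPd : ∀ z ∈ U ∩ prj ⁻¹' W', ∀ v, mvfderiv (𝓡 n) (fun x => P (φ (prj x))) z v
      = P (mvfderiv (𝓡 n) (fun x => φ (prj x)) z v) := fun z hz v =>
    mvfderiv_clm_comp P (SmoothFunOn.mdifferentiableAt hφπ hS hz) v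
  rw [← hPd _ ⟨hσU _, hxσ⟩, ← hPd _ hxS]
  refine h.eq_of_prj_eq hk hW'o (fun z hz => ⟨SmoothFunOn.mdifferentiableAt hψ hS hz, ?_⟩)
    (hσU _) hx.1 hxσ (hσ _)
  have h1 := mvfderiv_mlieBracket hS hg hz (hks.mono Set.inter_subset_left) (hX.mono hSS)
  rw [hPd z hz, h.mvfderiv_chart hz.1 hz.2.2, hkX z (hSS hz), mvfderiv_congr
    (f := fun y => mvfderiv (𝓡 n) (fun x => P (φ (prj x))) y (k y)) (g := fun _ => (0 : ℝ))
    ((hS.eventually_mem hz).mono fun y hy => by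
      beta_reduce
      rw [hPd y hy, h.mvfderiv_chart_k hy.1 hy.2.2, map_zero]), mvfderiv_const] at h1
  simpa using h1.symm

/-- The section `σ` need not be continuous. As the push-forward is independent of it, a smooth local
section may be used near each point. -/
theorem descField_smoothOn (hk : ∀ x ∈ U, k x ≠ 0) (hks : k.SmoothOn U) {W : Set N} (hW : IsOpen W)
    {X : VField n M} (hX : X.SmoothOn (U ∩ prj ⁻¹' W))
    (hkX : ∀ x ∈ U ∩ prj ⁻¹' W,
      mfderiv (𝓡 n) (𝓡 r) prj x (VectorField.mlieBracket (𝓡 n) k X x) = 0) :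
    VField.SmoothOn (descField (r := r) prj σ X) W := by
  intro y hy
  obtain ⟨s, hs, hss, hsp⟩ := h.exists_local_section (hσU y) (hk _ (hσU y))
  rw [hσ] at hs hss hsp
  have hS := h.isOpen_preimage hW
  have hσS : σ y ∈ U ∩ prj ⁻¹' W := ⟨hσU y, by rw [Set.mem_preimage, hσ]; exact hy⟩
  have h1 := contMDiffOn_mfderiv_apply hS (h.smooth.mono Set.inter_subset_left) hX
  have h2 := (h1.contMDiffAt (hS.mem_nhds hσS))
  rw [← hs] at h2
  refine ((h2.comp y hss).congr_of_eventuallyEq ?_).contMDiffWithinAt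
  have h3 : ∀ᶠ z in 𝓝 y, s z ∈ U ∩ prj ⁻¹' W := by
    refine hss.continuousAt.preimage_mem_nhds ?_
    rw [hs]
    exact hS.mem_nhds hσS
  filter_upwards [hsp, h3] with z hz hzS
  refine (congrArg (fun z => (⟨z, descField prj σ X z⟩ : TangentBundle (𝓡 r) N)) hz).symm.trans ?_
  exact congrArg _ (h.descField_apply hσU hσ hk hks hW hX hkX hzS)

end IsLocalLeafSpace

end Descent

/-! ### Transverse geometry -/

section TransverseGeometry

variable {n r : ℕ} {M : Type*} [TopologicalSpace M] [ChartedSpace (EuclideanSpace ℝ (Fin n)) M]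
  [IsManifold (𝓡 n) ∞ M]
  {N : Type*} [TopologicalSpace N] [ChartedSpace (EuclideanSpace ℝ (Fin r)) N]
  [IsManifold (𝓡 r) ∞ N]

/-! ### Algebra of scale data and invariance along the field -/

namespace IsScaleData

variable {k : VField n M} {U : Set M} {cov : ConnOp n M} {τ : OneForm n M}
  (d : IsScaleData k U cov τ)

include d

theorem form_field {x : M} (hx : x ∈ U) (hk : k x ≠ 0) : τ x (k x) = 1 := by
  have h1 := d.sq x hx (k x)
  rw [d.cov_field x hx, map_zero] at h1
  have h2 : (τ x (k x) - 1) • k x = 0 := by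
    rw [sub_smul, one_smul, h1]
    abel
  exact sub_eq_zero.1 ((smul_eq_zero.1 h2).resolve_right hk)

/-- Compute `A³ v` for `A = ∇k` as `A(A² v)` and as `A²(A v)`; only the second contains the term
`τ(A v) k`. -/
theorem form_cov {x : M} (hx : x ∈ U) (hk : k x ≠ 0) (v : TangentSpace (𝓡 n) x) :
    τ x (cov k x v) = 0 := by
  have h1 := d.sq x hx (cov k x v)
  rw [d.sq x hx v, map_add, map_neg, map_smul, d.cov_field x hx, smul_zero, add_zero,
    eq_comm, add_eq_left] at h1
  exact (smul_eq_zero.1 h1).resolve_right hk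

theorem smoothOn_cov [T2Space M] (hU : IsOpen U) {W : Set M} (hW : IsOpen W) (hWU : W ⊆ U)
    {X : VField n M} (hX : X.SmoothOn W) : VField.SmoothOn (fun y => cov k y (X y)) W :=
  d.affine.smoothOn_apply hU hW hWU (d.smooth_field.mono hWU) hX

variable (hL : ∀ W : Set M, IsOpen W → W ⊆ U → ∀ X Y : VField n M, X.SmoothOn W → Y.SmoothOn W →
  ∀ x ∈ W, lieDerivConn cov k X Y x = 0)

include hL

/-- Evaluate `L_k ∇ = 0` on the pair `(X, k)` and use `[k, k] = 0`. -/
theorem mlieBracket_cov {W : Set M} (hW : IsOpen W) (hWU : W ⊆ U)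
    {X : VField n M} (hX : X.SmoothOn W) {x : M} (hx : x ∈ W) :
    VectorField.mlieBracket (𝓡 n) k (fun y => cov k y (X y)) x
      = cov k x (VectorField.mlieBracket (𝓡 n) k X x) := by
  have h1 := hL W hW hWU X k hX (d.smooth_field.mono hWU) x hx
  have h2 : cov (VectorField.mlieBracket (𝓡 n) k k) x (X x) = 0 := by
    rw [show VectorField.mlieBracket (𝓡 n) k k = fun _ => 0 from
      funext fun y => mlieBracket_self_apply k y]
    exact d.affine.map_zero (hWU hx) _
  rw [lieDerivConn, h2, sub_zero, sub_eq_zero] at h1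
  exact h1

/-- Since `∇k` commutes with `L_k`, so does its square `-1 + τ ⊗ k`; comparing coefficients of `k`
gives the invariance of `τ`. -/
theorem form_mlieBracket [T2Space M] (hU : IsOpen U) (hk : ∀ x ∈ U, k x ≠ 0) {W : Set M}
    (hW : IsOpen W) (hWU : W ⊆ U) {X : VField n M} (hX : X.SmoothOn W) {x : M} (hx : x ∈ W) :
    τ x (VectorField.mlieBracket (𝓡 n) k X x)
      = mvfderiv (𝓡 n) (fun y => τ y (X y)) x (k x) := by
  have hAX := d.smoothOn_cov hU hW hWU hX
  have hτX : SmoothFunOn n (fun y => τ y (X y)) W := d.smooth_form W hW hWU X hX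
  have h1 := d.mlieBracket_cov hL hW hWU hAX hx
  have hkW := d.smooth_field.mono hWU
  have hneg : VField.DiffAt (fun y => (-1 : ℝ) • X y) x :=
    VField.DiffAt.smul mdifferentiableAt_const (hX.diffAt hW hx)
  rw [d.mlieBracket_cov hL hW hWU hX hx, d.sq x (hWU hx), mlieBracket_congr (X' := k)
    (Filter.Eventually.of_forall fun _ => rfl) ((hW.eventually_mem hx).mono fun y hy =>
      (d.sq y (hWU hy) (X y)).trans (by rw [← neg_one_smul ℝ (X y)])),
    mlieBracket_fun_add_right hneg ((VField.SmoothOn.smul hτX hkW).diffAt hW hx),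
    mlieBracket_fun_smul_right mdifferentiableAt_const (hX.diffAt hW hx),
    mlieBracket_fun_smul_right (SmoothFunOn.mdifferentiableAt hτX hW hx) (hkW.diffAt hW hx),
    mlieBracket_self_apply, mvfderiv_const] at h1
  simp only [zero_apply, zero_smul, zero_add, smul_zero, add_zero, neg_one_smul,
    add_right_inj] at h1
  exact (smul_left_injective ℝ (hk x (hWU hx)) h1).symm

end IsScaleData

/-- The horizontal lift of a vector field. -/
def horLiftField (τ : OneForm n M) (k : VField n M) (prj : M → N) (Y : VField r N) : VField n M :=
  fun x => horLift τ k prj x (Y (prj x))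

namespace IsLocalLeafSpace

variable {k : VField n M} {U : Set M} {prj : M → N} (h : IsLocalLeafSpace r k U prj)
  {τ : OneForm n M} {cov : ConnOp n M} {σ : N → M}

/-- Defined fibrewise at `σ y`. Restricting to points with `σ (prj x) = x` lets both sides live in
the same tangent space; independence of the point is proved later from invariance. -/
theorem exists_endField_desc (h : IsLocalLeafSpace r k U prj) (hτk : ∀ x ∈ U, τ x (k x) = 1)
    (hσU : ∀ y, σ y ∈ U) (B : EndField n M) :
    ∃ B' : EndField r N, ∀ x, σ (prj x) = x → ∀ w : TangentSpace (𝓡 r) (prj x),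
      B' (prj x) w = mfderiv (𝓡 n) (𝓡 r) prj x (B x (horLift τ k prj x w)) := by
  have h1 : ∀ y : N, ∃ L : EuclideanSpace ℝ (Fin r) →L[ℝ] EuclideanSpace ℝ (Fin r),
      ∀ w : EuclideanSpace ℝ (Fin r),
        L w = mfderiv (𝓡 n) (𝓡 r) prj (σ y) (B (σ y) (horLift τ k prj (σ y) w)) := fun y => by
    let f : TangentSpace (𝓡 r) (prj (σ y)) →ₗ[ℝ] TangentSpace (𝓡 r) (prj (σ y)) :=
      { toFun := fun w => mfderiv (𝓡 n) (𝓡 r) prj (σ y) (B (σ y) (horLift τ k prj (σ y) w))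
        map_add' := fun w w' => by
          rw [h.horLift_add (hσU y) (hτk _ (hσU y)), map_add, map_add]
        map_smul' := fun a w => by
          rw [h.horLift_smul (hσU y) (hτk _ (hσU y)), map_smul, map_smul]
          rfl }
    exact ⟨LinearMap.toContinuousLinearMap f, fun w => rfl⟩
  choose L hL using h1
  refine ⟨L, fun x hx w => (hL (prj x) w).trans ?_⟩
  have h2 : ∀ z, z = x → (mfderiv (𝓡 n) (𝓡 r) prj z (B z (horLift τ k prj z w)) :
      EuclideanSpace ℝ (Fin r)) = mfderiv (𝓡 n) (𝓡 r) prj x (B x (horLift τ k prj x w)) := by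
    rintro _ rfl
    rfl
  exact h2 _ hx

theorem descField_apply_section {X : VField n M} {x : M} (hx : σ (prj x) = x) :
    (descField prj σ X (prj x) : TangentSpace (𝓡 r) (prj x))
      = mfderiv (𝓡 n) (𝓡 r) prj x (X x) := by
  have h2 : ∀ z, z = x → (mfderiv (𝓡 n) (𝓡 r) prj z (X z) : EuclideanSpace ℝ (Fin r))
      = mfderiv (𝓡 n) (𝓡 r) prj x (X x) := by
    rintro _ rfl
    rfl
  exact h2 _ hx

include h

theorem horLift_mfderiv {x : M} (hx : x ∈ U) (hτk : τ x (k x) = 1) {v : TangentSpace (𝓡 n) x}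
    (hv : τ x v = 0) : horLift τ k prj x (mfderiv (𝓡 n) (𝓡 r) prj x v) = v :=
  (h.eq_horLift hx hτk hv rfl).symm

theorem mfderiv_horLiftField {Y : VField r N} {x : M} (hx : x ∈ U) :
    mfderiv (𝓡 n) (𝓡 r) prj x (horLiftField τ k prj Y x) = Y (prj x) :=
  h.mfderiv_horLift hx _

variable (hk : ∀ x ∈ U, k x ≠ 0) (d : IsScaleData k U cov τ)

include hk d

theorem horLiftField_smoothOn {W : Set N} (hW : IsOpen W) {Y : VField r N} (hY : Y.SmoothOn W) :
    (horLiftField τ k prj Y).SmoothOn (U ∩ prj ⁻¹' W) :=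
  h.smoothOn_horLift d.smooth_field d.smooth_form (fun x hx => d.form_field hx (hk x hx)) hW hY

theorem horLiftField_diffAt {Y : VField r N} {x : M} (hx : x ∈ U) (hY : Y.DiffAt (prj x)) :
    (horLiftField τ k prj Y).DiffAt x :=
  h.diffAt_horLift d.smooth_field d.smooth_form (fun x hx => d.form_field hx (hk x hx)) hx hY

/-- `∇k` acts on horizontal lifts. -/
theorem horLift_mfderiv_cov {x : M} (hx : x ∈ U) (v : TangentSpace (𝓡 n) x) :
    horLift τ k prj x (mfderiv (𝓡 n) (𝓡 r) prj x (cov k x v)) = cov k x v :=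
  h.horLift_mfderiv hx (d.form_field hx (hk x hx)) (d.form_cov hx (hk x hx) v)

variable [T2Space M]
  (hL : ∀ W : Set M, IsOpen W → W ⊆ U → ∀ X Y : VField n M, X.SmoothOn W → Y.SmoothOn W →
    ∀ x ∈ W, lieDerivConn cov k X Y x = 0)

include hL

/-- The bracket is vertical because the lift projects to `Y` and `k` to zero, and its
`k`-coefficient is the derivative along `k` of `τ` on the lift, which is zero. -/
theorem mlieBracket_horLiftField {W : Set N} (hW : IsOpen W) {Y : VField r N} (hY : Y.SmoothOn W)
    {x : M} (hx : x ∈ U ∩ prj ⁻¹' W) :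
    VectorField.mlieBracket (𝓡 n) k (horLiftField τ k prj Y) x = 0 := by
  have hS := h.isOpen_preimage hW
  have hYs := h.horLiftField_smoothOn hk d hW hY
  obtain ⟨a, ha⟩ := (h.ker x hx.1 _).1 (h.mfderiv_mlieBracket_field hW d.smooth_field hYs hY
    (fun z hz => h.mfderiv_horLiftField hz.1) hx)
  have h1 := d.form_mlieBracket hL h.isOpen hk hS Set.inter_subset_left hYs hx
  rw [mvfderiv_congr (f := fun y => τ y (horLiftField τ k prj Y y)) (g := fun _ => (0 : ℝ))
    ((hS.eventually_mem hx).mono fun y hy =>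
      apply_horLift (d.form_field hy.1 (hk y hy.1)) _), mvfderiv_const, ha, map_smul,
    d.form_field hx.1 (hk x hx.1), smul_eq_mul, mul_one] at h1
  have h2 : a = 0 := h1
  rw [ha, h2, zero_smul]

theorem mlieBracket_cov_horLiftField {W : Set N} (hW : IsOpen W) {Y : VField r N}
    (hY : Y.SmoothOn W) {x : M} (hx : x ∈ U ∩ prj ⁻¹' W) :
    VectorField.mlieBracket (𝓡 n) k (fun x => cov k x (horLiftField τ k prj Y x)) x = 0 := by
  rw [d.mlieBracket_cov hL (h.isOpen_preimage hW) Set.inter_subset_left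
    (h.horLiftField_smoothOn hk d hW hY) hx, h.mlieBracket_horLiftField hk d hL hW hY hx, map_zero]

theorem mlieBracket_cov_horLiftField₂ {W : Set N} (hW : IsOpen W) {Y Z : VField r N}
    (hY : Y.SmoothOn W) (hZ : Z.SmoothOn W) {x : M} (hx : x ∈ U ∩ prj ⁻¹' W) :
    VectorField.mlieBracket (𝓡 n) k
      (fun x => cov (horLiftField τ k prj Y) x (horLiftField τ k prj Z x)) x = 0 := by
  have hS := h.isOpen_preimage hW
  have h1 := hL _ hS Set.inter_subset_left _ _ (h.horLiftField_smoothOn hk d hW hZ)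
    (h.horLiftField_smoothOn hk d hW hY) x hx
  have h0 : VField.DiffAt (fun x => (0 : TangentSpace (𝓡 n) x)) x :=
    (VField.smoothOn_zero (U := Set.univ)).diffAt isOpen_univ (Set.mem_univ x)
  rw [lieDerivConn, h.mlieBracket_horLiftField hk d hL hW hZ hx, map_zero, sub_zero,
    d.affine.congr_near h.isOpen hx.1 h0 ((hS.eventually_mem hx).mono fun y hy =>
      h.mlieBracket_horLiftField hk d hL hW hY hy), d.affine.map_zero hx.1, sub_zero] at h1
  exact h1

theorem smoothOn_cov_horLiftField {W : Set N} (hW : IsOpen W) {Y Z : VField r N}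
    (hY : Y.SmoothOn W) (hZ : Z.SmoothOn W) :
    VField.SmoothOn (fun x => cov (horLiftField τ k prj Y) x (horLiftField τ k prj Z x))
      (U ∩ prj ⁻¹' W) :=
  d.affine.smoothOn_apply h.isOpen (h.isOpen_preimage hW) Set.inter_subset_left
    (h.horLiftField_smoothOn hk d hW hY) (h.horLiftField_smoothOn hk d hW hZ)

variable (hσU : ∀ y, σ y ∈ U) (hσ : ∀ y, prj (σ y) = y)

include hσU hσ

/-- The complex structure on the leaf space. -/
theorem exists_complexStructure : ∃ JN : EndField r N, JN.Smooth ∧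
    (∀ x ∈ U, ∀ w : TangentSpace (𝓡 r) (prj x),
      JN (prj x) w = mfderiv (𝓡 n) (𝓡 r) prj x (cov k x (horLift τ k prj x w))) := by
  have hτk : ∀ x ∈ U, τ x (k x) = 1 := fun x hx => d.form_field hx (hk x hx)
  obtain ⟨JN, hJN⟩ := h.exists_endField_desc hτk hσU (cov k)
  have hpt : ∀ y : N, ∃ x ∈ U, σ (prj x) = x ∧ prj x = y := fun y =>
    ⟨σ y, hσU y, by rw [hσ], hσ y⟩
  have hfield : ∀ (Y : VField r N) (y : N), JN y (Y y)
      = descField prj σ (fun x => cov k x (horLiftField τ k prj Y x)) y := by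
    intro Y y
    obtain ⟨x, hx, hxσ, rfl⟩ := hpt y
    rw [hJN x hxσ, descField_apply_section hxσ]
    rfl
  refine ⟨JN, fun W hW Y hY => ?_, fun x hx w => ?_⟩
  · refine VField.SmoothOn.congr (h.descField_smoothOn hσU hσ hk d.smooth_field hW
      (d.smoothOn_cov h.isOpen (h.isOpen_preimage hW) Set.inter_subset_left
        (h.horLiftField_smoothOn hk d hW hY)) fun x hx => ?_) fun y _ => hfield Y y
    rw [h.mlieBracket_cov_horLiftField hk d hL hW hY hx, map_zero]
  -- To pass from the chosen point of the fibre to any other, `w` is extended to a smooth field, to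
  -- which the descent of invariant fields applies.
  · obtain ⟨W, hW, hxW, hext⟩ := exists_localExt_smoothOn (n := r) (prj x)
    have hY := hext w
    have h1 := hfield (localExt w) (prj x)
    rw [h.descField_apply hσU hσ hk d.smooth_field hW
      (d.smoothOn_cov h.isOpen (h.isOpen_preimage hW) Set.inter_subset_left
        (h.horLiftField_smoothOn hk d hW hY)) (fun x hx => by
          rw [h.mlieBracket_cov_horLiftField hk d hL hW hY hx, map_zero]) ⟨hx, hxW⟩,
      horLiftField, localExt_self] at h1
    exact h1

/-- The affine connection on the leaf space. -/
theorem exists_affineConn : ∃ covN : ConnOp r N, IsAffineConnOn covN Set.univ ∧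
    ∀ W : Set N, IsOpen W → ∀ Y : VField r N, Y.SmoothOn W → ∀ x ∈ U ∩ prj ⁻¹' W,
      ∀ w : TangentSpace (𝓡 r) (prj x), covN Y (prj x) w
        = mfderiv (𝓡 n) (𝓡 r) prj x (cov (horLiftField τ k prj Y) x (horLift τ k prj x w)) := by
  have hτk : ∀ x ∈ U, τ x (k x) = 1 := fun x hx => d.form_field hx (hk x hx)
  choose covN hcovN using fun Y : VField r N =>
    h.exists_endField_desc hτk hσU (cov (horLiftField τ k prj Y))
  have hpt : ∀ y : N, ∃ x ∈ U, σ (prj x) = x ∧ prj x = y := fun y =>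
    ⟨σ y, hσU y, by rw [hσ], hσ y⟩
  have hfield : ∀ (Y Z : VField r N) (y : N), covN Y y (Z y) = descField prj σ
      (fun x => cov (horLiftField τ k prj Y) x (horLiftField τ k prj Z x)) y := by
    intro Y Z y
    obtain ⟨x, hx, hxσ, rfl⟩ := hpt y
    rw [hcovN Y x hxσ, descField_apply_section hxσ]
    rfl
  refine ⟨covN, IsAffineConnOn.of_smoothOn_apply isOpen_univ ⟨?_, ?_⟩ ?_, ?_⟩
  · intro Y Y' y hY hY' _
    ext1 w
    obtain ⟨x, hx, hxσ, rfl⟩ := hpt y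
    rw [add_apply, hcovN (Y + Y') x hxσ, hcovN Y x hxσ, hcovN Y' x hxσ, ← map_add,
      ← d.affine.map_add hx (h.horLiftField_diffAt hk d hx hY) (h.horLiftField_diffAt hk d hx hY'),
      d.affine.congr_near (Y := horLiftField τ k prj (Y + Y')) h.isOpen hx
        ((h.horLiftField_diffAt hk d hx hY).add
        (h.horLiftField_diffAt hk d hx hY')) ((h.isOpen.eventually_mem hx).mono fun z hz =>
          h.horLift_add hz (hτk z hz) _ _)]
  · intro Y f y hY hf _
    ext1 w
    obtain ⟨x, hx, hxσ, rfl⟩ := hpt y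
    have hYd := h.horLiftField_diffAt hk d hx hY
    have hfd : MDifferentiableAt (𝓡 n) 𝓘(ℝ, ℝ) (fun x => f (prj x)) x :=
      MDifferentiableAt.comp x hf (h.mdifferentiableAt hx)
    rw [hcovN (f • Y) x hxσ,
      d.affine.congr_near (Y := horLiftField τ k prj (f • Y)) h.isOpen hx
        (VField.DiffAt.smul hfd hYd)
        ((h.isOpen.eventually_mem hx).mono fun z hz => h.horLift_smul hz (hτk z hz) _ _),
      d.affine.map_smul hx hfd hYd, map_add, map_smul, map_smul, h.mfderiv_horLiftField hx,
      mvfderiv_comp_mfderiv hf (h.mdifferentiableAt hx), h.mfderiv_horLift hx, ← hcovN Y x hxσ]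
    rfl
  · intro Y hY W hW _ Z hZ
    exact VField.SmoothOn.congr (h.descField_smoothOn hσU hσ hk d.smooth_field hW
      (h.smoothOn_cov_horLiftField hk d hL hW (hY.mono (Set.subset_univ W)) hZ) fun x hx => by
        rw [h.mlieBracket_cov_horLiftField₂ hk d hL hW (hY.mono (Set.subset_univ W)) hZ hx,
          map_zero]) fun y _ => hfield Y Z y
  · intro W hW Y hY x hx w
    obtain ⟨W', hW', hxW', hext⟩ := exists_localExt_smoothOn (n := r) (prj x)
    have hWW := hW.inter hW'
    have hZ := (hext w).mono (W := W ∩ W') Set.inter_subset_right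
    have hY' := hY.mono (W := W ∩ W') Set.inter_subset_left
    have h1 := hfield Y (localExt w) (prj x)
    rw [h.descField_apply hσU hσ hk d.smooth_field hWW
      (h.smoothOn_cov_horLiftField hk d hL hWW hY' hZ) (fun x hx => by
        rw [h.mlieBracket_cov_horLiftField₂ hk d hL hWW hY' hZ hx, map_zero])
        ⟨hx.1, hx.2, hxW'⟩] at h1
    simp only [horLiftField, localExt_self] at h1
    exact h1

end IsLocalLeafSpace

end TransverseGeometry

/-! ### Comparison of scales -/

section ComparisonOfScales

variable {n r : ℕ} {M : Type*} [TopologicalSpace M] [ChartedSpace (EuclideanSpace ℝ (Fin n)) M]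
  [IsManifold (𝓡 n) ∞ M]
  {N : Type*} [TopologicalSpace N] [ChartedSpace (EuclideanSpace ℝ (Fin r)) N]
  [IsManifold (𝓡 r) ∞ N]

/-- Scale data which are invariant under the flow of `k`. -/
structure IsInvariantScaleData (k : VField n M) (U : Set M) (cov : ConnOp n M) (τ : OneForm n M) :
    Prop extends IsScaleData k U cov τ where
  lie : ∀ W : Set M, IsOpen W → W ⊆ U → ∀ X Y : VField n M, X.SmoothOn W → Y.SmoothOn W →
    ∀ x ∈ W, lieDerivConn cov k X Y x = 0
  div : ∀ x ∈ U, divergence cov k x = 0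

/-- The connection `covN` is the descent of `cov`, expressed in terms of horizontal lifts. -/
structure IsDescendedConn (k : VField n M) (U : Set M) (prj : M → N) (τ : OneForm n M)
    (cov : ConnOp n M) (covN : ConnOp r N) : Prop where
  affine : IsAffineConnOn covN Set.univ
  apply : ∀ W : Set N, IsOpen W → ∀ Y : VField r N, Y.SmoothOn W → ∀ x ∈ U ∩ prj ⁻¹' W,
    ∀ w : TangentSpace (𝓡 r) (prj x), covN Y (prj x) w
      = mfderiv (𝓡 n) (𝓡 r) prj x (cov (horLiftField τ k prj Y) x (horLift τ k prj x w))

/-- The endomorphism field `JN` is the descent of `∇k`, expressed in terms of horizontal lifts. -/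
def IsDescendedEnd (k : VField n M) (U : Set M) (prj : M → N) (τ : OneForm n M)
    (cov : ConnOp n M) (JN : EndField r N) : Prop :=
  ∀ x ∈ U, ∀ w : TangentSpace (𝓡 r) (prj x),
    JN (prj x) w = mfderiv (𝓡 n) (𝓡 r) prj x (cov k x (horLift τ k prj x w))

theorem mem_horizontal_iff {k : VField n M} {cov : ConnOp n M} {τ : OneForm n M} {x : M}
    (hτ : ∀ v, τ x v = schouten cov x v (k x)) {v : TangentSpace (𝓡 n) x} :
    v ∈ horizontal k cov x ↔ τ x v = 0 := by
  rw [hτ, horizontal, Set.mem_ofPred_eq, neg_eq_zero]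

namespace IsLocalLeafSpace

variable {k : VField n M} {U : Set M} {prj : M → N} (h : IsLocalLeafSpace r k U prj)
  {τ : OneForm n M} {cov : ConnOp n M} (hk : ∀ x ∈ U, k x ≠ 0)

include h hk

theorem horizontalBijOn (d : IsScaleData k U cov τ)
    (hτ : ∀ x ∈ U, ∀ v, τ x v = schouten cov x v (k x)) : HorizontalBijOn r k U prj cov := by
  intro x hx
  have hτk := d.form_field hx (hk x hx)
  refine ⟨fun v _ => Set.mem_univ _, fun v hv w hw hvw => ?_, fun w _ => ?_⟩
  · rw [mem_horizontal_iff (hτ x hx)] at hv hw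
    rw [h.eq_horLift hx hτk hv rfl, h.eq_horLift hx hτk hw rfl, hvw]
  · exact ⟨horLift τ k prj x w, (mem_horizontal_iff (hτ x hx)).2 (apply_horLift hτk w),
      h.mfderiv_horLift hx w⟩

theorem inducesEnd_iff (d : IsScaleData k U cov τ)
    (hτ : ∀ x ∈ U, ∀ v, τ x v = schouten cov x v (k x)) {JN : EndField r N}
    (hJN : IsDescendedEnd k U prj τ cov JN) (J' : EndField r N) :
    InducesEnd k U prj cov J' ↔ J' = JN := by
  constructor
  · intro hJ'
    funext y
    obtain ⟨x, hx, rfl⟩ : ∃ x ∈ U, prj x = y := h.surjective.symm.subset (Set.mem_univ y)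
    ext1 w
    have h1 := (hJ' x hx (horLift τ k prj x w) ((mem_horizontal_iff (hτ x hx)).2
      (apply_horLift (d.form_field hx (hk x hx)) w))).2
    rw [h.mfderiv_horLift hx] at h1
    rw [← h1, hJN x hx]
  · rintro rfl x hx v hv
    rw [mem_horizontal_iff (hτ x hx)] at hv ⊢
    exact ⟨d.form_cov hx (hk x hx) v, by
      rw [hJN x hx, h.horLift_mfderiv hx (d.form_field hx (hk x hx)) hv]⟩

/-- By uniqueness every horizontal lift of `Y` coincides with `horLiftField` on the open set over
`W`, and connections are local. -/
theorem inducesConn_iff (d : IsScaleData k U cov τ)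
    (hτ : ∀ x ∈ U, ∀ v, τ x v = schouten cov x v (k x)) {covN : ConnOp r N} :
    InducesConn k U prj cov covN ↔ IsDescendedConn k U prj τ cov covN := by
  constructor
  · rintro ⟨h1, h2⟩
    refine ⟨h1, fun W hW Y hY x hx w => ?_⟩
    have h3 := h2 W hW Y hY (horLiftField τ k prj Y) (fun z hz =>
      ⟨(mem_horizontal_iff (hτ z hz.1)).2 (apply_horLift (d.form_field hz.1 (hk z hz.1)) _),
        h.mfderiv_horLiftField hz.1⟩) x hx (horLift τ k prj x w)
      ((mem_horizontal_iff (hτ x hx.1)).2 (apply_horLift (d.form_field hx.1 (hk x hx.1)) _))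
    rwa [h.mfderiv_horLift hx.1] at h3
  · rintro ⟨h1, h2⟩
    refine ⟨h1, fun W hW Y hY X hX x hx v hv => ?_⟩
    rw [mem_horizontal_iff (hτ x hx.1)] at hv
    have hS := h.isOpen_preimage hW
    rw [h2 W hW Y hY x hx, h.horLift_mfderiv hx.1 (d.form_field hx.1 (hk x hx.1)) hv,
      d.affine.congr_near h.isOpen hx.1 ((h.horLiftField_smoothOn hk d hW hY).diffAt hS hx)
        ((hS.eventually_mem hx).mono fun z hz => h.eq_horLift hz.1
          (d.form_field hz.1 (hk z hz.1)) ((mem_horizontal_iff (hτ z hz.1)).1 (hX z hz).1)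
          (hX z hz).2)]

theorem descendedEnd_sq (d : IsScaleData k U cov τ) {JN : EndField r N}
    (hJN : IsDescendedEnd k U prj τ cov JN) (y : N) (w : TangentSpace (𝓡 r) y) :
    JN y (JN y w) = -w := by
  obtain ⟨x, hx, rfl⟩ : ∃ x ∈ U, prj x = y := h.surjective.symm.subset (Set.mem_univ y)
  rw [hJN x hx w, hJN x hx, h.horLift_mfderiv_cov hk d hx, d.sq x hx,
    apply_horLift (d.form_field hx (hk x hx)), zero_smul, add_zero, map_neg, h.mfderiv_horLift hx]

/-- No horizontality of `v` is needed, because `∇_k k = 0` removes the vertical part. -/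
theorem descendedEnd_mfderiv (d : IsScaleData k U cov τ) {JN : EndField r N}
    (hJN : IsDescendedEnd k U prj τ cov JN) {x : M} (hx : x ∈ U) (v : TangentSpace (𝓡 n) x) :
    JN (prj x) (mfderiv (𝓡 n) (𝓡 r) prj x v) = mfderiv (𝓡 n) (𝓡 r) prj x (cov k x v) := by
  have hτk := d.form_field hx (hk x hx)
  have h1 : horLift τ k prj x (mfderiv (𝓡 n) (𝓡 r) prj x v) = v - τ x v • k x :=
    (h.eq_horLift hx hτk (by rw [map_sub, map_smul, hτk, smul_eq_mul, mul_one, sub_self])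
      (by rw [map_sub, map_smul, h.k_mem_ker hx, smul_zero, sub_zero])).symm
  rw [hJN x hx, h1, map_sub, map_smul, d.cov_field x hx, smul_zero, sub_zero]

/-- The torsion identity is pushed forward with the brackets of lifts. For `∇J = 0`, the two error
terms of `IsScaleData.deriv` vanish: `τ` kills horizontal lifts and `k` projects to zero. -/
theorem descendedConn_torsionFreeComplex [T2Space M] (d : IsScaleData k U cov τ) {JN : EndField r N}
    (hJNs : JN.Smooth) (hJN : IsDescendedEnd k U prj τ cov JN) {covN : ConnOp r N}
    (hcovN : IsDescendedConn k U prj τ cov covN) : IsTorsionFreeComplexConn JN covN := by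
  have hpt : ∀ y : N, ∃ x ∈ U, prj x = y := fun y => h.surjective.symm.subset (Set.mem_univ y)
  refine ⟨hcovN.affine, hcovN.affine.isTorsionFreeOn_of_smooth isOpen_univ ?_,
    hcovN.affine.isComplexConn_of_smooth hJNs ?_⟩
  · intro W hW _ Y Z hY hZ y hy
    obtain ⟨x, hx, rfl⟩ := hpt y
    have hxS : x ∈ U ∩ prj ⁻¹' W := ⟨hx, hy⟩
    have hYs := h.horLiftField_smoothOn hk d hW hY
    have hZs := h.horLiftField_smoothOn hk d hW hZ
    have hS := h.isOpen_preimage hW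
    rw [hcovN.apply W hW Z hZ x hxS, hcovN.apply W hW Y hY x hxS, ← map_sub,
      ← h.mfderiv_mlieBracket hW hYs hZs hY hZ (fun z hz => h.mfderiv_horLiftField hz.1)
        (fun z hz => h.mfderiv_horLiftField hz.1) hxS]
    exact congrArg _ (d.torsionFree _ _ x hx (hYs.diffAt hS hxS) (hZs.diffAt hS hxS))
  · intro W hW Y hY y hy w
    obtain ⟨x, hx, rfl⟩ := hpt y
    have hxS : x ∈ U ∩ prj ⁻¹' W := ⟨hx, hy⟩
    have hYs := h.horLiftField_smoothOn hk d hW hY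
    have hS := h.isOpen_preimage hW
    have hAY := d.smoothOn_cov h.isOpen hS Set.inter_subset_left hYs
    rw [hcovN.apply W hW _ (hJNs W hW Y hY) x hxS, hcovN.apply W hW Y hY x hxS,
      h.descendedEnd_mfderiv hk d hJN hx,
      d.affine.congr_near (X := fun x => cov k x (horLiftField τ k prj Y x)) h.isOpen hx
        (hAY.diffAt hS hxS) ((hS.eventually_mem hxS).mono fun z hz => by
          rw [horLiftField, hJN z hz.1, h.horLift_mfderiv_cov hk d hz.1]
          rfl)]
    obtain ⟨a, ha⟩ := d.deriv _ hS Set.inter_subset_left _ hYs x hxS (horLift τ k prj x w)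
    rw [ha, map_add, map_smul, h.k_mem_ker hx, smul_zero, add_zero, horLiftField,
      apply_horLift (d.form_field hx (hk x hx)), zero_smul, add_zero]

/-- The counterpart for functions of the descent of vector fields: constancy on fibres, then a
smooth local section in place of `σ`. -/
theorem eq_descend [T2Space M] {W : Set N} (hW : IsOpen W) {σ : N → M} (hσU : ∀ y, σ y ∈ U)
    (hσ : ∀ y, prj (σ y) = y) {ψ : M → ℝ} (hψ : SmoothFunOn n ψ (U ∩ prj ⁻¹' W))
    (hkψ : ∀ x ∈ U ∩ prj ⁻¹' W, mvfderiv (𝓡 n) ψ x (k x) = 0) :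
    (∀ x ∈ U ∩ prj ⁻¹' W, ψ (σ (prj x)) = ψ x) ∧ SmoothFunOn r (fun y => ψ (σ y)) W := by
  have hS := h.isOpen_preimage hW
  have h0 : ∀ x ∈ U ∩ prj ⁻¹' W, ψ (σ (prj x)) = ψ x := fun x hx =>
    h.eq_of_prj_eq hk hW (fun z hz => ⟨SmoothFunOn.mdifferentiableAt hψ hS hz, hkψ z hz⟩)
      (hσU _) hx.1 (by rw [hσ]; exact hx.2) (hσ _)
  refine ⟨h0, fun y hy => ?_⟩
  obtain ⟨s, hs, hss, hsp⟩ := h.exists_local_section (hσU y) (hk _ (hσU y))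
  rw [hσ] at hs hss hsp
  have hσS : σ y ∈ U ∩ prj ⁻¹' W := ⟨hσU y, by rw [Set.mem_preimage, hσ]; exact hy⟩
  have h2 := hψ.contMDiffAt (hS.mem_nhds hσS)
  rw [← hs] at h2
  refine ((h2.comp y hss).congr_of_eventuallyEq ?_).contMDiffWithinAt
  have h3 : ∀ᶠ z in 𝓝 y, s z ∈ U ∩ prj ⁻¹' W := by
    refine hss.continuousAt.preimage_mem_nhds ?_
    rw [hs]
    exact hS.mem_nhds hσS
  filter_upwards [hsp, h3] with z hz hzS
  have := h0 _ hzS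
  rw [hz] at this
  exact this

end IsLocalLeafSpace

/-! ### Comparison of two scales -/

namespace IsInvariantScaleData

variable {k : VField n M} {U : Set M} {cov cov' : ConnOp n M} {τ τ' : OneForm n M}
  {Υ : OneForm n M} (d : IsInvariantScaleData k U cov τ) (d' : IsInvariantScaleData k U cov' τ')
  (hU : IsOpen U) (hk : ∀ x ∈ U, k x ≠ 0) (hch : IsProjChangeOn U cov Υ cov')

include d d' hU hch

/-- The divergence of `k` changes by `(n + 1) Υ(k)`, and it is zero in both scales. -/
theorem change_field {x : M} (hx : x ∈ U) : Υ x (k x) = 0 := by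
  have h1 : cov' k x = cov k x + (Υ x).smulRight (k x) + Υ x (k x) • .id ℝ _ := by
    ext1 v
    rw [hch k x hx (d.smooth_field.diffAt hU hx)]
    rfl
  have h2 := d'.div x hx
  have h3 : LinearMap.trace ℝ (TangentSpace (𝓡 n) x) ((Υ x).smulRight (k x)).toLinearMap
      = Υ x (k x) := LinearMap.trace_smulRight _ _
  have h4 : (cov' k x).toLinearMap = (cov k x).toLinearMap
      + ((Υ x).smulRight (k x)).toLinearMap + Υ x (k x) • LinearMap.id := by
    rw [h1]
    rfl
  have h5 : LinearMap.trace ℝ (TangentSpace (𝓡 n) x) (cov k x).toLinearMap = 0 := d.div x hx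
  rw [divergence, h4, map_add, map_add, h5, h3, map_smul, LinearMap.trace_id,
    finrank_tangentSpace, smul_eq_mul] at h2
  have h6 : ((n : ℝ) + 1) * Υ x (k x) = 0 := by linarith
  exact (mul_eq_zero.1 h6).resolve_left (by positivity)

theorem cov_change {x : M} (hx : x ∈ U) (v : TangentSpace (𝓡 n) x) :
    cov' k x v = cov k x v + Υ x v • k x := by
  rw [hch k x hx (d.smooth_field.diffAt hU hx), d.change_field d' hU hch hx, zero_smul, add_zero]

include hk

/-- Square `A' = A + Υ ⊗ k`, using `A' k = 0`, and compare coefficients of `k`. -/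
theorem form_change {x : M} (hx : x ∈ U) (v : TangentSpace (𝓡 n) x) :
    τ' x v = τ x v + Υ x (cov k x v) := by
  have h1 := d'.sq x hx v
  rw [d.cov_change d' hU hch hx v, map_add, map_smul, d'.cov_field x hx, smul_zero, add_zero,
    d.cov_change d' hU hch hx, d.sq x hx, add_assoc, add_right_inj, ← add_smul] at h1
  exact (smul_left_injective ℝ (hk x hx) h1).symm

/-- On horizontal vectors, the one-form of the change is `-τ' ∘ ∇k`. -/
theorem change_eq {x : M} (hx : x ∈ U) {v : TangentSpace (𝓡 n) x} (hv : τ x v = 0) :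
    Υ x v = -τ' x (cov k x v) := by
  rw [d.form_change d' hU hk hch hx, d.form_cov hx (hk x hx), d.sq x hx, hv, zero_smul, add_zero,
    zero_add, map_neg, neg_neg]

variable {prj : M → N} (h : IsLocalLeafSpace r k U prj)

include h

theorem horLift_change {x : M} (hx : x ∈ U) (w : TangentSpace (𝓡 r) (prj x)) :
    horLift τ' k prj x w = horLift τ k prj x w
      - Υ x (cov k x (horLift τ k prj x w)) • k x := by
  have hτk := d.form_field hx (hk x hx)
  have hτk' := d'.form_field hx (hk x hx)
  refine (h.eq_horLift hx hτk' ?_ ?_).symm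
  · rw [map_sub, map_smul, hτk', d.form_change d' hU hk hch hx,
      IsLocalLeafSpace.apply_horLift hτk]
    simp
  · rw [map_sub, map_smul, h.k_mem_ker hx, smul_zero, sub_zero, h.mfderiv_horLift hx]

theorem descendedEnd_change {JN : EndField r N} (hJN : IsDescendedEnd k U prj τ cov JN) :
    IsDescendedEnd k U prj τ' cov' JN := by
  intro x hx w
  rw [hJN x hx, d.horLift_change d' hU hk hch h hx, d.cov_change d' hU hch hx]
  simp [d.cov_field x hx, h.k_mem_ker hx]

/-- With `X` the old lift of `Y`, the new lift is `X - Υ(A X) k`. Differentiating the correction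
gives `-Υ(JY) Jw` modulo `k`; the corrected direction gives `-Υ(Jw) ∇_k X`, which projects to
`-Υ(Jw) JY`. The other two terms come from the projective change itself, with `Υ(k) = 0`. -/
theorem descendedConn_change [T2Space M] {JN : EndField r N}
    (hJN : IsDescendedEnd k U prj τ cov JN) {covN covN' : ConnOp r N}
    (hcovN : IsDescendedConn k U prj τ cov covN) (hcovN' : IsDescendedConn k U prj τ' cov' covN')
    (hΥ : Υ.SmoothOn U) {W : Set N} (hW : IsOpen W) {Y : VField r N} (hY : Y.SmoothOn W) {x : M}
    (hx : x ∈ U ∩ prj ⁻¹' W) (w : TangentSpace (𝓡 r) (prj x)) :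
    covN' Y (prj x) w = covN Y (prj x) w
      + Υ x (horLift τ k prj x w) • Y (prj x)
      + Υ x (horLift τ k prj x (Y (prj x))) • w
      - Υ x (horLift τ k prj x (JN (prj x) w)) • JN (prj x) (Y (prj x))
      - Υ x (horLift τ k prj x (JN (prj x) (Y (prj x)))) • JN (prj x) w := by
  have hS := h.isOpen_preimage hW
  have hX := h.horLiftField_smoothOn hk d.toIsScaleData hW hY
  have hXd := hX.diffAt hS hx
  have hkS := d.smooth_field.mono (W := U ∩ prj ⁻¹' W) Set.inter_subset_left
  have hf : SmoothFunOn n (fun z => -Υ z (cov k z (horLiftField τ k prj Y z))) (U ∩ prj ⁻¹' W) :=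
    ContMDiffOn.neg (hΥ _ hS Set.inter_subset_left _
      (d.smoothOn_cov h.isOpen hS Set.inter_subset_left hX))
  have hfd := SmoothFunOn.mdifferentiableAt hf hS hx
  have hkd := hkS.diffAt hS hx
  have hJ : ∀ w, horLift τ k prj x (JN (prj x) w) = cov k x (horLift τ k prj x w) := fun w => by
    rw [hJN x hx.1, h.horLift_mfderiv_cov hk d.toIsScaleData hx.1]
  have e1 : cov' (horLiftField τ' k prj Y) x (horLift τ' k prj x w)
      = cov' (horLiftField τ k prj Y) x (horLift τ' k prj x w)
        + ((-Υ x (cov k x (horLiftField τ k prj Y x))) • cov' k x (horLift τ' k prj x w)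
        + mvfderiv (𝓡 n) (fun z => -Υ z (cov k z (horLiftField τ k prj Y z))) x
          (horLift τ' k prj x w) • k x) := by
    rw [d'.affine.congr_near h.isOpen hx.1 (hXd.add (VField.DiffAt.smul hfd hkd))
      ((hS.eventually_mem hx).mono fun z hz => by
        rw [horLiftField, d.horLift_change d' hU hk hch h hz.1, neg_smul, sub_eq_add_neg]
        rfl), d'.affine.map_add hx.1 hXd (VField.DiffAt.smul hfd hkd),
      d'.affine.map_smul hx.1 hfd hkd]
  -- Torsion-freeness together with `[k, X] = 0` for the lift `X`.
  have e2 : cov (horLiftField τ k prj Y) x (k x) = cov k x (horLiftField τ k prj Y x) := by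
    have h1 := d.torsionFree k _ x hx.1 hkd hXd
    rw [h.mlieBracket_horLiftField hk d.toIsScaleData d.lie hW hY hx, sub_eq_zero] at h1
    exact h1
  rw [hcovN'.apply W hW Y hY x hx, hcovN.apply W hW Y hY x hx, e1, hch _ x hx.1 hXd,
    d.horLift_change d' hU hk hch h hx.1, d.cov_change d' hU hch hx.1, hJ, hJ]
  simp only [map_sub, map_add, map_smul, e2, h.k_mem_ker hx.1, d.cov_field x hx.1,
    d.change_field d' hU hch hx.1, smul_zero, sub_zero, add_zero, h.mfderiv_horLift hx.1,
    h.mfderiv_horLiftField hx.1, ← h.descendedEnd_mfderiv hk d.toIsScaleData hJN hx.1]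
  simp only [horLiftField]
  module

end IsInvariantScaleData

end ComparisonOfScales

/-! ### Descended change -/

section DescendedChange

variable {n r : ℕ} {M : Type*} [TopologicalSpace M] [ChartedSpace (EuclideanSpace ℝ (Fin n)) M]
  [IsManifold (𝓡 n) ∞ M]
  {N : Type*} [TopologicalSpace N] [ChartedSpace (EuclideanSpace ℝ (Fin r)) N]
  [IsManifold (𝓡 r) ∞ N]

namespace IsLocalLeafSpace

variable {k : VField n M} {U : Set M} {prj : M → N} (h : IsLocalLeafSpace r k U prj)
  {τ : OneForm n M} {σ : N → M}

theorem exists_oneForm_desc (h : IsLocalLeafSpace r k U prj) (hτk : ∀ x ∈ U, τ x (k x) = 1)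
    (hσU : ∀ y, σ y ∈ U) (θ : OneForm n M) :
    ∃ θ' : OneForm r N, ∀ x, σ (prj x) = x → ∀ w : TangentSpace (𝓡 r) (prj x),
      θ' (prj x) w = θ x (horLift τ k prj x w) := by
  have h1 : ∀ y : N, ∃ L : EuclideanSpace ℝ (Fin r) →L[ℝ] ℝ, ∀ w : EuclideanSpace ℝ (Fin r),
        L w = θ (σ y) (horLift τ k prj (σ y) w) := fun y => by
    let f : TangentSpace (𝓡 r) (prj (σ y)) →ₗ[ℝ] ℝ :=
      { toFun := fun w => θ (σ y) (horLift τ k prj (σ y) w)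
        map_add' := fun w w' => by
          rw [h.horLift_add (hσU y) (hτk _ (hσU y)), map_add]
        map_smul' := fun a w => by
          rw [h.horLift_smul (hσU y) (hτk _ (hσU y)), map_smul]
          rfl }
    exact ⟨LinearMap.toContinuousLinearMap f, fun w => rfl⟩
  choose L hL using h1
  refine ⟨L, fun x hx w => (hL (prj x) w).trans ?_⟩
  have h2 : ∀ z, z = x → θ z (horLift τ k prj z w) = θ x (horLift τ k prj x w) := by
    rintro _ rfl
    rfl
  exact h2 _ hx

end IsLocalLeafSpace

namespace IsInvariantScaleData

variable {k : VField n M} {U : Set M} {cov cov' : ConnOp n M} {τ τ' : OneForm n M}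
  {Υ : OneForm n M} (d : IsInvariantScaleData k U cov τ) (d' : IsInvariantScaleData k U cov' τ')
  (hk : ∀ x ∈ U, k x ≠ 0) (hch : IsProjChangeOn U cov Υ cov')
  {prj : M → N} (h : IsLocalLeafSpace r k U prj)

include d d' hk hch h

/-- The one-form of the change between two scales descends to the leaf space. -/
theorem exists_descendedForm [T2Space M] (hΥ : Υ.SmoothOn U) {σ : N → M} (hσU : ∀ y, σ y ∈ U)
    (hσ : ∀ y, prj (σ y) = y) : ∃ θ : OneForm r N, θ.SmoothOn Set.univ ∧
      ∀ x ∈ U, ∀ w : TangentSpace (𝓡 r) (prj x), θ (prj x) w = Υ x (horLift τ k prj x w) := by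
  have hτk : ∀ x ∈ U, τ x (k x) = 1 := fun x hx => d.form_field hx (hk x hx)
  obtain ⟨θ, hθ⟩ := h.exists_oneForm_desc hτk hσU Υ
  have hpt : ∀ y : N, ∃ x ∈ U, σ (prj x) = x ∧ prj x = y := fun y =>
    ⟨σ y, hσU y, by rw [hσ], hσ y⟩
  have hfield : ∀ (Y : VField r N) (y : N),
      θ y (Y y) = Υ (σ y) (horLiftField τ k prj Y (σ y)) := by
    intro Y y
    obtain ⟨x, hx, hxσ, rfl⟩ := hpt y
    rw [hθ x hxσ, hxσ]
    rfl
  have hdesc : ∀ W : Set N, IsOpen W → ∀ Y : VField r N, Y.SmoothOn W →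
      (∀ x ∈ U ∩ prj ⁻¹' W, Υ (σ (prj x)) (horLiftField τ k prj Y (σ (prj x)))
        = Υ x (horLiftField τ k prj Y x)) ∧
      SmoothFunOn r (fun y => Υ (σ y) (horLiftField τ k prj Y (σ y))) W := by
    intro W hW Y hY
    have hS := h.isOpen_preimage hW
    have hX := h.horLiftField_smoothOn hk d.toIsScaleData hW hY
    refine h.eq_descend hk hW hσU hσ (ψ := fun x => Υ x (horLiftField τ k prj Y x))
      (hΥ _ hS Set.inter_subset_left _ hX) fun x hx => ?_
    have h1 := d'.form_mlieBracket d'.lie h.isOpen hk hS Set.inter_subset_left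
      (d.smoothOn_cov h.isOpen hS Set.inter_subset_left hX) hx
    rw [h.mlieBracket_cov_horLiftField hk d.toIsScaleData d.lie hW hY hx, map_zero] at h1
    have hg := SmoothFunOn.mdifferentiableAt (d'.smooth_form _ hS Set.inter_subset_left _
      (d.smoothOn_cov h.isOpen hS Set.inter_subset_left hX)) hS hx
    -- On lifts `Υ = -τ' ∘ ∇k`. Invariance of `τ'` and the vanishing bracket of `k` with `∇k` of a
    -- lift then make this function constant along `k`.
    rw [mvfderiv_congr (f := fun x => Υ x (horLiftField τ k prj Y x))
      (g := fun x => (-1 : ℝ →L[ℝ] ℝ) (τ' x (cov k x (horLiftField τ k prj Y x))))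
      ((hS.eventually_mem hx).mono fun z hz => (d.change_eq d' h.isOpen hk hch hz.1
        (IsLocalLeafSpace.apply_horLift (hτk z hz.1) _)).trans (by simp; rfl)),
      mvfderiv_clm_comp _ hg, ← h1, map_zero]
  refine ⟨θ, fun W hW _ Y hY => ContMDiffOn.congr (hdesc W hW Y hY).2 fun y _ => hfield Y y,
    fun x hx w => ?_⟩
  obtain ⟨W, hW, hxW, hext⟩ := exists_localExt_smoothOn (n := r) (prj x)
  have h1 := (hfield (localExt w) (prj x)).trans ((hdesc W hW _ (hext w)).1 x ⟨hx, hxW⟩)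
  rw [horLiftField, localExt_self] at h1
  exact h1

/-- The change formula is known for smooth fields. Expanding a field differentiable at `y` in a
smooth frame, the derivatives of the coefficients contribute equally to both connections and the
rest is linear. -/
theorem cProjEquiv [T2Space M] {JN : EndField r N}
    (hJN : IsDescendedEnd k U prj τ cov JN) {covN covN' : ConnOp r N}
    (hcovN : IsDescendedConn k U prj τ cov covN) (hcovN' : IsDescendedConn k U prj τ' cov' covN')
    (hΥ : Υ.SmoothOn U) : CProjEquiv JN covN covN' := by
  choose σ hσU hσ using fun y : N => h.surjective.symm.subset (Set.mem_univ y)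
  obtain ⟨θ, hθs, hθ⟩ := d.exists_descendedForm d' hk hch h hΥ hσU hσ
  refine ⟨θ, hθs, fun Y y hY w => ?_⟩
  obtain ⟨V, hV, hyV, G, hG, hexp⟩ := exists_frame_expansion (n := r) y
  have hGd : ∀ i, (G i).DiffAt y := fun i => (hG i).diffAt hV hyV
  obtain ⟨c, hcd, hYc⟩ := hexp Y hY
  have hG' : ∀ i, covN' (G i) y w = covN (G i) y w + θ y w • G i y + θ y (G i y) • w
      - θ y (JN y w) • JN y (G i y) - θ y (JN y (G i y)) • JN y w := by
    intro i
    obtain ⟨x, hx, rfl⟩ : ∃ x ∈ U, prj x = y := ⟨σ y, hσU y, hσ y⟩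
    simp only [hθ x hx]
    exact d.descendedConn_change d' h.isOpen hk hch h hJN hcovN hcovN' hΥ hV (hG i) ⟨hx, hyV⟩ w
  have hYy : Y y = ∑ i, c i y • G i y := hYc.self_of_nhds
  rw [hcovN'.affine.eq_sum isOpen_univ (Set.mem_univ y) hGd hcd hYc,
    hcovN.affine.eq_sum isOpen_univ (Set.mem_univ y) hGd hcd hYc, hYy]
  simp only [hG', map_sum, map_smul, smul_eq_mul, Finset.smul_sum, Finset.sum_smul,
    ← Finset.sum_add_distrib, ← Finset.sum_sub_distrib]
  exact Finset.sum_congr rfl fun i _ => by module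

end IsInvariantScaleData

/-! ### Equivalence classes of connections and passage to invariant scale data -/

theorem CProjEquiv.symm {J : EndField n M} {c₁ c₂ : ConnOp n M} (h : CProjEquiv J c₁ c₂) :
    CProjEquiv J c₂ c₁ := by
  obtain ⟨Υ, hΥ, h⟩ := h
  refine ⟨fun x => -Υ x, fun W hW hWU X hX => ContMDiffOn.neg (hΥ W hW hWU X hX),
    fun σ x hσ v => ?_⟩
  rw [h σ x hσ v]
  simp only [neg_apply]
  module

theorem CProjEquiv.trans {J : EndField n M} {c₁ c₂ c₃ : ConnOp n M} (h : CProjEquiv J c₁ c₂)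
    (h' : CProjEquiv J c₂ c₃) : CProjEquiv J c₁ c₃ := by
  obtain ⟨Υ, hΥ, h⟩ := h
  obtain ⟨Υ', hΥ', h'⟩ := h'
  refine ⟨fun x => Υ x + Υ' x, fun W hW hWU X hX =>
    ContMDiffOn.add (hΥ W hW hWU X hX) (hΥ' W hW hWU X hX), fun σ x hσ v => ?_⟩
  rw [h' σ x hσ v, h σ x hσ v]
  simp only [add_apply]
  module

theorem CProjStructure.carrier_eq {J : EndField n M} (q : CProjStructure J) {c : ConnOp n M}
    (hc : c ∈ q.carrier) :
    q.carrier = {c' | IsTorsionFreeComplexConn J c' ∧ CProjEquiv J c c'} := by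
  obtain ⟨c₀, -, hq⟩ := q.isClass
  have h0 := (hq.subset hc).2
  rw [hq]
  exact Set.ext fun c' => and_congr_right fun _ =>
    ⟨fun h => h0.symm.trans h, fun h => h0.trans h⟩

/-- A c-projective structure is determined by any of its connections. -/
theorem CProjStructure.eq_of_mem {J : EndField n M} {q q' : CProjStructure J} {c : ConnOp n M}
    (hc : c ∈ q.carrier) (hc' : c ∈ q'.carrier) : q = q' := by
  have h := (q.carrier_eq hc).trans (q'.carrier_eq hc').symm
  cases q
  cases q'
  cases h
  rfl

theorem ProjStructure.exists_change_restrict (p : ProjStructure n M) {U : Set M}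
    {cov cov' : ConnOp n M} (hc : cov ∈ p.restrict U) (hc' : cov' ∈ p.restrict U) :
    ∃ Υ : OneForm n M, Υ.SmoothOn U ∧ IsProjChangeOn U cov Υ cov' := by
  obtain ⟨-, -, c₁, hc₁, Υ₁, hΥ₁, h₁⟩ := hc
  obtain ⟨-, -, c₂, hc₂, Υ₂, hΥ₂, h₂⟩ := hc'
  obtain ⟨Υ, hΥ, h⟩ := p.exists_change ⟨c₁, hc₁⟩ ⟨c₂, hc₂⟩
  refine ⟨fun x => Υ x + Υ₂ x - Υ₁ x, fun W hW hWU X hX => ?_, fun σ x hx hσ v => ?_⟩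
  · exact ContMDiffOn.sub (ContMDiffOn.add (hΥ W hW (Set.subset_univ W) X hX)
      (hΥ₂ W hW hWU X hX)) (hΥ₁ W hW hWU X hX)
  · rw [h₂ σ x hx hσ v, h σ x (Set.mem_univ x) hσ v, h₁ σ x hx hσ v]
    simp only [add_apply, sub_apply]
    module

theorem IsAdaptedScaleOn.isInvariantScaleData [T2Space M] {p : ProjStructure n M} {J : TractorEnd p}
    (hJ : IsParallelTractorComplexStructure p J) (hks : IsProjSymmetry p (underlyingField p J))
    {U : Set M} (hU : IsOpen U) (i₀ : Fin n) {cov : ConnOp n M}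
    (hcov : IsAdaptedScaleOn p (underlyingField p J) U cov) :
    IsInvariantScaleData (underlyingField p J) U cov (schoutenForm cov (underlyingField p J)) :=
  { (hJ.isScaleData hU hcov.1 hcov.2.2).2 with
    lie := fun _ hW hWU _ _ hX hY _ hx => hks.lieDerivConn_eq_zero hU
      (hJ.isScaleData hU hcov.1 hcov.2.2).2.smooth_field hcov.1 hcov.2.1 hcov.2.2 i₀ hW hWU hX hY hx
    div := hcov.2.2 }

end DescendedChange

end ProjGeom

end

/-! ### Assembly of the theorem -/

theorem mainTheorem10 (m : ℕ) (hm : 2 ≤ m)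
    {M : Type*} [TopologicalSpace M] [T2Space M] [SecondCountableTopology M]
    [ChartedSpace (EuclideanSpace ℝ (Fin (2 * m + 1))) M] [IsManifold (𝓡 (2 * m + 1)) ∞ M]
    (p : ProjStructure (2 * m + 1) M) (J : TractorEnd p)
    (hJ : IsParallelTractorComplexStructure p J)
    (hk : IsProjSymmetry p (underlyingField p J))
    {N : Type*} [TopologicalSpace N] [T2Space N] [SecondCountableTopology N]
    [ChartedSpace (EuclideanSpace ℝ (Fin (2 * m))) N] [IsManifold (𝓡 (2 * m)) ∞ N]
    (U : Set M) (prj : M → N) (hprj : IsLocalLeafSpace (2 * m) (underlyingField p J) U prj) :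
    (∀ x ∈ U, ∃ V : Set M, IsOpen V ∧ x ∈ V ∧ V ⊆ U ∧
      ∀ V' : Set M, IsOpen V' → V' ⊆ V →
        ∃ cov, IsAdaptedScaleOn p (underlyingField p J) V' cov) ∧
    ((∃ cov, IsAdaptedScaleOn p (underlyingField p J) U cov) →
      (∀ cov, IsAdaptedScaleOn p (underlyingField p J) U cov →
        HorizontalBijOn (2 * m) (underlyingField p J) U prj cov) ∧
      ∃ JN : EndField (2 * m) N, IsComplexStructure JN ∧
        (∀ cov, IsAdaptedScaleOn p (underlyingField p J) U cov →
          ∀ J' : EndField (2 * m) N, InducesEnd (underlyingField p J) U prj cov J' ↔ J' = JN) ∧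
        (∀ cov, IsAdaptedScaleOn p (underlyingField p J) U cov →
          ∃ covN : ConnOp (2 * m) N, InducesConn (underlyingField p J) U prj cov covN) ∧
        ∃! q : CProjStructure JN,
          ∀ cov, IsAdaptedScaleOn p (underlyingField p J) U cov →
            ∀ covN : ConnOp (2 * m) N, InducesConn (underlyingField p J) U prj cov covN → covN ∈ q.carrier) := by
  have h := hprj
  have hU := hprj.isOpen
  have hkU : (underlyingField p J).SmoothOn U :=
    (hJ.underlyingField_smoothOn Set.univ isOpen_univ).mono (Set.subset_univ U)
  have hk0 : ∀ x ∈ U, underlyingField p J x ≠ 0 := fun x hx => h.k_ne_zero rfl hx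
  refine ⟨fun x hx => h.exists_adaptedScale p hkU hx, ?_⟩
  rintro ⟨cov₀, hcov₀⟩
  have hd : ∀ cov, IsAdaptedScaleOn p (underlyingField p J) U cov → IsInvariantScaleData
      (underlyingField p J) U cov (schoutenForm cov (underlyingField p J)) := fun cov hcov =>
    hcov.isInvariantScaleData hJ hk hU 0
  have hτ : ∀ cov, IsAdaptedScaleOn p (underlyingField p J) U cov → ∀ x ∈ U, ∀ v,
      schoutenForm cov (underlyingField p J) x v = schouten cov x v (underlyingField p J x) :=
    fun cov hcov => (hJ.isScaleData hU hcov.1 hcov.2.2).1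
  -- A set-theoretic section suffices, since everything pushed forward along it is invariant.
  choose σ hσU hσ using fun y : N => h.surjective.symm.subset (Set.mem_univ y)
  have d₀ := hd cov₀ hcov₀
  obtain ⟨JN, hJNs, hJN⟩ := h.exists_complexStructure hk0 d₀.toIsScaleData d₀.lie hσU hσ
  have hconn : ∀ cov, IsAdaptedScaleOn p (underlyingField p J) U cov → ∃ covN : ConnOp (2 * m) N,
      IsDescendedConn (underlyingField p J) U prj (schoutenForm cov (underlyingField p J)) cov
        covN := fun cov hcov => by
    obtain ⟨covN, h1, h2⟩ :=
      h.exists_affineConn hk0 (hd cov hcov).toIsScaleData (hd cov hcov).lie hσU hσ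
    exact ⟨covN, h1, h2⟩
  -- The complex structure is built from `cov₀`; the change formulas show that every other adapted
  -- scale induces the same one.
  have hend : ∀ cov, IsAdaptedScaleOn p (underlyingField p J) U cov →
      IsDescendedEnd (underlyingField p J) U prj (schoutenForm cov (underlyingField p J)) cov
        JN := fun cov hcov => by
    obtain ⟨Υ, -, hch⟩ := p.exists_change_restrict hcov₀.1 hcov.1
    exact d₀.descendedEnd_change (hd cov hcov) hU hk0 hch h hJN
  have hcx : ∀ cov, IsAdaptedScaleOn p (underlyingField p J) U cov → ∀ covN : ConnOp (2 * m) N,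
      IsDescendedConn (underlyingField p J) U prj (schoutenForm cov (underlyingField p J)) cov
        covN → IsTorsionFreeComplexConn JN covN := fun cov hcov covN hcovN =>
    h.descendedConn_torsionFreeComplex hk0 (hd cov hcov).toIsScaleData hJNs (hend cov hcov) hcovN
  have hsq := h.descendedEnd_sq hk0 d₀.toIsScaleData hJN
  obtain ⟨covN₀, hcovN₀⟩ := hconn cov₀ hcov₀
  refine ⟨fun cov hcov => h.horizontalBijOn hk0 (hd cov hcov).toIsScaleData (hτ cov hcov), JN,
    ⟨hJNs, hsq, (hcx cov₀ hcov₀ covN₀ hcovN₀).isIntegrable hJNs hsq⟩, fun cov hcov J' =>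
    h.inducesEnd_iff hk0 (hd cov hcov).toIsScaleData (hτ cov hcov) (hend cov hcov) J',
    fun cov hcov => ?_,
    ⟨{cov | IsTorsionFreeComplexConn JN cov ∧ CProjEquiv JN covN₀ cov},
      covN₀, hcx cov₀ hcov₀ covN₀ hcovN₀, rfl⟩, fun cov hcov covN hcovN => ?_, fun q hq => ?_⟩
  · obtain ⟨covN, hcovN⟩ := hconn cov hcov
    exact ⟨covN, (h.inducesConn_iff hk0 (hd cov hcov).toIsScaleData (hτ cov hcov)).2 hcovN⟩
  · have hcovN' := (h.inducesConn_iff hk0 (hd cov hcov).toIsScaleData (hτ cov hcov)).1 hcovN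
    obtain ⟨Υ, hΥ, hch⟩ := p.exists_change_restrict hcov₀.1 hcov.1
    exact ⟨hcx cov hcov covN hcovN',
      d₀.cProjEquiv (hd cov hcov) hk0 hch h hJN hcovN₀ hcovN' hΥ⟩
  -- Any competing structure contains `covN₀`, and a class is determined by one of its members.
  · have h0 := hq cov₀ hcov₀ covN₀
      ((h.inducesConn_iff hk0 d₀.toIsScaleData (hτ cov₀ hcov₀)).2 hcovN₀)
    refine CProjStructure.eq_of_mem h0
      ⟨hcx cov₀ hcov₀ covN₀ hcovN₀, fun _ => 0, fun W _ _ X _ => ?_, fun Y y _ w => by simp⟩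
    exact contMDiffOn_const
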